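/- **Setting.** Let $d\ge 2$ and let $\Omega\subset\mathbb R^d$ be a bounded Lipschitz domain. Let $\mathcal T_h$ be a finite partition of $\Omega$ into non-overlapping open Lipschitz elements $K$, $\overline\Omega=\bigcup_K\overline K$, whose skeleton has finite $(d-1)$-dimensional Hausdorff measure; put $h_K=\operatorname{diam}K$, $h=\max_K h_K$. For $u$ piecewise in $H^2$, $p\ge1$ and $\omega>0$ let $[u]$ be the jump of the traces across the interior faces $\mathcal F_h^i$, let $\mathcal F_h^b$ be the boundary faces, and $$\|u\|_{DG}^2=\sum_K\|\nabla u\|_K^2+\omega^2\sum_K\|u\|_K^2+\tfrac{p^2}{h}\|[u]\|_{\mathcal F_h^i}^2+\omega\|u\|_{\mathcal F_h^b}^2,\qquad \|u\|_{DG^+}^2=\|u\|_{DG}^2+\sum_K p^{-2}h\,\|\nabla u\cdot n\|_{\partial K}^2 ,$$ and $\|z\|_{V,\omega}^2=\|\nabla z\|_\Omega^2+\omega^2\|z\|_\Omega^2$. Let $Q_h(K)=\mathbb P^{p-2}(K)$ (complex polynomials of total degree at most $p-2$; $\{0\}$ if $p=1$) with the norm $\|q\|_{Q_h(K)}^2=h_K^2\|\nabla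 q\|_K^2+p^2h_K\|q\|_{\partial K}^2$, let $\langle A_Ku,q\rangle=h_K(-\Delta u-\omega^2u,q)_K$ and $\langle A_{K,0}u,q\rangle=h_K(-\Delta u,q)_K$ for $q\in Q_h(K)$, let $\|A_0u\|_{Q_h'}^2=\sum_K\|A_{K,0}u\|_{Q_h(K)'}^2$, and let $$\mathbb T=\{v: v|_K\in\mathbb P^p(K),\ \langle A_Kv,q\rangle=0\ \ \forall q\in Q_h(K),\ \forall K\},\qquad \mathbb L=\{v: v|_K\in(|x-x_K|^2-r_K^2)\,\mathbb P^{p-2}(K)\ \ \forall K\},$$ where $x_K,r_K$ are the centre and radius of the ball $b_K$ in (A1). **Mesh conditions**, with shape parameters $\gamma_\star,c_{\rm out},C_{\rm bdry},C_{\rm sub}>0$, $n_{\max}\in\mathbb N$ and with $C_\Omega>0$: - (A0) $(1+\omega^2)h\le C_\Omega$. - (A1) For each $K$ there are balls $b_K\subset K\subset B_K$ with $\operatorname{diam}B_K\le\gamma_\star\operatorname{diam}b_K$, and $K$ is star-shaped with respect to $b_K$. - (A2) $\partial K$ is the disjoint union of at most $n_{\max}$ sets $F_i$ with $h_K\le C_{\rm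 bdry}\operatorname{diam}F_i$; for each $i$ there are a point $x_i^0\in K$ and a sub-element $K_{F_i}\subset K$, star-shaped with respect to $x_i^0$, with $h_K\le C_{\rm sub}\operatorname{diam}K_{F_i}$, and $(x-x_i^0)\cdot n(x)\ge c_{\rm out}h_K$ at all $x\in F_i$ where the outward unit normal $n(x)$ of $K$ exists. - (A3) Each $\partial K$ is a finite union of closed $C^1$ surfaces. **Statement.** There are constants $C_{\rm pf},C_{\rm itr}>0$, depending only on $d$ and the shape parameters; $c_{A,0}>0$, depending only on these, on $C_\Omega$ and on $p$; and $C_{\rm conf}>0$, depending only on $d$, the shape parameters, $C_\Omega$ and $\Omega$ (in particular all are independent of $h$, $\omega$ and the mesh), with the following properties. 1. For every element $K$ of a mesh satisfying (A1)–(A3): $\|v\|_K^2\le C_{\rm pf}\big(h_K^2\|\nabla v\|_K^2+h_K\|v\|_{\partial K}^2\big)$ for all $v\in H^1(K)$, and $\|q\|_{\partial K}\le C_{\rm itr}\,p\,h_K^{-1/2}\|q\|_K$ for all $p\ge1$, $q\in\mathbb P^p(K)$. 2. For all $p\ge1$, $\omega>0$ and all meshes satisfying (A0)–(A3): $\|A_0u_h\|_{Q_h'}\ge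 c_{A,0}\|u_h\|_{DG}$ for all $u_h\in\mathbb L$. 3. Let $p\ge1$, $\omega>0$, let the mesh satisfy (A0)–(A3), and let $1-\frac{2\sqrt{C_{\rm pf}}}{c_{A,0}}\sqrt{C_\Omega h}\ge C_2>0$. Then for every $z\in H^2(\Omega)$ there is $z_h\in\mathbb T$, of the form $z_h=v-w$ with $v$ piecewise affine and $w\in\mathbb L$, such that $$\|z-z_h\|_{DG^+}\le C^{(2)}\,h\,|z|_{H^2(\Omega)}+C^{(V)}\,\omega h\,\|z\|_{V,\omega},$$ where, with $C_*=\sqrt{1+C_{\rm itr}^2}$, $$C^{(2)}=C_{\rm conf}\Big(1+2C_*\sqrt{C_{\rm pf}}\,c_{A,0}^{-1}C_2^{-1}C_\Omega^2\Big),\qquad C^{(V)}=2C_*\sqrt{C_{\rm pf}}\,c_{A,0}^{-1}C_2^{-1}.$$ -/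

import Mathlib

open MeasureTheory Filter Topology Set
open scoped ENNReal NNReal

namespace TrefftzDG

noncomputable section

/-- The Euclidean space `ℝ^d`. -/
abbrev E (d : ℕ) := EuclideanSpace ℝ (Fin d)

/-- The `(d-1)`-dimensional surface measure: Hausdorff measure, normalised to agree with
Lebesgue measure on hyperplanes. -/
def surf (d : ℕ) : Measure (E d) := Measure.euclideanHausdorffMeasure (d - 1)

/-- `∫ |v|² dμ`. -/
def sqNorm {d : ℕ} (μ : Measure (E d)) (v : E d → ℂ) : ℝ≥0∞ := ∫⁻ x, ‖v x‖ₑ ^ 2 ∂μ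

/-- `‖v‖_U²`, the squared `L²(U)` norm. -/
def volSq {d : ℕ} (U : Set (E d)) (v : E d → ℂ) : ℝ≥0∞ := sqNorm (volume.restrict U) v

/-- `‖v‖_S²`, the squared `L²` norm on a piece `S` of a hypersurface. -/
def surfSq {d : ℕ} (S : Set (E d)) (v : E d → ℂ) : ℝ≥0∞ := sqNorm ((surf d).restrict S) v

/-! ### Sobolev spaces -/

/-- `g` is the weak partial derivative `∂ᵢ u` on the open set `U`. -/
def HasWeakDeriv {d : ℕ} (U : Set (E d)) (i : Fin d) (u g : E d → ℂ) : Prop :=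
  ∀ φ : E d → ℝ, ContDiff ℝ (⊤ : ℕ∞) φ → HasCompactSupport φ → tsupport φ ⊆ U →
    ∫ x in U, (fderiv ℝ φ x (EuclideanSpace.single i 1)) • u x = - ∫ x in U, φ x • g x

/-- `u` has a weak partial derivative `∂ᵢ u` in `L²(U)`. -/
def HasL2WeakDeriv {d : ℕ} (U : Set (E d)) (i : Fin d) (u : E d → ℂ) : Prop :=
  ∃ g : E d → ℂ, MemLp g 2 (volume.restrict U) ∧ HasWeakDeriv U i u g

open Classical in
/-- The weak partial derivative `∂ᵢ u ∈ L²(U)` (unique almost everywhere in `U`). -/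
def weakDeriv {d : ℕ} (U : Set (E d)) (i : Fin d) (u : E d → ℂ) : E d → ℂ :=
  if h : HasL2WeakDeriv U i u then h.choose else 0

/-- `u ∈ H¹(U)`. -/
def MemH1 {d : ℕ} (U : Set (E d)) (u : E d → ℂ) : Prop :=
  MemLp u 2 (volume.restrict U) ∧ ∀ i, HasL2WeakDeriv U i u

/-- `u ∈ H²(U)`. -/
def MemH2 {d : ℕ} (U : Set (E d)) (u : E d → ℂ) : Prop :=
  MemH1 U u ∧ ∀ i, MemH1 U (weakDeriv U i u)

/-- `‖∇u‖_U²`. -/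
def gradSq {d : ℕ} (U : Set (E d)) (u : E d → ℂ) : ℝ≥0∞ := ∑ i, volSq U (weakDeriv U i u)

/-- The seminorm `|u|_{H²(U)}`. -/
def h2Seminorm {d : ℕ} (U : Set (E d)) (u : E d → ℂ) : ℝ≥0∞ :=
  (∑ i, ∑ j, volSq U (weakDeriv U j (weakDeriv U i u))) ^ (1 / 2 : ℝ)

/-- The norm `‖u‖_{V,ω} = (‖∇u‖_U² + ω² ‖u‖_U²)^{1/2}`. -/
def vNorm {d : ℕ} (U : Set (E d)) (ω : ℝ) (u : E d → ℂ) : ℝ≥0∞ :=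
  (gradSq U u + ENNReal.ofReal (ω ^ 2) * volSq U u) ^ (1 / 2 : ℝ)

/-- The weak Laplacian of `u` on `U`. -/
def weakLaplacian {d : ℕ} (U : Set (E d)) (u : E d → ℂ) (x : E d) : ℂ :=
  ∑ i, weakDeriv U i (weakDeriv U i u) x

/-- `g ∈ L²(∂K)` is the trace of `v ∈ H¹(K)`: some smooth functions `φ n` converge to `v` in
`H¹(K)` while their restrictions to `∂K` converge to `g` in `L²(∂K)`. -/
def IsTrace {d : ℕ} (K : Set (E d)) (v g : E d → ℂ) : Prop :=
  MemH1 K v ∧ MemLp g 2 ((surf d).restrict (frontier K)) ∧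
  ∃ φ : ℕ → E d → ℂ, (∀ n, ContDiff ℝ (⊤ : ℕ∞) (φ n)) ∧
    Tendsto (fun n => volSq K (fun x => v x - φ n x)) atTop (𝓝 0) ∧
    (∀ i, Tendsto (fun n => volSq K (fun x =>
      weakDeriv K i v x - fderiv ℝ (φ n) x (EuclideanSpace.single i 1))) atTop (𝓝 0)) ∧
    Tendsto (fun n => surfSq (frontier K) (fun x => g x - φ n x)) atTop (𝓝 0)

open Classical in
/-- The trace of `v` on `∂K` (unique almost everywhere on `∂K` for Lipschitz `K`). -/
def trace {d : ℕ} (K : Set (E d)) (v : E d → ℂ) : E d → ℂ :=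
  if h : ∃ g, IsTrace K v g then h.choose else 0

/-! ### Domains, normals, hypersurfaces -/

/-- Near each of its boundary points, `U` is the set above the graph of a Lipschitz function, in
the coordinates given by some unit vector `ν` and its orthogonal complement. -/
def HasLipschitzBoundary {d : ℕ} (U : Set (E d)) : Prop :=
  ∀ x ∈ frontier U, ∃ ν : E d, ‖ν‖ = 1 ∧ ∃ (L : ℝ≥0) (ψ : E d → ℝ), LipschitzWith L ψ ∧
    ∃ r > 0, ∀ y ∈ Metric.ball x r,
      (y ∈ U ↔ ψ (y - (inner ℝ ν y : ℝ) • ν) < (inner ℝ ν y : ℝ))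

/-- A bounded domain with Lipschitz boundary. -/
def IsLipschitzDomain {d : ℕ} (U : Set (E d)) : Prop :=
  IsOpen U ∧ IsConnected U ∧ Bornology.IsBounded U ∧ HasLipschitzBoundary U

/-- `n` is the outward unit normal of `K` at `x`: the set `K` has a tangent half-space at `x`. -/
def IsOuterNormal {d : ℕ} (K : Set (E d)) (x n : E d) : Prop :=
  ‖n‖ = 1 ∧ ∀ ε > 0, ∃ r > 0, ∀ y ∈ Metric.ball x r,
    ((inner ℝ (y - x) n : ℝ) < -ε * ‖y - x‖ → y ∈ K) ∧
    (ε * ‖y - x‖ < (inner ℝ (y - x) n : ℝ) → y ∉ K)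

open Classical in
/-- The outward unit normal of `K` (it exists almost everywhere on `∂K` for Lipschitz `K`). -/
def outerNormal {d : ℕ} (K : Set (E d)) (x : E d) : E d :=
  if h : ∃ n, IsOuterNormal K x n then h.choose else 0

/-- The normal trace `∇u · n` on `∂K`. -/
def normalTrace {d : ℕ} (K : Set (E d)) (u : E d → ℂ) (x : E d) : ℂ :=
  ∑ i, ((outerNormal K x i : ℝ) : ℂ) * trace K (weakDeriv K i u) x

/-- `S` is a closed piece of a `C¹` hypersurface. -/
def IsClosedC1Piece {d : ℕ} (S : Set (E d)) : Prop :=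
  IsClosed S ∧ ∀ x ∈ S, ∃ g : E d → ℝ, ContDiff ℝ 1 g ∧ fderiv ℝ g x ≠ 0 ∧
    ∀ᶠ y in 𝓝 x, y ∈ S → g y = 0

/-! ### Meshes -/

/-- The uniform shape-regularity parameters; `cSub` quantifies the comparability
`h_{K_F} ≃ h_K` of the sub-elements. -/
structure ShapeParams where
  gam : ℝ
  cOut : ℝ
  cBdry : ℝ
  cSub : ℝ
  nMax : ℕ
  gam_pos : 0 < gam
  cOut_pos : 0 < cOut
  cBdry_pos : 0 < cBdry
  cSub_pos : 0 < cSub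

/-- A mesh of `Ω`: a finite partition of `Ω` into non-overlapping (open) Lipschitz elements `K`.
The data include the centre `x_K` and the radius `r_K` of the ball `b_K` inscribed in `K`. -/
structure Mesh {d : ℕ} (Ω : Set (E d)) where
  elems : Finset (Set (E d))
  ctr : Set (E d) → E d
  rad : Set (E d) → ℝ
  lipschitz : ∀ K ∈ elems, IsLipschitzDomain K
  subset : ∀ K ∈ elems, K ⊆ Ω
  disjoint : ∀ K ∈ elems, ∀ K' ∈ elems, K ≠ K' → Disjoint K K'
  cover : closure Ω = ⋃ K ∈ elems, closure K
  skeleton_finite : surf d (⋃ K ∈ elems, frontier K) < ⊤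

/-- The mesh size `h = sup_K diam K`. -/
def Mesh.h {d : ℕ} {Ω : Set (E d)} (T : Mesh Ω) : ℝ :=
  sSup (Metric.diam '' (T.elems : Set (Set (E d))))

/-- (A1): there are balls `b_K ⊆ K ⊆ B_K` with `diam B_K ≤ γ diam b_K`, and `K` is star-shaped
with respect to `b_K`. -/
def Mesh.A1 {d : ℕ} {Ω : Set (E d)} (T : Mesh Ω) (σ : ShapeParams) : Prop :=
  ∀ K ∈ T.elems, 0 < T.rad K ∧ Metric.ball (T.ctr K) (T.rad K) ⊆ K ∧
    (∃ (y : E d) (R : ℝ), K ⊆ Metric.closedBall y R ∧ R ≤ σ.gam * T.rad K) ∧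
    ∀ y ∈ Metric.ball (T.ctr K) (T.rad K), StarConvex ℝ y K

/-- (A2): `∂K` is partitioned into at most `n_max` pieces `F i` of diameter comparable to `h_K`,
each with a star-shaped sub-element whose star centre `x0` sees `F i` non-tangentially. -/
def Mesh.A2 {d : ℕ} {Ω : Set (E d)} (T : Mesh Ω) (σ : ShapeParams) : Prop :=
  ∀ K ∈ T.elems, ∃ (n : ℕ) (F : Fin n → Set (E d)), n ≤ σ.nMax ∧
    (∀ i j, i ≠ j → Disjoint (F i) (F j)) ∧ (⋃ i, F i) = frontier K ∧
    ∀ i, Metric.diam K ≤ σ.cBdry * Metric.diam (F i) ∧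
      ∃ (KF : Set (E d)) (x0 : E d), KF ⊆ K ∧ x0 ∈ K ∧ StarConvex ℝ x0 KF ∧
        Metric.diam K ≤ σ.cSub * Metric.diam KF ∧
        ∀ x ∈ F i, ∀ n, IsOuterNormal K x n →
          σ.cOut * Metric.diam K ≤ (inner ℝ (x - x0) n : ℝ)

/-- (A3): each `∂K` is a finite union of closed `C¹` surfaces. -/
def Mesh.A3 {d : ℕ} {Ω : Set (E d)} (T : Mesh Ω) : Prop :=
  ∀ K ∈ T.elems, ∃ (n : ℕ) (S : Fin n → Set (E d)),
    (∀ i, IsClosedC1Piece (S i)) ∧ (⋃ i, S i) = frontier K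

/-- The assumptions (A1), (A2), (A3). -/
def Mesh.ShapeRegular {d : ℕ} {Ω : Set (E d)} (T : Mesh Ω) (σ : ShapeParams) : Prop :=
  T.A1 σ ∧ T.A2 σ ∧ T.A3

/-- (A0): `(1 + ω²) h ≤ C_Ω`. -/
def Mesh.A0 {d : ℕ} {Ω : Set (E d)} (T : Mesh Ω) (ω CΩ : ℝ) : Prop :=
  (1 + ω ^ 2) * T.h ≤ CΩ

/-! ### DG norms -/

/-- `‖[u]‖²` on the interior faces. Every interior face, lying between two elements `K ≠ K'`, is
counted once for each order of the two, whence the factor `1/2`. -/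
def Mesh.jumpSq {d : ℕ} {Ω : Set (E d)} (T : Mesh Ω) (u : E d → ℂ) : ℝ≥0∞ :=
  open Classical in
  2⁻¹ * ∑ P ∈ T.elems.offDiag,
    surfSq (frontier P.1 ∩ frontier P.2 ∩ Ω) (fun x => trace P.1 u x - trace P.2 u x)

/-- `‖u‖²` on the boundary faces. -/
def Mesh.bdrySq {d : ℕ} {Ω : Set (E d)} (T : Mesh Ω) (u : E d → ℂ) : ℝ≥0∞ :=
  ∑ K ∈ T.elems, surfSq (frontier K ∩ frontier Ω) (trace K u)

/-- The square of the DG norm. -/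
def Mesh.dgSq {d : ℕ} {Ω : Set (E d)} (T : Mesh Ω) (ω : ℝ) (p : ℕ) (u : E d → ℂ) : ℝ≥0∞ :=
  ∑ K ∈ T.elems, gradSq K u + ENNReal.ofReal (ω ^ 2) * ∑ K ∈ T.elems, volSq K u
    + ENNReal.ofReal ((p : ℝ) ^ 2 / T.h) * T.jumpSq u + ENNReal.ofReal ω * T.bdrySq u

/-- The DG norm. -/
def Mesh.dgNorm {d : ℕ} {Ω : Set (E d)} (T : Mesh Ω) (ω : ℝ) (p : ℕ) (u : E d → ℂ) : ℝ≥0∞ :=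
  (T.dgSq ω p u) ^ (1 / 2 : ℝ)

/-- The DG⁺ norm. -/
def Mesh.dgPlusNorm {d : ℕ} {Ω : Set (E d)} (T : Mesh Ω) (ω : ℝ) (p : ℕ) (u : E d → ℂ) :
    ℝ≥0∞ :=
  (T.dgSq ω p u + ∑ K ∈ T.elems,
    ENNReal.ofReal (T.h / (p : ℝ) ^ 2) * surfSq (frontier K) (normalTrace K u)) ^ (1 / 2 : ℝ)

/-! ### Discrete spaces and local operators -/

/-- Polynomials in `d` real variables with complex coefficients. -/
abbrev Poly (d : ℕ) := MvPolynomial (Fin d) ℂ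

/-- The function on `ℝ^d` defined by a polynomial. -/
def polyFun {d : ℕ} (q : Poly d) (x : E d) : ℂ := MvPolynomial.eval (fun i => ((x i : ℝ) : ℂ)) q

/-- `ℙ^p`, the polynomials of total degree at most `p`. -/
abbrev polySpace (d p : ℕ) : Submodule ℂ (Poly d) := MvPolynomial.restrictTotalDegree (Fin d) ℂ p

/-- `ℙ^{p-2}`, the local test space `Q_h(K)`; it is `{0}` for `p < 2`. -/
def testSpace (d p : ℕ) : Submodule ℂ (Poly d) := if 2 ≤ p then polySpace d (p - 2) else ⊥

/-- The norm of `Q_h(K)`: `‖q‖² = h_K² ‖∇q‖_K² + p² h_K ‖q‖_{∂K}²`. -/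
def testNorm {d : ℕ} (p : ℕ) (K : Set (E d)) (q : Poly d) : ℝ≥0∞ :=
  (ENNReal.ofReal (Metric.diam K ^ 2) * ∑ i, volSq K (polyFun (MvPolynomial.pderiv i q))
    + ENNReal.ofReal ((p : ℝ) ^ 2 * Metric.diam K) * surfSq (frontier K) (polyFun q)) ^ (1 / 2 : ℝ)

/-- `⟨A_K u, q⟩ = h_K (-Δu - ω² u, q)_K`. For `ω = 0` this is the prototype `⟨A_{K,0} u, q⟩`. -/
def localOp {d : ℕ} (ω : ℝ) (K : Set (E d)) (u : E d → ℂ) (q : Poly d) : ℂ :=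
  (Metric.diam K : ℂ) *
    ∫ x in K, (-weakLaplacian K u x - (ω : ℂ) ^ 2 * u x) * (starRingEnd ℂ) (polyFun q x)

/-- The dual norm `‖A_0 u‖_{Q_h'} = (∑_K ‖A_{K,0} u‖_{Q_h(K)'}²)^{1/2}` of the prototype. -/
def Mesh.protoDualNorm {d : ℕ} {Ω : Set (E d)} (T : Mesh Ω) (p : ℕ) (u : E d → ℂ) : ℝ≥0∞ :=
  (∑ K ∈ T.elems, (⨆ q ∈ testSpace d p, ‖localOp 0 K u q‖ₑ / testNorm p K q) ^ 2) ^ (1 / 2 : ℝ)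

/-- `u` is, on each element, a polynomial of degree at most `p`. -/
def Mesh.IsPiecewisePoly {d : ℕ} {Ω : Set (E d)} (T : Mesh Ω) (p : ℕ) (u : E d → ℂ) : Prop :=
  ∀ K ∈ T.elems, ∃ q ∈ polySpace d p, ∀ x ∈ K, u x = polyFun q x

/-- The Trefftz space `𝕋`. -/
def Mesh.IsTrefftz {d : ℕ} {Ω : Set (E d)} (T : Mesh Ω) (ω : ℝ) (p : ℕ) (u : E d → ℂ) : Prop :=
  T.IsPiecewisePoly p u ∧ ∀ K ∈ T.elems, ∀ q ∈ testSpace d p, localOp ω K u q = 0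

/-- The space `𝕃` with local spaces `𝕃(K) = (|x - x_K|² - r_K²) ℙ^{p-2}(K)`. -/
def Mesh.IsBubble {d : ℕ} {Ω : Set (E d)} (T : Mesh Ω) (p : ℕ) (u : E d → ℂ) : Prop :=
  ∀ K ∈ T.elems, ∃ q ∈ testSpace d p, ∀ x ∈ K,
    u x = ((‖x - T.ctr K‖ ^ 2 - T.rad K ^ 2 : ℝ) : ℂ) * polyFun q x

/-! ### The inequalities defining the constants -/

/-- Scaled Poincaré–Friedrichs inequality on `K` with constant `C`. -/
def PoincareFriedrichs {d : ℕ} (K : Set (E d)) (C : ℝ) : Prop :=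
  ∀ v, MemH1 K v → volSq K v ≤ ENNReal.ofReal C *
    (ENNReal.ofReal (Metric.diam K ^ 2) * gradSq K v
      + ENNReal.ofReal (Metric.diam K) * surfSq (frontier K) (trace K v))

/-- Polynomial inverse trace inequality on `K` with constant `C`, for all degrees `p ≥ 1`. -/
def InverseTrace {d : ℕ} (K : Set (E d)) (C : ℝ) : Prop :=
  ∀ p : ℕ, 1 ≤ p → ∀ q ∈ polySpace d p,
    (surfSq (frontier K) (polyFun q)) ^ (1 / 2 : ℝ) ≤
      ENNReal.ofReal (C * p * Metric.diam K ^ (-(1 / 2) : ℝ)) *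
        (volSq K (polyFun q)) ^ (1 / 2 : ℝ)

/-- Coercivity of the prototype operator on `𝕃` with constant `c`. -/
def Mesh.ProtoCoercive {d : ℕ} {Ω : Set (E d)} (T : Mesh Ω) (ω : ℝ) (p : ℕ) (c : ℝ) : Prop :=
  ∀ u, T.IsBubble p u → ENNReal.ofReal c * T.dgNorm ω p u ≤ T.protoDualNorm p u

end

end TrefftzDG

open TrefftzDG

/-! Every constant is produced by the inscribed ball of (A1). Let `K` be star-shaped with respect to
the ball of radius `r` about `c` and contained in the concentric ball of radius `ρ r`, with `ρ =
2γ⋆`. The gauge of `K` about `c` is `1/r`-Lipschitz, and the radial projection π sends the shell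
`1/2 < gauge < 1` to `∂K`. The part of the shell that π sends into a δ-ball about a boundary point
has volume at least of order `r δ^(d-1)`. A packing argument turns this into the bound of the
surface measure by `C r⁻¹` times the image of volume under π (`IsStarBall.surf_restrict_le`).
Boundary integrals are thus dominated by integrals over rays, without normals or a divergence
theorem.

Item 1. For `C¹` functions, integrating the derivative along rays gives the trace inequality, and
integrating along segments from the inscribed ball to `K` gives the Poincaré inequality. Contraction
towards `c` followed by mollification makes smooth functions dense in `H¹(K)`, so traces exist and
both inequalities pass to the limit. Friedrichs' inequality follows by subtracting a constant, whose
size is read off on `∂K` because `∂K` has surface measure at least that of a `(d-1)`-ball of radius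
`r`. For polynomials the derivative is replaced by the one-dimensional bound `|P(0)|² ≤ (p+1)² ∫₀¹
|P|²` (`enorm_eval_zero_sq_le`), which supplies the explicit factor `p`.

Item 2. The map `q ↦ Δ((|y|² - 1) q)` is injective on polynomials
(`eq_zero_of_polyLap_bubble_eq_zero`). Equivalence of norms on a reference ball and scaling then
bound a bubble and its derivatives on `K` by its Laplacian (`exists_bubble_const`). Since `ΔW` has
degree at most `p - 2`, the function `-ΔW` is an admissible test function and shows that the dual
norm controls `r ‖ΔW‖`. The DG norm of a bubble is controlled by the same quantity, by the trace
inequality, a bounded overlap count and (A0).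

Item 3. On each element, take `v` affine by two uses of the Poincaré inequality. As `Δv = 0`, the
Trefftz condition for `v - w` is the discrete equation `(Δw + ω² w - ω² v, q) = 0`. For small `ω²
r²` it is a perturbation of the invertible map `w ↦ Δw`, so it has a solution with `‖Δw‖ ≤ 2ω² ‖v‖`
(`exists_variational_solution`). Summation gives an `O(h)` estimate (`Mesh.A1.exists_trefftz`).
Finally, coercivity survives a decrease of its constant, so `cA0` is taken so small that `cA0⁻¹`
dominates `p` and the bubble constant. Then the prescribed `C^(2)` and `C^(V)` are large enough, and
the smallness assumption of item 3 yields the smallness of `ω² r²`. -/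

namespace TrefftzDG

/-! ### Elements star-shaped with respect to a ball. -/

variable {d : ℕ}

/-- `K` is open, contains `ball c r`, is star-shaped with respect to all its points, and is contained
in a concentric ball of radius `ρ r`. -/
structure IsStarBall (K : Set (E d)) (c : E d) (r ρ : ℝ) : Prop where
  isOpen : IsOpen K
  pos : 0 < r
  ball_subset : Metric.ball c r ⊆ K
  subset_closedBall : K ⊆ Metric.closedBall c (ρ * r)
  starConvex : ∀ y ∈ Metric.ball c r, StarConvex ℝ y K

namespace IsStarBall

variable {K : Set (E d)} {c : E d} {r ρ : ℝ}

theorem center_mem (h : IsStarBall K c r ρ) : c ∈ K := h.ball_subset (Metric.mem_ball_self h.pos)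

theorem bounded (h : IsStarBall K c r ρ) : Bornology.IsBounded K :=
  Metric.isBounded_closedBall.subset h.subset_closedBall

theorem closure_subset (h : IsStarBall K c r ρ) : closure K ⊆ Metric.closedBall c (ρ * r) :=
  closure_minimal h.subset_closedBall Metric.isClosed_closedBall

theorem isCompact_frontier (h : IsStarBall K c r ρ) : IsCompact (frontier K) :=
  (Metric.isCompact_of_isClosed_isBounded isClosed_closure h.bounded.closure).of_isClosed_subset
    isClosed_frontier frontier_subset_closure

theorem volume_lt_top (h : IsStarBall K c r ρ) : volume K < ⊤ := h.bounded.measure_lt_top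

/-- Every `z` in this ball is `(1 - t) b + t x'` with `b` in the inscribed ball and `x' ∈ K`. A
nearby `x'` replaces `x` because `x` may lie on the boundary; the slack in the radius pays for it.
-/
theorem ball_lineMap_subset (h : IsStarBall K c r ρ) {x : E d} (hx : x ∈ closure K) {t : ℝ}
    (ht0 : 0 ≤ t) (ht1 : t < 1) : Metric.ball (c + t • (x - c)) ((1 - t) * r) ⊆ K := by
  intro z hz
  rw [mem_ball_iff_norm] at hz
  obtain ⟨x', hx', hd⟩ := Metric.mem_closure_iff.1 hx ((1 - t) * r - ‖z - (c + t • (x - c))‖)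
    (by linarith)
  rw [dist_eq_norm] at hd
  have h1 : 0 < 1 - t := by linarith
  have hb : (1 - t)⁻¹ • (z - t • x') ∈ Metric.ball c r := by
    rw [mem_ball_iff_norm]
    have e : (1 - t)⁻¹ • (z - t • x') - c
        = (1 - t)⁻¹ • ((z - (c + t • (x - c))) + t • (x - x')) := by
      have : c = (1 - t)⁻¹ • ((1 - t) • c) := by rw [smul_smul, inv_mul_cancel₀ h1.ne', one_smul]
      nth_rewrite 1 [this]
      rw [← smul_sub]
      congr 1
      module
    rw [e, norm_smul, Real.norm_of_nonneg (by positivity), inv_mul_lt_iff₀ h1]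
    calc _ ≤ ‖z - (c + t • (x - c))‖ + ‖t • (x - x')‖ := norm_add_le _ _
      _ ≤ ‖z - (c + t • (x - c))‖ + ‖x - x'‖ := by
        rw [norm_smul, Real.norm_of_nonneg ht0]
        gcongr
        exact mul_le_of_le_one_left (norm_nonneg _) ht1.le
      _ < _ := by linarith
  have := h.starConvex _ hb hx' h1.le ht0 (by ring)
  rwa [smul_smul, mul_inv_cancel₀ h1.ne', one_smul, sub_add_cancel] at this

theorem lineMap_mem (h : IsStarBall K c r ρ) {x : E d} (hx : x ∈ closure K) {t : ℝ}
    (ht0 : 0 ≤ t) (ht1 : t < 1) : c + t • (x - c) ∈ K :=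
  h.ball_lineMap_subset hx ht0 ht1 (Metric.mem_ball_self (mul_pos (by linarith) h.pos))

end IsStarBall

/-! ### The gauge and the radial projection. -/

/-- The gauge of `K` with respect to the centre `c`. -/
noncomputable def starGauge (K : Set (E d)) (c x : E d) : ℝ := gauge ((fun y => c + y) ⁻¹' K) (x - c)

/-- Radial projection onto the boundary of `K`. -/
noncomputable def radProj (K : Set (E d)) (c x : E d) : E d := c + (starGauge K c x)⁻¹ • (x - c)

/-- The outer shell `{1/2 < g < 1}` of `K`. -/
def shell (K : Set (E d)) (c : E d) : Set (E d) := {x | 1 / 2 < starGauge K c x ∧ starGauge K c x < 1}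

namespace IsStarBall

variable {K : Set (E d)} {c : E d} {r ρ : ℝ}

theorem starGauge_smul {s : ℝ} (hs : 0 ≤ s) (x : E d) :
    starGauge K c (c + s • (x - c)) = s * starGauge K c x := by
  rw [starGauge, starGauge, add_sub_cancel_left, gauge_smul_of_nonneg hs, smul_eq_mul]

theorem absorbent (h : IsStarBall K c r ρ) : Absorbent ℝ ((fun y => c + y) ⁻¹' K) := by
  refine absorbent_nhds_zero ?_
  have : Continuous (fun y : E d => c + y) := by fun_prop
  exact this.continuousAt.preimage_mem_nhds (by simpa using h.isOpen.mem_nhds h.center_mem)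

theorem mem_of_starGauge_lt (h : IsStarBall K c r ρ) {x : E d} (hx : starGauge K c x < 1) :
    x ∈ K := by
  obtain ⟨b, hb0, hb1, k, hk, e⟩ := exists_lt_of_gauge_lt h.absorbent hx
  have := h.lineMap_mem (subset_closure hk) hb0.le hb1
  simp only [add_sub_cancel_left] at this
  simp only at e
  rw [e] at this
  simpa using this

theorem starGauge_lt_one (h : IsStarBall K c r ρ) {x : E d} (hx : x ∈ K) : starGauge K c x < 1 := by
  refine gauge_lt_one_of_mem_of_isOpen ?_ (by simpa using hx)
  exact h.isOpen.preimage (by fun_prop)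

/-- Choose `t` just above the gauge of `y` and `s` just above `‖x - y‖ / r`. Then `x - c` is a
vector of `t (K - c)` plus a vector of `s` times the centred ball. The convex combination with
weights `t/(t+s)` and `s/(t+s)` joins a point of `K` to a point of the ball, so star-shapedness
suffices and convexity of `K` is not required. -/
theorem starGauge_le_add (h : IsStarBall K c r ρ) (x y : E d) :
    starGauge K c x ≤ starGauge K c y + ‖x - y‖ / r := by
  refine le_of_forall_pos_lt_add fun ε hε => ?_
  obtain ⟨t, ht0, ht1, k, hk, e⟩ := exists_lt_of_gauge_lt h.absorbent
    (show gauge _ (y - c) < starGauge K c y + ε / 2 by unfold starGauge; linarith)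
  simp only at e
  have hr := h.pos
  set s := ‖x - y‖ / r + ε / 4 with hs
  have hs0 : 0 < s := by positivity
  have hb : c + s⁻¹ • (x - y) ∈ Metric.ball c r := by
    rw [mem_ball_iff_norm, add_sub_cancel_left, norm_smul, Real.norm_of_nonneg (by positivity),
      inv_mul_lt_iff₀ hs0, hs, add_mul, div_mul_cancel₀ _ hr.ne']
    have : 0 < ε / 4 * r := by positivity
    linarith
  have hts : 0 < t + s := by positivity
  have hm := h.starConvex _ hb hk (a := s / (t + s)) (b := t / (t + s)) (by positivity)
    (by positivity) (by field_simp; ring)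
  have : starGauge K c x ≤ t + s := by
    refine gauge_le_of_mem hts.le ⟨(t + s)⁻¹ • (x - c), ?_, ?_⟩
    · simp only [mem_preimage]
      convert hm using 1
      have hk' : k = t⁻¹ • (y - c) := by rw [← e, smul_smul, inv_mul_cancel₀ ht0.ne', one_smul]
      rw [hk']
      have e1 : (s / (t + s)) • (c + s⁻¹ • (x - y)) = (s / (t+s)) • c + (t+s)⁻¹ • (x - y) := by
        rw [smul_add, smul_smul]; congr 2; field_simp
      have e2 : (t / (t + s)) • (c + t⁻¹ • (y - c)) = (t / (t+s)) • c + (t+s)⁻¹ • (y - c) := by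
        rw [smul_add, smul_smul]; congr 2; field_simp
      rw [e1, e2]
      have e3 : c = (s / (t+s)) • c + (t / (t+s)) • c := by
        rw [← add_smul, ← add_div, add_comm s t, div_self hts.ne', one_smul]
      nth_rewrite 1 [e3]
      module
    · simp only
      rw [smul_smul, mul_inv_cancel₀ hts.ne', one_smul]
  linarith

theorem continuous_starGauge (h : IsStarBall K c r ρ) : Continuous (starGauge K c) := by
  refine (LipschitzWith.of_le_add_mul (Real.toNNReal r⁻¹) fun x y => ?_).continuous
  rw [Real.coe_toNNReal _ (inv_nonneg.2 h.pos.le), dist_eq_norm, mul_comm, ← div_eq_mul_inv]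
  exact h.starGauge_le_add x y

theorem abs_starGauge_sub_le (h : IsStarBall K c r ρ) (x y : E d) :
    |starGauge K c x - starGauge K c y| ≤ ‖x - y‖ / r := by
  have h1 := h.starGauge_le_add x y
  have h2 := h.starGauge_le_add y x
  rw [norm_sub_rev] at h2
  rw [abs_le]; constructor <;> linarith

theorem eq_setOf (h : IsStarBall K c r ρ) : K = {x | starGauge K c x < 1} :=
  Subset.antisymm (fun _ => h.starGauge_lt_one) fun _ => h.mem_of_starGauge_lt

theorem starGauge_frontier (h : IsStarBall K c r ρ) {a : E d} (ha : a ∈ frontier K) :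
    starGauge K c a = 1 := by
  rw [h.eq_setOf] at ha
  exact frontier_lt_subset_eq h.continuous_starGauge continuous_const ha

theorem shell_subset (h : IsStarBall K c r ρ) : shell K c ⊆ K := fun _ hx => h.mem_of_starGauge_lt hx.2

theorem isOpen_shell (h : IsStarBall K c r ρ) : IsOpen (shell K c) :=
  (isOpen_lt continuous_const h.continuous_starGauge).inter
    (isOpen_lt h.continuous_starGauge continuous_const)

theorem measurable_radProj (h : IsStarBall K c r ρ) : Measurable (radProj K c) := by
  unfold radProj
  have := h.continuous_starGauge.measurable
  fun_prop

theorem norm_sub_center_le (h : IsStarBall K c r ρ) {a : E d} (ha : a ∈ closure K) :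
    ‖a - c‖ ≤ ρ * r := by
  exact mem_closedBall_iff_norm.1 (h.closure_subset ha)

theorem le_norm_sub_center (h : IsStarBall K c r ρ) {a : E d} (ha : a ∈ frontier K) :
    r ≤ ‖a - c‖ := by
  by_contra! hlt
  have : a ∈ K := h.ball_subset (mem_ball_iff_norm.2 hlt)
  rw [h.isOpen.frontier_eq] at ha
  exact ha.2 this

theorem rho_nonneg (h : IsStarBall K c r ρ) : 0 ≤ ρ := by
  have := h.norm_sub_center_le (subset_closure h.center_mem)
  simp only [sub_self, norm_zero] at this
  exact nonneg_of_mul_nonneg_left this h.pos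

/-- Near the points `c + t (a - c)`, `5/8 ≤ t ≤ 7/8`, the radial projection is close to `a`. -/
theorem ball_subset_shell_inter (h : IsStarBall K c r ρ) {a : E d} (ha : a ∈ frontier K) {t η δ : ℝ}
    (ht0 : 5 / 8 ≤ t) (ht1 : t ≤ 7 / 8) (hη : η ≤ r / 8) (hδ : 2 * (1 + ρ) * η ≤ δ) :
    Metric.ball (c + t • (a - c)) η ⊆ shell K c ∩ radProj K c ⁻¹' Metric.ball a δ := by
  intro x hx
  rw [mem_ball_iff_norm] at hx
  have hr := h.pos
  have hρ := h.rho_nonneg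
  have hg : |starGauge K c x - t| ≤ ‖x - (c + t • (a - c))‖ / r := by
    have := h.abs_starGauge_sub_le x (c + t • (a - c))
    rwa [starGauge_smul (by linarith), h.starGauge_frontier ha, mul_one] at this
  have hg' : ‖x - (c + t • (a - c))‖ / r < 1 / 8 := by
    rw [div_lt_iff₀ hr]; linarith
  have hab := abs_le.1 hg
  have hg2 : 1 / 2 < starGauge K c x := by linarith
  refine ⟨⟨hg2, by linarith⟩, ?_⟩
  rw [mem_preimage, mem_ball_iff_norm, radProj]
  set g := starGauge K c x with hgdef
  have hg0 : 0 < g := by linarith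
  -- The error of the projection splits into the displacement from the ray point and the radial
  -- mismatch `(t - g)(a - c)`, both at most a multiple of `η`. The factor `g⁻¹ < 2` accounts for
  -- the 2 in `2 (1 + ρ) η ≤ δ`.
  have e : c + g⁻¹ • (x - c) - a
      = g⁻¹ • ((x - (c + t • (a - c))) + (t - g) • (a - c)) := by
    have : a - c = g⁻¹ • (g • (a - c)) := by rw [smul_smul, inv_mul_cancel₀ hg0.ne', one_smul]
    have e2 : c + g⁻¹ • (x - c) - a = g⁻¹ • (x - c) - (a - c) := by abel
    rw [e2]
    nth_rewrite 1 [this]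
    rw [← smul_sub]
    congr 1
    module
  rw [e, norm_smul, Real.norm_of_nonneg (by positivity), inv_mul_lt_iff₀ hg0]
  set n := ‖x - (c + t • (a - c))‖ with hn
  have hn0 : 0 ≤ n := norm_nonneg _
  calc _ ≤ n + ‖(t - g) • (a - c)‖ := norm_add_le _ _
    _ ≤ n + (n / r) * (ρ * r) := by
      rw [norm_smul, Real.norm_eq_abs, abs_sub_comm]
      gcongr
      exact h.norm_sub_center_le (frontier_subset_closure ha)
    _ = (1 + ρ) * n := by field_simp
    _ < (1 + ρ) * η := by gcongr
    _ ≤ δ * (1 / 2) := by linarith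
    _ ≤ g * δ := by
      rw [mul_comm]
      have : 0 < η := lt_of_le_of_lt hn0 hx
      have : 0 ≤ δ := le_trans (by positivity) hδ
      gcongr

end IsStarBall

/-! ### Comparison of the surface measure with the volume of the shell. -/

/-- If `ν` gives mass at least `δ ^ m / k` to all small balls centred on the compact set `A`, then
the `m`-dimensional Hausdorff measure of `A` is controlled by `ν A`. -/
theorem hausdorffMeasure_le_of_ball {X : Type*} [MetricSpace X] [ProperSpace X] [MeasurableSpace X]
    [BorelSpace X] {A : Set X} (hA : IsCompact A) (m : ℕ) (ν : Measure X) [IsFiniteMeasure ν]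
    {k : ℝ≥0∞} (hk : k ≠ ⊤) {δ₀ : ℝ} (hδ₀ : 0 < δ₀)
    (h : ∀ a ∈ A, ∀ δ, 0 < δ → δ ≤ δ₀ → ENNReal.ofReal (δ ^ m) ≤ k * ν (Metric.ball a δ)) :
    μH[(m : ℝ)] A ≤ 4 ^ m * k * ν A := by
  have hpack : ∀ δ : ℝ≥0, 0 < δ → Metric.packingNumber δ A ≠ ⊤ := by
    intro δ hδ
    obtain ⟨N, -, hN, hc⟩ := Metric.exists_finite_isCover_of_totallyBounded (ε := δ / 2)
      (by positivity) hA.totallyBounded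
    have h1 := Metric.packingNumber_two_mul_le_externalCoveringNumber (δ / 2) A
    rw [mul_div_cancel₀ δ two_ne_zero] at h1
    have h2 := hc.externalCoveringNumber_le_encard
    exact ne_top_of_le_ne_top (by simpa using hN) (h1.trans h2)
  set δ : ℕ → ℝ≥0 := fun n => (δ₀.toNNReal) * ((n : ℝ≥0) + 1)⁻¹ with hδ
  have hδpos : ∀ n, 0 < δ n := fun n => by
    have : 0 < δ₀.toNNReal := by simpa using hδ₀
    positivity
  have hδle : ∀ n, (δ n : ℝ) ≤ δ₀ := fun n => by
    simp only [hδ, NNReal.coe_mul, Real.coe_toNNReal _ hδ₀.le]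
    refine mul_le_of_le_one_right hδ₀.le ?_
    rw [← NNReal.coe_one, NNReal.coe_le_coe]
    exact inv_le_one_of_one_le₀ (by simp)
  have hδlim : Tendsto δ atTop (𝓝 0) := by
    have h1 : Tendsto (fun n : ℕ => ((n : ℝ≥0) + 1)⁻¹) atTop (𝓝 0) := by
      rw [← NNReal.tendsto_coe]
      simpa using tendsto_one_div_add_atTop_nhds_zero_nat (𝕜 := ℝ)
    simpa using h1.const_mul δ₀.toNNReal
  -- Closed δ-balls about a maximal δ-separated set cover `A`, while the concentric δ/2-balls are
  -- disjoint. The mass hypothesis is applied at radius δ/2; a diameter of at most `2δ = 4 (δ/2)`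
  -- gives the factor `4 ^ m`.
  set M : ℕ → Set X := fun n => Metric.maximalSeparatedSet (δ n) A with hM
  have hMfin : ∀ n, (M n).Finite := fun n => by
    rw [← Set.encard_ne_top_iff, Metric.encard_maximalSeparatedSet (hpack _ (hδpos n))]
    exact hpack _ (hδpos n)
  have hMsub : ∀ n, M n ⊆ A := fun n => Metric.maximalSeparatedSet_subset
  have : ∀ n, Fintype (M n) := fun n => (hMfin n).fintype
  have key : ∀ n, ∑ i : M n, Metric.ediam (Metric.closedBall (i : X) (δ n)) ^ (m : ℝ)
      ≤ 4 ^ m * k * ν (Metric.cthickening (δ n) A) := by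
    intro n
    have hb : ∀ i : M n, Metric.ediam (Metric.closedBall (i : X) (δ n)) ^ (m : ℝ)
        ≤ 4 ^ m * (k * ν (Metric.ball (i : X) (δ n / 2))) := by
      intro i
      have h1 : Metric.ediam (Metric.closedBall (i : X) (δ n)) ≤ 4 * ENNReal.ofReal (δ n / 2) := by
        have := Metric.ediam_closedEBall_le (x := (i : X)) (r := (δ n : ℝ≥0∞))
        rw [Metric.closedEBall_coe] at this
        refine this.trans (le_of_eq ?_)
        rw [show (4 : ℝ≥0∞) = ENNReal.ofReal 4 by simp, ← ENNReal.ofReal_mul (by norm_num),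
          ← ENNReal.ofReal_coe_nnreal, show (2 : ℝ≥0∞) = ENNReal.ofReal 2 by simp,
          ← ENNReal.ofReal_mul (by norm_num)]
        congr 1
        ring
      rw [ENNReal.rpow_natCast]
      calc _ ≤ (4 * ENNReal.ofReal (δ n / 2)) ^ m := by gcongr
        _ = 4 ^ m * ENNReal.ofReal ((δ n / 2 : ℝ) ^ m) := by
          rw [mul_pow, ENNReal.ofReal_pow (by positivity)]
        _ ≤ _ := by
          have := h i (hMsub n i.2) (δ n / 2) (by have := hδpos n; positivity)
            (by have := hδle n; have := hδpos n; linarith [NNReal.coe_nonneg (δ n)])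
          gcongr
    refine (Finset.sum_le_sum fun i _ => hb i).trans ?_
    rw [← Finset.mul_sum, ← Finset.mul_sum, ← mul_assoc]
    gcongr
    have hdisj : Pairwise (Function.onFun Disjoint fun i : M n => Metric.ball (i : X) (δ n / 2)) := by
      intro i j hij
      refine Metric.ball_disjoint_ball ?_
      have := Metric.isSeparated_maximalSeparatedSet (ε := δ n) (A := A) i.2 j.2
        (fun e => hij (Subtype.ext e))
      simp only [edist_dist, ← ENNReal.ofReal_coe_nnreal] at this
      have := (ENNReal.ofReal_lt_ofReal_iff_of_nonneg (NNReal.coe_nonneg _)).1 this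
      linarith
    rw [← tsum_fintype (L := .unconditional _),
      ← measure_iUnion hdisj (fun i => Metric.isOpen_ball.measurableSet)]
    refine measure_mono (iUnion_subset fun i => ?_)
    refine Metric.ball_subset_closedBall.trans ((Metric.closedBall_subset_closedBall ?_).trans
      (Metric.closedBall_subset_cthickening (hMsub n i.2) _))
    have := NNReal.coe_nonneg (δ n); linarith
  -- The disjoint balls leave `A`, but only by δ; compactness makes the mass of the thickenings
  -- decrease to that of `A`.
  have hlim : Tendsto (fun n => 4 ^ m * k * ν (Metric.cthickening (δ n) A)) atTop
      (𝓝 (4 ^ m * k * ν A)) := by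
    refine ENNReal.Tendsto.const_mul ?_ (Or.inr (ENNReal.mul_ne_top (by simp) hk))
    refine (tendsto_measure_cthickening_of_isCompact hA).comp ?_
    exact (NNReal.tendsto_coe.2 hδlim)
  refine (Measure.hausdorffMeasure_le_liminf_sum (m : ℝ) A (l := atTop)
    (fun n => 2 * (δ n : ℝ≥0∞)) ?_ (fun n (i : M n) => Metric.closedBall (i : X) (δ n)) ?_ ?_).trans ?_
  · have := ENNReal.Tendsto.const_mul (ENNReal.tendsto_coe.2 hδlim)
      (Or.inr (ENNReal.ofNat_ne_top (n := 2)))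
    simpa using this
  · refine Eventually.of_forall fun n i => ?_
    have := Metric.ediam_closedEBall_le (x := (i : X)) (r := (δ n : ℝ≥0∞))
    rwa [Metric.closedEBall_coe] at this
  · refine Eventually.of_forall fun n x hx => ?_
    obtain ⟨y, hy, hxy⟩ := Metric.isCover_maximalSeparatedSet (hpack _ (hδpos n)) hx
    refine mem_iUnion.2 ⟨⟨y, hy⟩, ?_⟩
    simp only at hxy
    rw [← Metric.closedEBall_coe]
    exact hxy
  · rw [← hlim.liminf_eq]
    exact liminf_le_liminf (Eventually.of_forall key)

/-- The inward radial image of the shell. -/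
noncomputable def shellMeasure (K : Set (E d)) (c : E d) : Measure (E d) :=
  (volume.restrict (shell K c)).map (radProj K c)

/-- The constant in the comparison of the surface measure with the shell measure. -/
noncomputable def ballConst (d : ℕ) (ρ : ℝ) : ℝ≥0∞ :=
  ENNReal.ofReal (16 * (2 * (1 + ρ)) ^ (d - 1)) * (volume (Metric.ball (0 : E d) 1))⁻¹

theorem volume_unitBall_pos : 0 < volume (Metric.ball (0 : E d) 1) :=
  Metric.measure_ball_pos _ _ one_pos

theorem ballConst_ne_top (ρ : ℝ) : ballConst d ρ ≠ ⊤ :=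
  ENNReal.mul_ne_top ENNReal.ofReal_ne_top (ENNReal.inv_ne_top.2 volume_unitBall_pos.ne')

namespace IsStarBall

variable {K : Set (E d)} {c : E d} {r ρ : ℝ}

/-- The segment `c + t (a - c)`, `5/8 ≤ t ≤ 7/8`, carries about `r / η` disjoint balls of radius `η`
comparable to `δ`, and all of them project into the `δ`-ball about `a`. Their total volume is of
order `r η ^ (d - 1)`, the source of the factor `r⁻¹` and of the exponent. -/
theorem le_shellMeasure_ball (h : IsStarBall K c r ρ) (hd : 1 ≤ d) {a : E d} (ha : a ∈ frontier K)
    {δ : ℝ} (hδ : 0 < δ) (hδr : δ ≤ r / 4) :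
    ENNReal.ofReal (δ ^ (d - 1)) ≤
      (ballConst d ρ * ENNReal.ofReal r⁻¹) * shellMeasure K c (Metric.ball a δ) := by
  have hr := h.pos
  have hρ := h.rho_nonneg
  set η := δ / (2 * (1 + ρ)) with hη
  have hη0 : 0 < η := by positivity
  have hδη : δ = 2 * (1 + ρ) * η := by rw [hη]; field_simp
  have hηr : η ≤ r / 8 := by
    rw [hη, div_le_iff₀ (by positivity)]
    nlinarith
  set N := ⌊r / (8 * η)⌋₊ with hN
  have hN1 : (1 : ℝ) ≤ N := by
    have : 1 ≤ r / (8 * η) := by rw [le_div_iff₀ (by positivity)]; linarith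
    exact_mod_cast (Nat.one_le_floor_iff _).2 this
  have hNle : (N : ℝ) ≤ r / (8 * η) := Nat.floor_le (by positivity)
  have hNge : r / (16 * η) ≤ N := by
    have h1 : r / (8 * η) < N + 1 := Nat.lt_floor_add_one _
    have : r / (16 * η) = r / (8 * η) / 2 := by field_simp; ring
    rw [this]; linarith
  set t : Fin N → ℝ := fun j => 5 / 8 + (j : ℝ) * (2 * η / r) with ht
  have ht0 : ∀ j, 5 / 8 ≤ t j := fun j => by simp only [ht]; linarith [show 0 ≤ (j : ℝ) * (2 * η / r) by positivity]
  have ht1 : ∀ j, t j ≤ 7 / 8 := fun j => by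
    have : (j : ℝ) ≤ r / (8 * η) := (Nat.cast_le.2 j.2.le).trans hNle
    have : (j : ℝ) * (2 * η / r) ≤ r / (8 * η) * (2 * η / r) := by gcongr
    have e : r / (8 * η) * (2 * η / r) = 1 / 4 := by field_simp; norm_num
    simp only [ht]; linarith
  have hdisj : Pairwise (Function.onFun Disjoint fun j : Fin N => Metric.ball (c + t j • (a - c)) η) := by
    intro i j hij
    refine Metric.ball_disjoint_ball ?_
    rw [dist_eq_norm, add_sub_add_left_eq_sub, ← sub_smul, norm_smul, Real.norm_eq_abs]
    have h1 : 2 * η / r ≤ |t i - t j| := by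
      simp only [ht]
      rw [add_sub_add_left_eq_sub, ← sub_mul, abs_mul, abs_of_pos (show 0 < 2 * η / r by positivity)]
      refine le_mul_of_one_le_left (by positivity) ?_
      have : (i : ℤ) - (j : ℤ) ≠ 0 := by
        intro e; apply hij; ext; omega
      exact_mod_cast Int.one_le_abs this
    calc η + η = 2 * η / r * r := by field_simp; ring
      _ ≤ |t i - t j| * ‖a - c‖ := by
        gcongr
        exact h.le_norm_sub_center ha
  have hmeas : shellMeasure K c (Metric.ball a δ)
      = volume (shell K c ∩ radProj K c ⁻¹' Metric.ball a δ) := by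
    rw [shellMeasure, Measure.map_apply h.measurable_radProj Metric.isOpen_ball.measurableSet,
      Measure.restrict_apply (h.measurable_radProj Metric.isOpen_ball.measurableSet), inter_comm]
  have hsum : (N : ℝ≥0∞) * (ENNReal.ofReal (η ^ d) * volume (Metric.ball (0 : E d) 1))
      ≤ shellMeasure K c (Metric.ball a δ) := by
    rw [hmeas]
    have := measure_mono (μ := volume) (iUnion_subset fun j =>
      h.ball_subset_shell_inter ha (ht0 j) (ht1 j) hηr hδη.ge)
    rw [measure_iUnion hdisj fun j => Metric.isOpen_ball.measurableSet, tsum_fintype] at this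
    simp_rw [Measure.addHaar_ball_of_pos volume _ hη0] at this
    simpa using this
  have hv0 := (volume_unitBall_pos (d := d)).ne'
  have hvt : volume (Metric.ball (0 : E d) 1) ≠ ⊤ := measure_ball_lt_top.ne
  calc ENNReal.ofReal (δ ^ (d - 1))
      ≤ ENNReal.ofReal (16 * (2 * (1 + ρ)) ^ (d - 1)) * ENNReal.ofReal r⁻¹
          * (ENNReal.ofReal N * ENNReal.ofReal (η ^ d)) := by
        rw [← ENNReal.ofReal_mul (by positivity), ← ENNReal.ofReal_mul (by positivity),
          ← ENNReal.ofReal_mul (by positivity)]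
        apply ENNReal.ofReal_le_ofReal
        rw [hδη, mul_pow]
        have e : η ^ d = η ^ (d - 1) * η := by rw [← pow_succ, Nat.sub_add_cancel hd]
        calc _ = (2 * (1 + ρ)) ^ (d - 1) * η ^ (d - 1) * 1 := by ring
          _ = 16 * (2 * (1 + ρ)) ^ (d - 1) * r⁻¹ * (r / (16 * η) * (η ^ (d - 1) * η)) := by
            field_simp
          _ ≤ _ := by rw [e]; gcongr
    _ = (ballConst d ρ * ENNReal.ofReal r⁻¹)
          * ((N : ℝ≥0∞) * (ENNReal.ofReal (η ^ d) * volume (Metric.ball (0 : E d) 1))) := by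
        rw [ballConst, ENNReal.ofReal_natCast]
        generalize volume (Metric.ball (0 : E d) 1) = V at *
        calc _ = _ * (V⁻¹ * V) := by rw [ENNReal.inv_mul_cancel hv0 hvt, mul_one]
          _ = _ := by ring
    _ ≤ _ := by gcongr

end IsStarBall

/-- The normalising factor of the surface measure. -/
noncomputable def surfFactor (d : ℕ) : ℝ≥0 :=
  Measure.addHaarScalarFactor (volume : Measure (EuclideanSpace ℝ (Fin (d - 1)))) μH[((d - 1 : ℕ) : ℝ)]

theorem surf_apply (A : Set (E d)) : surf d A = surfFactor d * μH[((d - 1 : ℕ) : ℝ)] A := by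
  rw [surf, Measure.euclideanHausdorffMeasure_def]
  rfl

noncomputable def surfConst (d : ℕ) (ρ : ℝ) : ℝ≥0∞ :=
  surfFactor d * (4 ^ (d - 1) * ballConst d ρ)

theorem surfConst_ne_top (ρ : ℝ) : surfConst d ρ ≠ ⊤ :=
  ENNReal.mul_ne_top ENNReal.coe_ne_top (ENNReal.mul_ne_top (by simp) (ballConst_ne_top ρ))

namespace IsStarBall

variable {K : Set (E d)} {c : E d} {r ρ : ℝ}

theorem isFiniteMeasure_shellMeasure (h : IsStarBall K c r ρ) :
    IsFiniteMeasure (shellMeasure K c) := by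
  have : IsFiniteMeasure (volume.restrict (shell K c)) :=
    ⟨by rw [Measure.restrict_apply_univ]; exact (measure_mono h.shell_subset).trans_lt h.volume_lt_top⟩
  unfold shellMeasure
  infer_instance

theorem surf_le_of_isCompact (h : IsStarBall K c r ρ) (hd : 1 ≤ d) {A : Set (E d)} (hA : IsCompact A)
    (hAK : A ⊆ frontier K) :
    surf d A ≤ surfConst d ρ * ENNReal.ofReal r⁻¹ * shellMeasure K c A := by
  have := h.isFiniteMeasure_shellMeasure
  have h1 := hausdorffMeasure_le_of_ball hA (d - 1) (shellMeasure K c)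
    (k := ballConst d ρ * ENNReal.ofReal r⁻¹)
    (ENNReal.mul_ne_top (ballConst_ne_top ρ) ENNReal.ofReal_ne_top) (δ₀ := r / 4)
    (by have := h.pos; positivity) fun a ha δ h0 h1 => h.le_shellMeasure_ball hd (hAK ha) h0 h1
  rw [surf_apply, surfConst]
  refine (mul_le_mul_right h1 (surfFactor d : ℝ≥0∞)).trans (le_of_eq ?_)
  ring

theorem surf_frontier_lt_top (h : IsStarBall K c r ρ) (hd : 1 ≤ d) : surf d (frontier K) < ⊤ := by
  have := h.isFiniteMeasure_shellMeasure
  refine (h.surf_le_of_isCompact hd h.isCompact_frontier Subset.rfl).trans_lt ?_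
  exact ENNReal.mul_lt_top (ENNReal.mul_lt_top (surfConst_ne_top ρ).lt_top ENNReal.ofReal_lt_top)
    (measure_lt_top _ _)

theorem isFiniteMeasure_surf (h : IsStarBall K c r ρ) (hd : 1 ≤ d) :
    IsFiniteMeasure ((surf d).restrict (frontier K)) :=
  ⟨by rw [Measure.restrict_apply_univ]; exact h.surf_frontier_lt_top hd⟩

/-- The surface measure is dominated by the shell measure. -/
theorem surf_restrict_le (h : IsStarBall K c r ρ) (hd : 1 ≤ d) :
    (surf d).restrict (frontier K) ≤ (surfConst d ρ * ENNReal.ofReal r⁻¹) • shellMeasure K c := by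
  have := h.isFiniteMeasure_surf hd
  refine Measure.le_iff.2 fun A hA => ?_
  -- Inner regularity by closed sets reduces the claim to compact subsets of the frontier.
  rw [hA.measure_eq_iSup_isClosed_of_ne_top (measure_ne_top _ _)]
  refine iSup_le fun F => iSup_le fun hF => iSup_le fun hFc => ?_
  rw [Measure.restrict_apply hFc.measurableSet, Measure.smul_apply, smul_eq_mul]
  refine (h.surf_le_of_isCompact hd (h.isCompact_frontier.inter_left hFc) inter_subset_right).trans ?_
  gcongr
  exact inter_subset_left.trans hF

/-- A one-sided substitute for polar coordinates: surface integrals become volume integrals of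
functions constant along rays. Both trace estimates below start from it. -/
theorem surf_lintegral_le (h : IsStarBall K c r ρ) (hd : 1 ≤ d) {f : E d → ℝ≥0∞} (hf : Measurable f) :
    ∫⁻ x in frontier K, f x ∂(surf d) ≤
      surfConst d ρ * ENNReal.ofReal r⁻¹ * ∫⁻ x in shell K c, f (radProj K c x) := by
  refine (lintegral_mono' (h.surf_restrict_le hd) le_rfl).trans ?_
  rw [lintegral_smul_measure, smul_eq_mul, shellMeasure, lintegral_map hf h.measurable_radProj]

end IsStarBall

/-! ### Integration along rays and the trace inequality for `C¹` functions. -/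

theorem ennreal_add_sq_le (a b : ℝ≥0∞) : (a + b) ^ 2 ≤ 2 * a ^ 2 + 2 * b ^ 2 := by
  by_cases ha : a = ⊤
  · simp [ha]
  by_cases hb : b = ⊤
  · simp [hb]
  lift a to ℝ≥0 using ha
  lift b to ℝ≥0 using hb
  norm_cast
  have h := add_sq_le (a := (a : ℝ)) (b := b)
  rw [← NNReal.coe_le_coe]
  push_cast
  linarith

theorem enorm_add_sq_le (a b : ℂ) : ‖a + b‖ₑ ^ 2 ≤ 2 * ‖a‖ₑ ^ 2 + 2 * ‖b‖ₑ ^ 2 :=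
  (pow_le_pow_left' (enorm_add_le a b) 2).trans (ennreal_add_sq_le _ _)

theorem enorm_sub_sq_le (a b : ℂ) : ‖a - b‖ₑ ^ 2 ≤ 2 * ‖a‖ₑ ^ 2 + 2 * ‖b‖ₑ ^ 2 := by
  rw [sub_eq_add_neg, ← enorm_neg b]
  exact enorm_add_sq_le _ _

theorem enorm_sq_eq {F : Type*} [NormedAddCommGroup F] (a : F) : ‖a‖ₑ ^ 2 = ENNReal.ofReal (‖a‖ ^ 2) := by
  rw [← ofReal_norm, ENNReal.ofReal_pow (norm_nonneg _)]

/-- Cauchy-Schwarz for the Lebesgue integral. -/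
theorem sq_lintegral_mul_le {α : Type*} [MeasurableSpace α] (μ : Measure α) {f g : α → ℝ≥0∞}
    (hf : AEMeasurable f μ) (hg : AEMeasurable g μ) :
    (∫⁻ x, f x * g x ∂μ) ^ 2 ≤ (∫⁻ x, f x ^ 2 ∂μ) * ∫⁻ x, g x ^ 2 ∂μ := by
  have h := ENNReal.lintegral_mul_le_Lp_mul_Lq μ Real.HolderConjugate.two_two hf hg
  simp only [Pi.mul_apply, ENNReal.rpow_two] at h
  refine (pow_le_pow_left' h 2).trans (le_of_eq ?_)
  rw [mul_pow, ← ENNReal.rpow_natCast, ← ENNReal.rpow_natCast, ← ENNReal.rpow_mul, ← ENNReal.rpow_mul]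
  norm_num

theorem sq_lintegral_le {α : Type*} [MeasurableSpace α] (μ : Measure α) {f : α → ℝ≥0∞}
    (hf : AEMeasurable f μ) : (∫⁻ x, f x ∂μ) ^ 2 ≤ μ univ * ∫⁻ x, f x ^ 2 ∂μ := by
  have := sq_lintegral_mul_le μ (f := fun _ => 1) aemeasurable_const hf
  simpa using this

/-- The pointwise squared gradient of a differentiable function. -/
noncomputable def gradEnergy (φ : E d → ℂ) (x : E d) : ℝ≥0∞ :=
  ∑ i, ‖fderiv ℝ φ x (EuclideanSpace.single i 1)‖ₑ ^ 2

theorem enorm_fderiv_apply_sq_le (φ : E d → ℂ) (x w : E d) :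
    ‖fderiv ℝ φ x w‖ₑ ^ 2 ≤ ‖w‖ₑ ^ 2 * gradEnergy φ x := by
  simp only [gradEnergy, enorm_sq_eq]
  rw [← ENNReal.ofReal_sum_of_nonneg fun i _ => by positivity, ← ENNReal.ofReal_mul (by positivity)]
  apply ENNReal.ofReal_le_ofReal
  have hw : w = ∑ i, w i • EuclideanSpace.single i (1 : ℝ) := by
    have := (EuclideanSpace.basisFun (Fin d) ℝ).sum_repr w
    simpa using this.symm
  have h1 : ‖fderiv ℝ φ x w‖ ≤ ∑ i, |w i| * ‖fderiv ℝ φ x (EuclideanSpace.single i 1)‖ := by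
    conv_lhs => rw [hw, map_sum]
    refine (norm_sum_le _ _).trans (Finset.sum_le_sum fun i _ => ?_)
    rw [map_smul, norm_smul, Real.norm_eq_abs]
  calc _ ≤ (∑ i, |w i| * ‖fderiv ℝ φ x (EuclideanSpace.single i 1)‖) ^ 2 := by gcongr
    _ ≤ (∑ i, |w i| ^ 2) * ∑ i, ‖fderiv ℝ φ x (EuclideanSpace.single i 1)‖ ^ 2 :=
      Finset.sum_mul_sq_le_sq_mul_sq _ _ _
    _ = _ := by rw [EuclideanSpace.norm_sq_eq]; simp

theorem continuous_fderiv_apply {φ : E d → ℂ} (hφ : ContDiff ℝ 1 φ) (w : E d) :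
    Continuous fun x => fderiv ℝ φ x w :=
  (hφ.continuous_fderiv one_ne_zero).clm_apply continuous_const

theorem measurable_gradEnergy {φ : E d → ℂ} (hφ : ContDiff ℝ 1 φ) : Measurable (gradEnergy φ) := by
  unfold gradEnergy
  refine Finset.measurable_sum _ fun i _ => ?_
  exact ((continuous_fderiv_apply hφ _).measurable.enorm).pow_const 2

/-- Increments of `φ` along a segment are controlled by the gradient. -/
theorem enorm_sub_sq_le_lintegral {φ : E d → ℂ} (hφ : ContDiff ℝ 1 φ) (v w : E d) {a b : ℝ}
    (hab : a ≤ b) :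
    ‖φ (v + b • w) - φ (v + a • w)‖ₑ ^ 2 ≤
      ENNReal.ofReal (b - a) * ‖w‖ₑ ^ 2 * ∫⁻ s in Ioo a b, gradEnergy φ (v + s • w) := by
  have hder : ∀ s : ℝ, HasDerivAt (fun s : ℝ => φ (v + s • w)) (fderiv ℝ φ (v + s • w) w) s := by
    intro s
    have h1 : HasDerivAt (fun s : ℝ => v + s • w) w s := by
      simpa using ((hasDerivAt_id s).smul_const w).const_add v
    exact ((hφ.differentiable one_ne_zero) _).hasFDerivAt.comp_hasDerivAt s h1
  have hcont : Continuous fun s : ℝ => fderiv ℝ φ (v + s • w) w :=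
    (continuous_fderiv_apply hφ w).comp (by fun_prop)
  have hftc := intervalIntegral.integral_eq_sub_of_hasDerivAt (fun s _ => hder s)
    (hcont.intervalIntegrable a b)
  rw [← hftc, intervalIntegral.integral_of_le hab, ← restrict_Ioo_eq_restrict_Ioc]
  have hm : Measurable fun s : ℝ => gradEnergy φ (v + s • w) :=
    (measurable_gradEnergy hφ).comp (by fun_prop)
  calc _ ≤ (∫⁻ s in Ioo a b, ‖fderiv ℝ φ (v + s • w) w‖ₑ) ^ 2 :=
        pow_le_pow_left' (enorm_integral_le_lintegral_enorm _) 2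
    _ ≤ volume.restrict (Ioo a b) univ * ∫⁻ s in Ioo a b, ‖fderiv ℝ φ (v + s • w) w‖ₑ ^ 2 :=
        sq_lintegral_le _ hcont.measurable.enorm.aemeasurable
    _ ≤ ENNReal.ofReal (b - a) * ∫⁻ s in Ioo a b, ‖w‖ₑ ^ 2 * gradEnergy φ (v + s • w) := by
        rw [Measure.restrict_apply_univ, Real.volume_Ioo]
        gcongr with s
        exact enorm_fderiv_apply_sq_le _ _ _
    _ = _ := by rw [lintegral_const_mul _ hm, mul_assoc]

/-- Dilation by a nonzero factor is a homeomorphism, so the change of variables holds for every `f`,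
measurable or not. -/
theorem lintegral_comp_add_smul_of_ne_zero {V : Type*} [NormedAddCommGroup V] [NormedSpace ℝ V]
    [FiniteDimensional ℝ V] [MeasurableSpace V] [BorelSpace V] (μ : Measure V) [μ.IsAddHaarMeasure]
    (f : V → ℝ≥0∞) (v : V) {s : ℝ} (hs : s ≠ 0) :
    ∫⁻ x, f (v + s • x) ∂μ = ENNReal.ofReal |(s ^ Module.finrank ℝ V)⁻¹| * ∫⁻ x, f x ∂μ := by
  have h1 : ∫⁻ x, f (v + s • x) ∂μ = ∫⁻ y, f (v + y) ∂(Measure.map (fun x : V => s • x) μ) :=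
    (lintegral_map_equiv (fun y => f (v + y))
      (Homeomorph.smulOfNeZero s hs : V ≃ₜ V).toMeasurableEquiv).symm
  rw [h1, Measure.map_addHaar_smul _ hs, lintegral_smul_measure, lintegral_add_left_eq_self,
    smul_eq_mul]

theorem lintegral_comp_add_smul (f : E d → ℝ≥0∞) (v : E d) {s : ℝ} (hs : 0 < s) :
    ∫⁻ x, f (v + s • x) = ENNReal.ofReal ((s ^ d)⁻¹) * ∫⁻ x, f x := by
  rw [lintegral_comp_add_smul_of_ne_zero _ _ _ hs.ne', finrank_euclideanSpace_fin,
    abs_of_pos (by positivity)]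

/-- Averaging over dilations with centre `c`. -/
theorem lintegral_dilation_le {f : E d → ℝ≥0∞} (hf : Measurable f) (c : E d) {a b : ℝ} (ha : 0 < a)
    (A : Set (E d)) :
    ∫⁻ x in A, ∫⁻ s in Ioo a b, f (c + s • (x - c)) ≤
      ENNReal.ofReal ((a ^ d)⁻¹ * (b - a)) * ∫⁻ x, f x := by
  have hm : Measurable (Function.uncurry fun (x : E d) (s : ℝ) => f (c + s • (x - c))) := by
    unfold Function.uncurry
    exact hf.comp (by fun_prop)
  calc _ ≤ ∫⁻ x, ∫⁻ s in Ioo a b, f (c + s • (x - c)) := setLIntegral_le_lintegral _ _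
    _ = ∫⁻ s in Ioo a b, ∫⁻ x, f (c + s • (x - c)) := lintegral_lintegral_swap hm.aemeasurable
    _ ≤ ∫⁻ s in Ioo a b, ENNReal.ofReal ((a ^ d)⁻¹) * ∫⁻ x, f x := by
      refine setLIntegral_mono' measurableSet_Ioo fun s hs => ?_
      have hs0 : 0 < s := ha.trans hs.1
      have e : ∀ x : E d, c + s • (x - c) = (c - s • c) + s • x := fun x => by module
      simp_rw [e]
      rw [lintegral_comp_add_smul _ _ hs0]
      gcongr
      exact hs.1.le
    _ = _ := by
      rw [lintegral_const, Measure.restrict_apply_univ, Real.volume_Ioo,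
        ENNReal.ofReal_mul (by positivity)]
      ring

theorem volSq_eq (K : Set (E d)) (v : E d → ℂ) : volSq K v = ∫⁻ x in K, ‖v x‖ₑ ^ 2 := rfl

theorem surfSq_eq (S : Set (E d)) (v : E d → ℂ) : surfSq S v = ∫⁻ x in S, ‖v x‖ₑ ^ 2 ∂(surf d) := rfl

namespace IsStarBall

variable {K : Set (E d)} {c : E d} {r ρ : ℝ}

theorem enorm_sub_center_sq_le (h : IsStarBall K c r ρ) {x : E d} (hx : x ∈ K) :
    ‖x - c‖ₑ ^ 2 ≤ ENNReal.ofReal ((ρ * r) ^ 2) := by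
  rw [enorm_sq_eq]
  have := h.norm_sub_center_le (subset_closure hx)
  gcongr

theorem shell_point_mem (h : IsStarBall K c r ρ) {x : E d} {s : ℝ} (hs : 0 ≤ s)
    (hs1 : s * starGauge K c x < 1) : c + s • (x - c) ∈ K :=
  h.mem_of_starGauge_lt (by rwa [starGauge_smul hs])

/-- Trace inequality for `C¹` functions. -/
theorem surfSq_le_of_contDiff (h : IsStarBall K c r ρ) (hd : 1 ≤ d) {φ : E d → ℂ}
    (hφ : ContDiff ℝ 1 φ) :
    surfSq (frontier K) φ ≤ surfConst d ρ * ENNReal.ofReal r⁻¹ *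
      (2 * volSq K φ + 2 * ENNReal.ofReal ((ρ * r) ^ 2) * ∫⁻ x in K, gradEnergy φ x) := by
  have hφm : Measurable fun x => ‖φ x‖ₑ ^ 2 := hφ.continuous.measurable.enorm.pow_const 2
  rw [surfSq_eq]
  refine (h.surf_lintegral_le hd hφm).trans ?_
  gcongr
  set F : E d → ℝ≥0∞ := K.indicator (gradEnergy φ) with hF
  have hFm : Measurable F := (measurable_gradEnergy hφ).indicator h.isOpen.measurableSet
  -- On the ray through `x`, the point `x` has parameter 1 and its projection has parameter `1 /
  -- gauge`, below 2. The points in between lie in `K`; extending the energy by zero allows the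
  -- interval `(1, 2)` for all `x` at once.
  have hpt : ∀ x ∈ shell K c, ‖φ (radProj K c x)‖ₑ ^ 2 ≤ 2 * ‖φ x‖ₑ ^ 2 +
      2 * ENNReal.ofReal ((ρ * r) ^ 2) * ∫⁻ s in Ioo (1 : ℝ) 2, F (c + s • (x - c)) := by
    intro x hx
    have hg1 : 1 < (starGauge K c x)⁻¹ := by
      rw [one_lt_inv₀ (by linarith [hx.1])]; exact hx.2
    have hg2 : (starGauge K c x)⁻¹ < 2 := by
      rw [inv_lt_comm₀ (by linarith [hx.1]) two_pos]; linarith [hx.1]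
    have e : φ (radProj K c x) = φ x + (φ (radProj K c x) - φ x) := by ring
    rw [e]
    refine (enorm_add_sq_le _ _).trans ?_
    rw [mul_assoc]
    gcongr
    have h1 := enorm_sub_sq_le_lintegral hφ c (x - c) hg1.le
    rw [one_smul, add_sub_cancel] at h1
    refine h1.trans ?_
    refine mul_le_mul' ?_ ?_
    · calc _ ≤ 1 * ENNReal.ofReal ((ρ * r) ^ 2) := by
            gcongr
            · rw [← ENNReal.ofReal_one]; apply ENNReal.ofReal_le_ofReal; linarith
            · exact h.enorm_sub_center_sq_le (h.shell_subset hx)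
        _ = _ := one_mul _
    · calc ∫⁻ s in Ioo 1 (starGauge K c x)⁻¹, gradEnergy φ (c + s • (x - c))
          = ∫⁻ s in Ioo 1 (starGauge K c x)⁻¹, F (c + s • (x - c)) := by
            refine setLIntegral_congr_fun measurableSet_Ioo fun s hs => ?_
            have hg0 : 0 < starGauge K c x := by linarith [hx.1]
            have : c + s • (x - c) ∈ K := h.shell_point_mem (by linarith [hs.1])
              (by rw [← lt_div_iff₀ hg0, one_div]; exact hs.2)
            simp [hF, this]
        _ ≤ _ := lintegral_mono_set (Ioo_subset_Ioo_right hg2.le)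
  have hsm := h.isOpen_shell.measurableSet
  have hm2 : Measurable fun x => ∫⁻ s in Ioo (1 : ℝ) 2, F (c + s • (x - c)) :=
    Measurable.lintegral_prod_right' (f := fun p : E d × ℝ => F (c + p.2 • (p.1 - c)))
      (hFm.comp (by fun_prop))
  calc _ ≤ ∫⁻ x in shell K c, (2 * ‖φ x‖ₑ ^ 2 +
      2 * ENNReal.ofReal ((ρ * r) ^ 2) * ∫⁻ s in Ioo (1 : ℝ) 2, F (c + s • (x - c))) :=
        setLIntegral_mono' hsm hpt
    _ = 2 * (∫⁻ x in shell K c, ‖φ x‖ₑ ^ 2) + 2 * ENNReal.ofReal ((ρ * r) ^ 2) *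
        ∫⁻ x in shell K c, ∫⁻ s in Ioo (1 : ℝ) 2, F (c + s • (x - c)) := by
        rw [lintegral_add_left (hφm.const_mul 2), lintegral_const_mul _ hφm, lintegral_const_mul _ hm2]
    _ ≤ _ := by
        refine add_le_add (mul_le_mul' le_rfl (lintegral_mono_set h.shell_subset))
          (mul_le_mul' le_rfl ?_)
        · refine (lintegral_dilation_le hFm c one_pos _).trans ?_
          rw [hF, lintegral_indicator h.isOpen.measurableSet]
          norm_num

/-! ### The Poincaré inequality for `C¹` functions, in double integral form. -/

/-- The volume of `K` is comparable to that of the inscribed ball. -/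
theorem volume_le (h : IsStarBall K c r ρ) :
    volume K ≤ ENNReal.ofReal ((ρ + 1) ^ d) * volume (Metric.ball c r) := by
  have hρ := h.rho_nonneg
  have hr := h.pos
  calc _ ≤ volume (Metric.ball c ((ρ + 1) * r)) := by
        refine measure_mono (h.subset_closedBall.trans (Metric.closedBall_subset_ball ?_))
        linarith
    _ = _ := by
        rw [Measure.addHaar_ball_mul_of_pos _ _ (by positivity), Measure.addHaar_ball_center _ c]
        simp

/-- A double integral form of the Poincaré inequality for `C¹` functions. -/
theorem lintegral_lintegral_sub_le (h : IsStarBall K c r ρ) {φ : E d → ℂ} (hφ : ContDiff ℝ 1 φ) :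
    ∫⁻ y in Metric.ball c r, ∫⁻ x in K, ‖φ x - φ y‖ₑ ^ 2 ≤
      ENNReal.ofReal ((2 * ρ * r) ^ 2 * 2 ^ d * (1 + (ρ + 1) ^ d)) * volume (Metric.ball c r) *
        ∫⁻ x in K, gradEnergy φ x := by
  set F : E d → ℝ≥0∞ := K.indicator (gradEnergy φ) with hF
  have hKm := h.isOpen.measurableSet
  have hρ := h.rho_nonneg
  have hr := h.pos
  have hFm : Measurable F := (measurable_gradEnergy hφ).indicator hKm
  have hFI : ∫⁻ x, F x = ∫⁻ x in K, gradEnergy φ x := lintegral_indicator hKm _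
  set I := ∫⁻ x in K, gradEnergy φ x with hI
  set B := Metric.ball c r with hB
  have hBm : MeasurableSet B := Metric.isOpen_ball.measurableSet
  have hpt : ∀ y ∈ B, ∀ x ∈ K, ‖φ x - φ y‖ₑ ^ 2 ≤
      ENNReal.ofReal ((2 * ρ * r) ^ 2) * ∫⁻ s in Ioo (0 : ℝ) 1, F (y + s • (x - y)) := by
    intro y hy x hx
    have h1 := enorm_sub_sq_le_lintegral hφ y (x - y) zero_le_one
    simp only [one_smul, add_sub_cancel, zero_smul, add_zero, sub_zero, ENNReal.ofReal_one,
      one_mul] at h1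
    refine h1.trans (mul_le_mul' ?_ (le_of_eq ?_))
    · rw [enorm_sq_eq]
      apply ENNReal.ofReal_le_ofReal
      have h2 := h.norm_sub_center_le (subset_closure hx)
      have h3 := h.norm_sub_center_le (subset_closure (h.ball_subset hy))
      have : ‖x - y‖ ≤ 2 * ρ * r := by
        calc ‖x - y‖ = ‖(x - c) - (y - c)‖ := by congr 1; abel
          _ ≤ ‖x - c‖ + ‖y - c‖ := norm_sub_le _ _
          _ ≤ _ := by linarith
      gcongr
    · refine setLIntegral_congr_fun measurableSet_Ioo fun s hs => ?_
      have : y + s • (x - y) ∈ K := by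
        have := h.starConvex y hy hx (a := 1 - s) (b := s) (by linarith [hs.2]) hs.1.le (by ring)
        convert this using 1
        module
      simp [hF, this]
  have hm3 : Measurable fun p : (E d × E d) × ℝ => F (p.1.1 + p.2 • (p.1.2 - p.1.1)) :=
    hFm.comp (by fun_prop)
  have hm2 : Measurable fun p : E d × E d => ∫⁻ s in Ioo (0 : ℝ) 1, F (p.1 + s • (p.2 - p.1)) :=
    hm3.lintegral_prod_right'
  -- For fixed `s` the point is affine in `y` with ratio `1 - s` and in `x` with ratio `s`.
  -- Integrating first in the variable whose ratio is at least `1/2` costs at most `2 ^ d`, so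
  -- neither endpoint is singular.
  have hslice : ∀ s ∈ Ioo (0 : ℝ) 1, ∫⁻ y in B, ∫⁻ x in K, F (y + s • (x - y)) ≤
      ENNReal.ofReal (2 ^ d) * (volume B + volume K) * I := by
    intro s hs
    rcases le_total s (1 / 2) with hs2 | hs2
    · have hm : Measurable (Function.uncurry fun y x : E d => F (y + s • (x - y))) := by
        unfold Function.uncurry; exact hFm.comp (by fun_prop)
      rw [lintegral_lintegral_swap hm.aemeasurable]
      calc _ ≤ ∫⁻ x in K, ENNReal.ofReal (2 ^ d) * I := by
            refine lintegral_mono fun x => (setLIntegral_le_lintegral _ _).trans ?_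
            have e : ∀ y : E d, y + s • (x - y) = s • x + (1 - s) • y := fun y => by module
            simp_rw [e]
            rw [lintegral_comp_add_smul _ _ (by linarith [hs.2]), hFI]
            gcongr
            rw [← inv_pow]
            have h0 : 0 < 1 - s := by linarith [hs.2]
            gcongr
            rw [inv_le_comm₀ h0 two_pos]; linarith
        _ = ENNReal.ofReal (2 ^ d) * volume K * I := by
            rw [lintegral_const, Measure.restrict_apply_univ]; ring
        _ ≤ _ := by gcongr; exact le_add_self
    · calc _ ≤ ∫⁻ y in B, ENNReal.ofReal (2 ^ d) * I := by
            refine lintegral_mono fun y => (setLIntegral_le_lintegral _ _).trans ?_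
            have e : ∀ x : E d, y + s • (x - y) = (y - s • y) + s • x := fun x => by module
            simp_rw [e]
            rw [lintegral_comp_add_smul _ _ hs.1, hFI]
            gcongr
            rw [← inv_pow]
            have h0 : 0 < s := hs.1
            gcongr
            rw [inv_le_comm₀ h0 two_pos]; linarith
        _ = ENNReal.ofReal (2 ^ d) * volume B * I := by
            rw [lintegral_const, Measure.restrict_apply_univ]; ring
        _ ≤ _ := by gcongr; exact le_self_add
  calc _ ≤ ∫⁻ y in B, ∫⁻ x in K, ENNReal.ofReal ((2 * ρ * r) ^ 2) *
          ∫⁻ s in Ioo (0 : ℝ) 1, F (y + s • (x - y)) :=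
        setLIntegral_mono' hBm fun y hy => setLIntegral_mono' hKm fun x hx => hpt y hy x hx
    _ = ENNReal.ofReal ((2 * ρ * r) ^ 2) * ∫⁻ y in B, ∫⁻ x in K,
          ∫⁻ s in Ioo (0 : ℝ) 1, F (y + s • (x - y)) := by
        rw [← lintegral_const_mul]
        · congr with y
          rw [lintegral_const_mul]
          exact hm2.comp (by fun_prop : Measurable fun x : E d => (y, x))
        · exact hm2.lintegral_prod_right'
    _ = ENNReal.ofReal ((2 * ρ * r) ^ 2) * ∫⁻ s in Ioo (0 : ℝ) 1, ∫⁻ y in B, ∫⁻ x in K,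
          F (y + s • (x - y)) := by
        congr 1
        have e1 : ∀ y, ∫⁻ x in K, ∫⁻ s in Ioo (0 : ℝ) 1, F (y + s • (x - y))
            = ∫⁻ s in Ioo (0 : ℝ) 1, ∫⁻ x in K, F (y + s • (x - y)) := fun y =>
          lintegral_lintegral_swap
            (hm3.comp (by fun_prop : Measurable fun q : E d × ℝ => ((y, q.1), q.2))).aemeasurable
        simp_rw [e1]
        refine lintegral_lintegral_swap ?_
        have : Measurable fun p : (E d × ℝ) => ∫⁻ x in K, F (p.1 + p.2 • (x - p.1)) :=
          (hm3.comp (by fun_prop : Measurable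
            fun q : (E d × ℝ) × E d => ((q.1.1, q.2), q.1.2))).lintegral_prod_right'
        exact this.aemeasurable
    _ ≤ ENNReal.ofReal ((2 * ρ * r) ^ 2) * ∫⁻ s in Ioo (0 : ℝ) 1,
          ENNReal.ofReal (2 ^ d) * (volume B + volume K) * I := by
        gcongr 1
        exact setLIntegral_mono' measurableSet_Ioo hslice
    _ = ENNReal.ofReal ((2 * ρ * r) ^ 2) * ENNReal.ofReal (2 ^ d) * (volume B + volume K) * I := by
        rw [lintegral_const, Measure.restrict_apply_univ, Real.volume_Ioo]
        simp; ring
    _ ≤ ENNReal.ofReal ((2 * ρ * r) ^ 2) * ENNReal.ofReal (2 ^ d) *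
          (volume B + ENNReal.ofReal ((ρ + 1) ^ d) * volume B) * I := by
        gcongr; exact h.volume_le
    _ = _ := by
        rw [ENNReal.ofReal_mul (by positivity), ENNReal.ofReal_mul (by positivity),
          ENNReal.ofReal_add zero_le_one (by positivity), ENNReal.ofReal_one]
        ring

end IsStarBall

/-! ### The sharp endpoint bound for polynomials and the inverse trace inequality. -/

open Polynomial in
/-- Coefficients of the polynomial representing point evaluation at `0` in `L²(0,1)`. -/
theorem exists_evaluation_kernel (p : ℕ) : ∃ a : ℕ → ℝ,
    (∀ j ≤ p, ∑ i ∈ Finset.range (p + 1), a i / (i + j + 1) = if j = 0 then 1 else 0) ∧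
    a 0 = (p + 1) ^ 2 := by
  classical
  set s := Finset.range (p + 1) with hs
  set v : ℕ → ℝ := fun i => -((i : ℝ) + 1) with hv
  -- The linear system has a Cauchy matrix, which partial fractions invert: `f` vanishes at `1, …,
  -- p`, and `f` divided by the nodal polynomial of the points `-(i + 1)` is a sum of terms `const /
  -- (x + i + 1)`. Evaluation at `x = j` gives the equations.
  set f : ℝ[X] := ∏ j ∈ Finset.range p, (X - C ((j : ℝ) + 1)) with hf
  have hvs : Set.InjOn v s := by
    intro i _ j _ h
    simp only [hv, neg_inj, add_left_inj, Nat.cast_inj] at h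
    exact h
  have hdeg : f.degree < s.card := by
    rw [hf, Polynomial.degree_prod]
    simp only [degree_X_sub_C, Finset.sum_const, Finset.card_range, hs, nsmul_eq_mul, mul_one]
    exact_mod_cast Nat.lt_succ_self p
  have hint := Lagrange.eq_interpolate hvs hdeg
  have hne : ∀ j : ℕ, ∀ i ∈ s, (j : ℝ) ≠ v i := by
    intro j i _ h
    simp only [hv] at h
    have : (0 : ℝ) ≤ j := by positivity
    have : (0 : ℝ) ≤ i := by positivity
    linarith
  have hev : ∀ j : ℕ, f.eval (j : ℝ) = (Lagrange.nodal s v).eval (j : ℝ) *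
      ∑ i ∈ s, Lagrange.nodalWeight s v i * ((j : ℝ) - v i)⁻¹ * f.eval (v i) := by
    intro j
    conv_lhs => rw [hint]
    rw [Lagrange.eval_interpolate_not_at_node _ (hne j)]
  have hf0 : f.eval 0 = (-1) ^ p * (p.factorial : ℝ) := by
    rw [hf, eval_prod, ← Finset.prod_range_add_one_eq_factorial]
    push_cast
    rw [← Finset.card_range p, ← Finset.prod_const, Finset.card_range, ← Finset.prod_mul_distrib]
    refine Finset.prod_congr rfl fun i _ => ?_
    simp
  have hn0 : (Lagrange.nodal s v).eval 0 = ((p + 1).factorial : ℝ) := by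
    rw [Lagrange.eval_nodal, ← Finset.prod_range_add_one_eq_factorial]
    push_cast
    refine Finset.prod_congr rfl fun i _ => ?_
    simp [hv]
  have hfv : f.eval (v 0) = (-1) ^ p * ((p + 1).factorial : ℝ) := by
    rw [hf, eval_prod, ← Finset.prod_range_add_one_eq_factorial, Finset.prod_range_succ']
    push_cast
    have e : ((-1 : ℝ)) ^ p = ∏ i ∈ Finset.range p, (-1 : ℝ) := by simp
    rw [e, mul_one, ← Finset.prod_mul_distrib]
    refine Finset.prod_congr rfl fun i _ => ?_
    simp [hv]; ring
  have hw0 : Lagrange.nodalWeight s v 0 = ((p.factorial : ℝ))⁻¹ := by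
    rw [Lagrange.nodalWeight, hs, ← Finset.prod_range_add_one_eq_factorial]
    have : (Finset.range (p + 1)).erase 0 = (Finset.range p).image Nat.succ := by
      ext i
      simp only [Finset.mem_erase, Finset.mem_range, Finset.mem_image]
      constructor
      · rintro ⟨h0, h1⟩; exact ⟨i - 1, by omega, by omega⟩
      · rintro ⟨j, hj, rfl⟩; omega
    rw [this, Finset.prod_image (fun _ _ _ _ h => Nat.succ_injective h)]
    push_cast
    rw [← Finset.prod_inv_distrib]
    refine Finset.prod_congr rfl fun i _ => ?_
    simp [hv]
  have hp0 : (p.factorial : ℝ) ≠ 0 := by positivity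
  have hsg : ((-1 : ℝ) ^ p) * (-1) ^ p = 1 := by rw [← mul_pow]; simp
  -- At `x = 0` the quotient equals `(-1) ^ p / (p + 1)`, whence the normalising factor.
  refine ⟨fun i => (-1) ^ p * (p + 1) * (Lagrange.nodalWeight s v i * f.eval (v i)), ?_, ?_⟩
  · intro j hj
    have hsum : ∑ i ∈ s, ((-1 : ℝ) ^ p * (p + 1) * (Lagrange.nodalWeight s v i * f.eval (v i))) /
        (i + j + 1) = (-1) ^ p * (p + 1) *
          ∑ i ∈ s, Lagrange.nodalWeight s v i * ((j : ℝ) - v i)⁻¹ * f.eval (v i) := by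
      rw [Finset.mul_sum]
      refine Finset.sum_congr rfl fun i _ => ?_
      have : (j : ℝ) - v i = i + j + 1 := by simp only [hv]; ring
      rw [this, div_eq_mul_inv]; ring
    rw [hsum]
    have h := hev j
    split_ifs with h0
    · subst h0
      rw [Nat.cast_zero, hf0, hn0, Nat.factorial_succ] at h
      rw [Nat.cast_zero]
      push_cast at h
      have h2 : (-1 : ℝ) ^ p = (p + 1) * ∑ i ∈ s, Lagrange.nodalWeight s v i * ((0 : ℝ) - v i)⁻¹ *
          f.eval (v i) := by
        apply mul_right_cancel₀ hp0
        rw [h]; ring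
      rw [mul_assoc, ← h2, hsg]
    · have hz : f.eval (j : ℝ) = 0 := by
        rw [hf, eval_prod]
        refine Finset.prod_eq_zero (i := j - 1) (by rw [Finset.mem_range]; omega) ?_
        have : ((j - 1 : ℕ) : ℝ) = j - 1 := by rw [Nat.cast_sub (by omega)]; simp
        simp [this]
      rw [hz] at h
      have hn : (Lagrange.nodal s v).eval (j : ℝ) ≠ 0 := Lagrange.eval_nodal_not_at_node (hne j)
      rw [(mul_eq_zero.1 h.symm).resolve_left hn, mul_zero]
  · simp only
    rw [hw0, hfv, Nat.factorial_succ]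
    push_cast
    field_simp
    rw [← pow_mul, mul_comm p 2, pow_mul]
    norm_num

open Polynomial in
/-- The sharp pointwise bound for polynomials in `L²(0,1)`. -/
theorem enorm_eval_zero_sq_le (p : ℕ) (P : ℂ[X]) (hP : P.natDegree ≤ p) :
    ‖P.eval 0‖ₑ ^ 2 ≤ ENNReal.ofReal ((p + 1) ^ 2) * ∫⁻ t in Ioo (0 : ℝ) 1, ‖P.eval (t : ℂ)‖ₑ ^ 2 := by
  obtain ⟨a, ha, ha0⟩ := exists_evaluation_kernel p
  -- `k` represents evaluation at 0 on polynomials of degree at most `p` in `L²(0,1)`. Applied to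
  -- `k` itself this gives `∫ k² = k 0 = a 0 = (p + 1)²`, and Cauchy-Schwarz concludes.
  set k : ℝ → ℝ := fun t => ∑ i ∈ Finset.range (p + 1), a i * t ^ i with hk
  have hkc : Continuous k := by fun_prop
  have hmom : ∀ j ≤ p, ∫ t in (0 : ℝ)..1, k t * t ^ j = if j = 0 then 1 else 0 := by
    intro j hj
    rw [← ha j hj]
    simp only [hk, Finset.sum_mul]
    rw [intervalIntegral.integral_finsetSum fun i _ => by
      exact (by fun_prop : Continuous fun t : ℝ => a i * t ^ i * t ^ j).intervalIntegrable _ _]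
    refine Finset.sum_congr rfl fun i _ => ?_
    simp_rw [mul_assoc, ← pow_add]
    rw [intervalIntegral.integral_const_mul, integral_pow]
    push_cast
    simp [div_eq_mul_inv]
  have hk2 : ∫ t in (0 : ℝ)..1, k t ^ 2 = (p + 1) ^ 2 := by
    have e : ∀ t, k t ^ 2 = ∑ j ∈ Finset.range (p + 1), a j * (k t * t ^ j) := by
      intro t
      rw [sq]
      nth_rewrite 2 [hk]
      simp only
      rw [Finset.mul_sum]
      exact Finset.sum_congr rfl fun j _ => by ring
    simp_rw [e]
    rw [intervalIntegral.integral_finsetSum fun i _ => by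
      exact (by fun_prop : Continuous fun t : ℝ => a i * (k t * t ^ i)).intervalIntegrable _ _]
    simp_rw [intervalIntegral.integral_const_mul]
    rw [Finset.sum_congr rfl fun j hj => by
      rw [hmom j (by rw [Finset.mem_range] at hj; omega)]]
    simp [ha0]
  have hrep : P.eval 0 = ∫ t in (0 : ℝ)..1, (k t : ℂ) * P.eval (t : ℂ) := by
    have e : ∀ t : ℝ, (k t : ℂ) * P.eval (t : ℂ)
        = ∑ j ∈ Finset.range (p + 1), P.coeff j * ((k t * t ^ j : ℝ) : ℂ) := by
      intro t
      rw [eval_eq_sum_range' (Nat.lt_succ_of_le hP), Finset.mul_sum]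
      refine Finset.sum_congr rfl fun j _ => ?_
      push_cast; ring
    simp_rw [e]
    rw [intervalIntegral.integral_finsetSum fun i _ => by
      exact (by fun_prop : Continuous fun t : ℝ => P.coeff i * ((k t * t ^ i : ℝ) : ℂ)).intervalIntegrable _ _]
    rw [Finset.sum_congr rfl fun j hj => by
      rw [intervalIntegral.integral_const_mul, intervalIntegral.integral_ofReal,
        hmom j (by rw [Finset.mem_range] at hj; omega)]]
    rw [Finset.sum_eq_single 0 (fun j _ hj => by rw [if_neg hj, Complex.ofReal_zero, mul_zero])
      (fun h => absurd (Finset.mem_range.2 p.succ_pos) h), if_pos rfl, Complex.ofReal_one, mul_one,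
      Polynomial.coeff_zero_eq_eval_zero]
  rw [intervalIntegral.integral_of_le zero_le_one, ← restrict_Ioo_eq_restrict_Ioc] at hrep
  rw [intervalIntegral.integral_of_le zero_le_one, ← restrict_Ioo_eq_restrict_Ioc] at hk2
  have hPc : Continuous fun t : ℝ => P.eval (t : ℂ) := P.continuous.comp Complex.continuous_ofReal
  calc ‖P.eval 0‖ₑ ^ 2 ≤ (∫⁻ t in Ioo (0 : ℝ) 1, ‖k t‖ₑ * ‖P.eval (t : ℂ)‖ₑ) ^ 2 := by
        rw [hrep]
        refine pow_le_pow_left' ((enorm_integral_le_lintegral_enorm _).trans (le_of_eq ?_)) 2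
        congr with t
        rw [enorm_mul]
        congr 1
        simp [← ofReal_norm]
    _ ≤ (∫⁻ t in Ioo (0 : ℝ) 1, ‖k t‖ₑ ^ 2) * ∫⁻ t in Ioo (0 : ℝ) 1, ‖P.eval (t : ℂ)‖ₑ ^ 2 :=
        sq_lintegral_mul_le _ hkc.measurable.enorm.aemeasurable hPc.measurable.enorm.aemeasurable
    _ = _ := by
        congr 1
        rw [← hk2, ofReal_integral_eq_lintegral_ofReal]
        · congr with t
          rw [enorm_sq_eq]; simp
        · exact ((hkc.pow 2).integrableOn_Icc (a := 0) (b := 1)).mono_set Ioo_subset_Icc_self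
        · exact Eventually.of_forall fun t => sq_nonneg _

theorem continuous_polyFun (q : Poly d) : Continuous (polyFun q) := by
  unfold polyFun
  exact (MvPolynomial.continuous_eval q).comp (by fun_prop)

/-- The restriction of a polynomial to a line is a polynomial. -/
theorem exists_polynomial_line (q : Poly d) {p : ℕ} (hq : q ∈ polySpace d p) (v w : E d) :
    ∃ P : Polynomial ℂ, P.natDegree ≤ p ∧ ∀ s : ℝ, P.eval (s : ℂ) = polyFun q (v + s • w) := by
  refine ⟨MvPolynomial.aeval (fun i => Polynomial.C ((v i : ℝ) : ℂ) +
    Polynomial.C ((w i : ℝ) : ℂ) * Polynomial.X) q, ?_, fun s => ?_⟩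
  · have := MvPolynomial.aeval_natDegree_le (n := 1) q
      ((MvPolynomial.mem_restrictTotalDegree _ _ _).1 hq)
      (fun i => Polynomial.C ((v i : ℝ) : ℂ) + Polynomial.C ((w i : ℝ) : ℂ) * Polynomial.X)
      (fun i => by
        rw [add_comm]; exact Polynomial.natDegree_linear_le)
    rwa [mul_one] at this
  · rw [← Polynomial.coe_evalRingHom, MvPolynomial.aeval_def, MvPolynomial.hom_eval₂, polyFun, ← MvPolynomial.eval₂_id]
    congr 1
    · ext; simp
    · ext i; simp; ring

namespace IsStarBall

variable {K : Set (E d)} {c : E d} {r ρ : ℝ}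

/-- The inverse trace inequality with explicit dependence on the degree. -/
theorem surfSq_polyFun_le (h : IsStarBall K c r ρ) (hd : 1 ≤ d) {p : ℕ} {q : Poly d}
    (hq : q ∈ polySpace d p) :
    surfSq (frontier K) (polyFun q) ≤ surfConst d ρ * ENNReal.ofReal r⁻¹ *
      (ENNReal.ofReal (3 * 2 ^ d * (p + 1) ^ 2) * volSq K (polyFun q)) := by
  have hqm : Measurable fun x => ‖polyFun q x‖ₑ ^ 2 :=
    (continuous_polyFun q).measurable.enorm.pow_const 2
  rw [surfSq_eq]
  refine (h.surf_lintegral_le hd hqm).trans ?_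
  gcongr
  set F : E d → ℝ≥0∞ := K.indicator fun x => ‖polyFun q x‖ₑ ^ 2 with hF
  have hFm : Measurable F := hqm.indicator h.isOpen.measurableSet
  have hpt : ∀ x ∈ shell K c, ‖polyFun q (radProj K c x)‖ₑ ^ 2 ≤
      ENNReal.ofReal ((p + 1) ^ 2 * 2) * ∫⁻ s in Ioo (1 / 2 : ℝ) 2, F (c + s • (x - c)) := by
    intro x hx
    have hg0 : 0 < starGauge K c x := by linarith [hx.1]
    have hg1 : 1 < (starGauge K c x)⁻¹ := by rw [one_lt_inv₀ hg0]; exact hx.2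
    have hg2 : (starGauge K c x)⁻¹ < 2 := by
      rw [inv_lt_comm₀ hg0 two_pos]; linarith [hx.1]
    -- The line runs inwards from the boundary point. With parameter `1 / gauge - t / 2` it stays in
    -- `K` and in the range `(1/2, 2)` for `0 < t < 1`, so only values of `q` in `K` are used; the
    -- slope `1/2` costs a factor 2.
    obtain ⟨P, hPd, hP⟩ := exists_polynomial_line q hq (radProj K c x) ((-1 / 2 : ℝ) • (x - c))
    have h0 := enorm_eval_zero_sq_le p P hPd
    have e0 := hP 0
    simp only [Complex.ofReal_zero, zero_smul, add_zero] at e0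
    rw [e0] at h0
    refine h0.trans ?_
    rw [ENNReal.ofReal_mul (by positivity), mul_assoc]
    gcongr
    set G : ℝ → ℝ≥0∞ := (Ioo (1 / 2 : ℝ) 2).indicator fun s => F (c + s • (x - c)) with hG
    calc ∫⁻ t in Ioo (0 : ℝ) 1, ‖P.eval (t : ℂ)‖ₑ ^ 2
        ≤ ∫⁻ t in Ioo (0 : ℝ) 1, G ((starGauge K c x)⁻¹ + (-1 / 2 : ℝ) • t) := by
          refine setLIntegral_mono' measurableSet_Ioo fun t ht => ?_
          rw [hP t]
          have e : radProj K c x + t • (-1 / 2 : ℝ) • (x - c)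
              = c + ((starGauge K c x)⁻¹ + (-1 / 2 : ℝ) • t) • (x - c) := by
            rw [radProj, smul_eq_mul]; module
          rw [e]
          set s := (starGauge K c x)⁻¹ + (-1 / 2 : ℝ) • t with hs
          rw [smul_eq_mul] at hs
          have hs1 : s ∈ Ioo (1 / 2 : ℝ) 2 := ⟨by linarith [ht.2], by linarith [ht.1]⟩
          have hsK : c + s • (x - c) ∈ K := h.shell_point_mem (by linarith [hs1.1]) (by
            rw [← lt_div_iff₀ hg0, one_div]; linarith [ht.1])
          rw [hG, indicator_of_mem hs1, hF, indicator_of_mem hsK]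
      _ ≤ ∫⁻ t, G ((starGauge K c x)⁻¹ + (-1 / 2 : ℝ) • t) := setLIntegral_le_lintegral _ _
      _ = _ := by
          rw [lintegral_comp_add_smul_of_ne_zero _ _ _ (by norm_num), hG,
            lintegral_indicator measurableSet_Ioo]
          norm_num [abs_of_neg]
  have hm2 : Measurable fun x => ∫⁻ s in Ioo (1 / 2 : ℝ) 2, F (c + s • (x - c)) :=
    Measurable.lintegral_prod_right' (f := fun p : E d × ℝ => F (c + p.2 • (p.1 - c)))
      (hFm.comp (by fun_prop))
  refine (setLIntegral_mono' h.isOpen_shell.measurableSet hpt).trans ?_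
  rw [lintegral_const_mul _ hm2]
  refine (mul_le_mul' le_rfl (lintegral_dilation_le hFm c (by norm_num) _)).trans (le_of_eq ?_)
  rw [hF, lintegral_indicator h.isOpen.measurableSet, ← mul_assoc,
    ← ENNReal.ofReal_mul (by positivity), ← volSq_eq]
  congr 2
  rw [one_div, inv_pow, inv_inv]; ring

end IsStarBall

/-! ### Calculus of weak derivatives. -/

theorem sqNorm_congr {μ : Measure (E d)} {v w : E d → ℂ} (h : v =ᵐ[μ] w) : sqNorm μ v = sqNorm μ w :=
  lintegral_congr_ae (h.mono fun x hx => by simp only [hx])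

theorem sqNorm_eq_eLpNorm (μ : Measure (E d)) (v : E d → ℂ) : sqNorm μ v = eLpNorm v 2 μ ^ 2 := by
  rw [eLpNorm_eq_lintegral_rpow_enorm_toReal (by norm_num) (by norm_num), sqNorm,
    ← ENNReal.rpow_natCast, ← ENNReal.rpow_mul]
  simp

theorem sqNorm_lt_top {μ : Measure (E d)} {v : E d → ℂ} (h : MemLp v 2 μ) : sqNorm μ v < ⊤ := by
  rw [sqNorm_eq_eLpNorm]
  exact ENNReal.pow_lt_top h.2

theorem sqNorm_add_le {μ : Measure (E d)} {v w : E d → ℂ} (hv : AEStronglyMeasurable v μ) :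
    sqNorm μ (fun x => v x + w x) ≤ 2 * sqNorm μ v + 2 * sqNorm μ w := by
  calc _ ≤ ∫⁻ x, (2 * ‖v x‖ₑ ^ 2 + 2 * ‖w x‖ₑ ^ 2) ∂μ := lintegral_mono fun x => enorm_add_sq_le _ _
    _ = _ := by
      rw [lintegral_add_left' ((hv.enorm.pow_const 2).const_mul 2), lintegral_const_mul' _ _ (by simp),
        lintegral_const_mul' _ _ (by simp)]
      rfl

theorem sqNorm_neg (μ : Measure (E d)) (v : E d → ℂ) : sqNorm μ (fun x => -v x) = sqNorm μ v := by
  simp [sqNorm]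

theorem sqNorm_sub_le {μ : Measure (E d)} {v w : E d → ℂ} (hv : AEStronglyMeasurable v μ) :
    sqNorm μ (fun x => v x - w x) ≤ 2 * sqNorm μ v + 2 * sqNorm μ w := by
  simp_rw [sub_eq_add_neg]
  exact (sqNorm_add_le hv).trans_eq (by rw [sqNorm_neg])

theorem sqNorm_const_mul (μ : Measure (E d)) (a : ℂ) (v : E d → ℂ) :
    sqNorm μ (fun x => a * v x) = ‖a‖ₑ ^ 2 * sqNorm μ v := by
  simp only [sqNorm, enorm_mul, mul_pow]
  rw [lintegral_const_mul' _ _ (by simp)]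

theorem volSq_mono {U V : Set (E d)} (h : U ⊆ V) (v : E d → ℂ) : volSq U v ≤ volSq V v :=
  lintegral_mono_set h

theorem hasWeakDeriv_congr {U : Set (E d)} {i : Fin d} {u u' g g' : E d → ℂ}
    (hu : u =ᵐ[volume.restrict U] u') (hg : g =ᵐ[volume.restrict U] g') :
    HasWeakDeriv U i u g ↔ HasWeakDeriv U i u' g' := by
  refine forall_congr' fun φ => forall_congr' fun _ => forall_congr' fun _ => forall_congr' fun _ => ?_
  rw [integral_congr_ae (hu.mono fun x hx => by simp only [hx] :
      (fun x => (fderiv ℝ φ x (EuclideanSpace.single i 1)) • u x) =ᵐ[volume.restrict U]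
        fun x => (fderiv ℝ φ x (EuclideanSpace.single i 1)) • u' x),
    integral_congr_ae (hg.mono fun x hx => by simp only [hx] :
      (fun x => φ x • g x) =ᵐ[volume.restrict U] fun x => φ x • g' x)]

theorem integrable_test_smul {φ : E d → ℝ} (hφ : ContDiff ℝ (⊤ : ℕ∞) φ) (hs : HasCompactSupport φ)
    {μ : Measure (E d)} [IsLocallyFiniteMeasure μ] {g : E d → ℂ}
    (hg : MemLp g 2 μ) : Integrable (fun x => φ x • g x) μ :=
  (hg.locallyIntegrable (by norm_num)).integrable_smul_left_of_hasCompactSupport hφ.continuous hs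

theorem continuous_fderiv_test {φ : E d → ℝ} (hφ : ContDiff ℝ (⊤ : ℕ∞) φ) (w : E d) :
    Continuous fun x => fderiv ℝ φ x w :=
  (hφ.continuous_fderiv (by simp)).clm_apply continuous_const

theorem integrable_fderiv_test_smul {φ : E d → ℝ} (hφ : ContDiff ℝ (⊤ : ℕ∞) φ)
    (hs : HasCompactSupport φ) {μ : Measure (E d)} [IsLocallyFiniteMeasure μ] {g : E d → ℂ}
    (hg : MemLp g 2 μ) (w : E d) : Integrable (fun x => (fderiv ℝ φ x w) • g x) μ :=
  (hg.locallyIntegrable (by norm_num)).integrable_smul_left_of_hasCompactSupport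
    (continuous_fderiv_test hφ w) (hs.fderiv_apply (𝕜 := ℝ) w)

/-- The fundamental lemma of the calculus of variations. It lets the chosen `weakDeriv` be replaced
by any explicit weak derivative. -/
theorem HasWeakDeriv.ae_eq {U : Set (E d)} (hU : IsOpen U) {i : Fin d} {u g g' : E d → ℂ}
    (hg : MemLp g 2 (volume.restrict U)) (hg' : MemLp g' 2 (volume.restrict U))
    (h : HasWeakDeriv U i u g) (h' : HasWeakDeriv U i u g') : g =ᵐ[volume.restrict U] g' := by
  have hloc : LocallyIntegrable (fun x => g x - g' x) (volume.restrict U) :=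
    (hg.sub hg').locallyIntegrable (by norm_num)
  have key := hU.ae_eq_zero_of_integral_contDiff_smul_eq_zero (μ := volume.restrict U)
    (f := fun x => g x - g' x) (hloc.locallyIntegrableOn U) fun φ hφ hs ht => by
      have e1 := h φ hφ hs ht
      have e2 := h' φ hφ hs ht
      simp_rw [smul_sub]
      rw [integral_sub (integrable_test_smul hφ hs hg) (integrable_test_smul hφ hs hg'),
        sub_eq_zero, ← neg_inj, ← e1, ← e2]
  filter_upwards [key, self_mem_ae_restrict hU.measurableSet] with x hx hxU
  exact sub_eq_zero.1 (hx hxU)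

/-- `v ∈ H¹(U)` with weak gradient `g`. -/
structure IsH1 (U : Set (E d)) (v : E d → ℂ) (g : Fin d → E d → ℂ) : Prop where
  memLp : MemLp v 2 (volume.restrict U)
  memLp_grad : ∀ i, MemLp (g i) 2 (volume.restrict U)
  weak : ∀ i, HasWeakDeriv U i v (g i)

namespace IsH1

variable {U : Set (E d)} {v w : E d → ℂ} {g k : Fin d → E d → ℂ}

theorem memH1 (h : IsH1 U v g) : MemH1 U v := ⟨h.memLp, fun i => ⟨g i, h.memLp_grad i, h.weak i⟩⟩

theorem _root_.TrefftzDG.MemH1.isH1 (h : MemH1 U v) : IsH1 U v fun i => weakDeriv U i v := by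
  refine ⟨h.1, fun i => ?_, fun i => ?_⟩ <;> rw [weakDeriv, dif_pos (h.2 i)]
  · exact (h.2 i).choose_spec.1
  · exact (h.2 i).choose_spec.2

theorem weakDeriv_ae_eq (hU : IsOpen U) (h : IsH1 U v g) (i : Fin d) :
    weakDeriv U i v =ᵐ[volume.restrict U] g i :=
  (h.memH1.isH1.weak i).ae_eq hU (h.memH1.isH1.memLp_grad i) (h.memLp_grad i) (h.weak i)

theorem gradSq_eq (hU : IsOpen U) (h : IsH1 U v g) : gradSq U v = ∑ i, volSq U (g i) :=
  Finset.sum_congr rfl fun i _ => sqNorm_congr (h.weakDeriv_ae_eq hU i)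

theorem congr (h : IsH1 U v g) (hv : v =ᵐ[volume.restrict U] w)
    (hg : ∀ i, g i =ᵐ[volume.restrict U] k i) : IsH1 U w k :=
  ⟨h.memLp.ae_eq hv, fun i => (h.memLp_grad i).ae_eq (hg i),
    fun i => (hasWeakDeriv_congr hv (hg i)).1 (h.weak i)⟩

theorem sub (h : IsH1 U v g) (h' : IsH1 U w k) :
    IsH1 U (fun x => v x - w x) fun i x => g i x - k i x := by
  refine ⟨h.memLp.sub h'.memLp, fun i => (h.memLp_grad i).sub (h'.memLp_grad i),
    fun i φ hφ hs ht => ?_⟩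
  simp_rw [smul_sub]
  rw [integral_sub (integrable_fderiv_test_smul hφ hs h.memLp _)
      (integrable_fderiv_test_smul hφ hs h'.memLp _),
    integral_sub (integrable_test_smul hφ hs (h.memLp_grad i))
      (integrable_test_smul hφ hs (h'.memLp_grad i)), h.weak i φ hφ hs ht, h'.weak i φ hφ hs ht]
  ring

/-- A test function supported in `V` is one for `U`, and both integrands vanish off its support.
This carries the derivatives of `z` from `Ω` to the elements. -/
theorem mono {V : Set (E d)} (h : IsH1 U v g) (hVU : V ⊆ U) : IsH1 V v g := by
  refine ⟨h.memLp.mono_measure (Measure.restrict_mono_set _ hVU),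
    fun i => (h.memLp_grad i).mono_measure (Measure.restrict_mono_set _ hVU), fun i φ hφ hs ht => ?_⟩
  have h1 := h.weak i φ hφ hs (ht.trans hVU)
  have e : ∀ f : E d → ℂ, (∀ x, x ∉ tsupport φ → f x = 0) → ∫ x in U, f x = ∫ x in V, f x := by
    intro f hf
    rw [← Measure.restrict_restrict_of_subset hVU]
    refine (setIntegral_eq_integral_of_forall_compl_eq_zero fun x hx => ?_).symm
    exact hf x fun hxt => hx (ht hxt)
  rw [e, e] at h1
  · exact h1
  · intro x hx
    rw [image_eq_zero_of_notMem_tsupport hx, zero_smul]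
  · intro x hx
    have hx' : x ∉ tsupport (fderiv ℝ φ) := fun h => hx (tsupport_fderiv_subset ℝ h)
    rw [image_eq_zero_of_notMem_tsupport hx']
    simp

/-- `C¹` functions belong to `H¹` of bounded open sets. -/
theorem of_contDiff (hU : IsOpen U) (hb : Bornology.IsBounded U) (hv : ContDiff ℝ 1 v) :
    IsH1 U v fun i x => fderiv ℝ v x (EuclideanSpace.single i 1) := by
  have hmem : ∀ f : E d → ℂ, Continuous f → MemLp f 2 (volume.restrict U) := by
    intro f hf
    have hcl : IsCompact (closure U) := hb.isCompact_closure
    have hfin : IsFiniteMeasure (volume.restrict U) :=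
      ⟨by rw [Measure.restrict_apply_univ]; exact hb.measure_lt_top⟩
    obtain ⟨C, hC⟩ := hcl.exists_bound_of_continuousOn hf.continuousOn
    refine MemLp.of_bound hf.aestronglyMeasurable C ?_
    filter_upwards [self_mem_ae_restrict hU.measurableSet] with x hx
    exact hC x (subset_closure hx)
  refine ⟨hmem v hv.continuous, fun i => hmem _ (continuous_fderiv_apply hv _),
    fun i φ hφ hs ht => ?_⟩
  have hφd : Differentiable ℝ φ := hφ.differentiable (by simp)
  have hvl : LocallyIntegrable v := hv.continuous.locallyIntegrable
  have hgl : LocallyIntegrable fun x => fderiv ℝ v x (EuclideanSpace.single i 1) :=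
    (continuous_fderiv_apply hv _).locallyIntegrable
  have h1 := integral_smul_fderiv_eq_neg_fderiv_smul_of_integrable (μ := volume)
    (f := φ) (g := v) (v := EuclideanSpace.single i 1)
    (hvl.integrable_smul_left_of_hasCompactSupport (continuous_fderiv_test hφ _)
      (hs.fderiv_apply (𝕜 := ℝ) _))
    (hgl.integrable_smul_left_of_hasCompactSupport hφ.continuous hs)
    (hvl.integrable_smul_left_of_hasCompactSupport hφ.continuous hs)
    (fun x _ => hφd x) (fun x _ => (hv.differentiable one_ne_zero) x)
  rw [setIntegral_eq_integral_of_forall_compl_eq_zero, setIntegral_eq_integral_of_forall_compl_eq_zero,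
    h1, neg_neg]
  · intro x hx
    rw [image_eq_zero_of_notMem_tsupport fun h => hx (ht h), zero_smul]
  · intro x hx
    have hx' : x ∉ tsupport (fderiv ℝ φ) := fun h => hx (ht (tsupport_fderiv_subset ℝ h))
    rw [image_eq_zero_of_notMem_tsupport hx']
    simp

theorem sub_const (hU : IsOpen U) (hb : Bornology.IsBounded U) (h : IsH1 U v g) (m : ℂ) :
    IsH1 U (fun x => v x - m) g := by
  refine (h.sub (of_contDiff hU hb (contDiff_const (c := m)))).congr (by rfl) fun i => ?_
  simp

end IsH1

/-! ### Density of smooth functions in `H¹(K)`. -/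

open scoped Convolution in
/-- Mollification with the kernel `η` composed with the dilation by `l` centred at `c`. -/
noncomputable def mollify (η : E d → ℝ) (c : E d) (l : ℝ) (v : E d → ℂ) (x : E d) : ℂ :=
  (η ⋆[ContinuousLinearMap.lsmul ℝ ℝ, volume] v) (c + l • (x - c))

theorem mollify_eq (η : E d → ℝ) (c : E d) (l : ℝ) (v : E d → ℂ) (x : E d) :
    mollify η c l v x = ∫ t, η t • v (c + l • (x - c) - t) := rfl

theorem contDiff_mollify {η : E d → ℝ} (hη : ContDiff ℝ (⊤ : ℕ∞) η) (hs : HasCompactSupport η)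
    (c : E d) (l : ℝ) {v : E d → ℂ} (hv : LocallyIntegrable v) :
    ContDiff ℝ (⊤ : ℕ∞) (mollify η c l v) := by
  have h1 := hs.contDiff_convolution_left (ContinuousLinearMap.lsmul ℝ ℝ) (μ := volume) hη hv
  exact h1.comp (by fun_prop : ContDiff ℝ (⊤ : ℕ∞) fun x : E d => c + l • (x - c))

/-- Mollification is bounded in `L²`. -/
theorem sqNorm_mollify_le {η : E d → ℝ} (hη0 : ∀ x, 0 ≤ η x) (hηc : Continuous η)
    (hηi : Integrable η) (hη1 : ∫ x, η x = 1) (c : E d) {l : ℝ} (hl : 0 < l)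
    {v : E d → ℂ} (hv : Measurable v) :
    sqNorm volume (mollify η c l v) ≤ ENNReal.ofReal ((l ^ d)⁻¹) * sqNorm volume v := by
  have hη1' : ∫⁻ t, ‖η t‖ₑ = 1 := by
    rw [← ENNReal.ofReal_one, ← hη1, ofReal_integral_eq_lintegral_ofReal hηi (Eventually.of_forall hη0)]
    congr with t
    rw [Real.enorm_of_nonneg (hη0 t)]
  have hηm : Measurable fun t => ‖η t‖ₑ := hηc.measurable.enorm
  have hm : Measurable fun p : E d × E d => ‖η p.2‖ₑ * ‖v (c + l • (p.1 - c) - p.2)‖ₑ ^ 2 :=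
    (hηm.comp measurable_snd).mul
      ((hv.comp (by fun_prop : Measurable fun p : E d × E d => c + l • (p.1 - c) - p.2)).enorm.pow_const 2)
  have hpt : ∀ x, ‖mollify η c l v x‖ₑ ^ 2 ≤
      ∫⁻ t, ‖η t‖ₑ * ‖v (c + l • (x - c) - t)‖ₑ ^ 2 := by
    intro x
    have hvm : Measurable fun t => ‖v (c + l • (x - c) - t)‖ₑ :=
      (hv.comp (by fun_prop : Measurable fun t : E d => c + l • (x - c) - t)).enorm
    -- With the kernel split into two square roots, Cauchy-Schwarz and `∫ η = 1` give Jensen's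
    -- inequality for the square.
    have h1 : ‖mollify η c l v x‖ₑ ≤ ∫⁻ t, ‖η t‖ₑ ^ (1 / 2 : ℝ) *
        (‖η t‖ₑ ^ (1 / 2 : ℝ) * ‖v (c + l • (x - c) - t)‖ₑ) := by
      rw [mollify_eq]
      refine (enorm_integral_le_lintegral_enorm _).trans (le_of_eq ?_)
      congr with t
      rw [enorm_smul, ← mul_assoc, ← ENNReal.rpow_add_of_nonneg _ _ (by norm_num) (by norm_num)]
      norm_num
    refine (pow_le_pow_left' h1 2).trans ?_
    refine (sq_lintegral_mul_le _ (hηm.pow_const _).aemeasurable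
      ((hηm.pow_const _).mul hvm).aemeasurable).trans (le_of_eq ?_)
    have e : ∀ t, (‖η t‖ₑ ^ (1 / 2 : ℝ)) ^ 2 = ‖η t‖ₑ := fun t => by
      rw [← ENNReal.rpow_natCast, ← ENNReal.rpow_mul]; norm_num
    simp only [Pi.mul_apply, mul_pow, e]
    rw [hη1', one_mul]
  calc _ ≤ ∫⁻ x, ∫⁻ t, ‖η t‖ₑ * ‖v (c + l • (x - c) - t)‖ₑ ^ 2 := lintegral_mono hpt
    _ = ∫⁻ t, ∫⁻ x, ‖η t‖ₑ * ‖v (c + l • (x - c) - t)‖ₑ ^ 2 :=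
        lintegral_lintegral_swap hm.aemeasurable
    _ = ∫⁻ t, ‖η t‖ₑ * (ENNReal.ofReal ((l ^ d)⁻¹) * sqNorm volume v) := by
        congr with t
        rw [lintegral_const_mul' _ _ (by simp)]
        congr 1
        have e : ∀ x : E d, c + l • (x - c) - t = (c - l • c - t) + l • x := fun x => by module
        simp_rw [e]
        exact lintegral_comp_add_smul (fun y => ‖v y‖ₑ ^ 2) _ hl
    _ = _ := by rw [lintegral_mul_const _ hηm, hη1', one_mul]

namespace IsStarBall

variable {K : Set (E d)} {c : E d} {r ρ : ℝ}

theorem integrable_indicator (h : IsStarBall K c r ρ) {v : E d → ℂ}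
    (hv : MemLp v 2 (volume.restrict K)) : Integrable (K.indicator v) := by
  have : IsFiniteMeasure (volume.restrict K) := ⟨by
    rw [Measure.restrict_apply_univ]; exact h.volume_lt_top⟩
  rw [integrable_indicator_iff h.isOpen.measurableSet]
  exact hv.integrable (by norm_num)

/-- Contraction by `l` leaves room `(1 - l) r` around the image of `x`. A kernel with smaller
support therefore samples the function only inside `K`, and no extension across the boundary is
required. -/
theorem sub_mem_of_support (h : IsStarBall K c r ρ) {l : ℝ} (hl0 : 0 ≤ l) (hl1 : l < 1) {x t : E d}
    (hx : x ∈ K) (ht : ‖t‖ < (1 - l) * r) : c + l • (x - c) - t ∈ K := by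
  refine h.ball_lineMap_subset (subset_closure hx) hl0 hl1 ?_
  rw [mem_ball_iff_norm]
  simpa using ht

/-- Inside `K`, the derivative of the mollification is the mollification of the weak derivative. -/
theorem fderiv_mollify (h : IsStarBall K c r ρ) {η : E d → ℝ} (hη : ContDiff ℝ (⊤ : ℕ∞) η)
    {l δ : ℝ} (hl0 : 0 ≤ l) (hl1 : l < 1) (hδ : δ < (1 - l) * r)
    (hs : tsupport η ⊆ Metric.closedBall 0 δ)
    {v g : E d → ℂ} (hv : MemLp v 2 (volume.restrict K)) {i : Fin d} (hw : HasWeakDeriv K i v g)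
    {x : E d} (hx : x ∈ K) :
    fderiv ℝ (mollify η c l (K.indicator v)) x (EuclideanSpace.single i 1)
      = l • mollify η c l (K.indicator g) x := by
  have hKm := h.isOpen.measurableSet
  have hcs : HasCompactSupport η := (isCompact_closedBall (0 : E d) δ).of_isClosed_subset
    (isClosed_tsupport η) hs
  have hvi := h.integrable_indicator hv
  set e : E d := EuclideanSpace.single i 1 with he
  set x₀ := c + l • (x - c) with hx₀
  have hd := hcs.hasFDerivAt_convolution_left (ContinuousLinearMap.lsmul ℝ ℝ) (μ := volume)
    (hη.of_le (by simp)) hvi.locallyIntegrable x₀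
  have hA : HasFDerivAt (fun y : E d => c + l • (y - c)) (l • ContinuousLinearMap.id ℝ (E d)) x :=
    (((hasFDerivAt_id x).sub_const c).const_smul l).const_add c
  have hcomp : HasFDerivAt (mollify η c l (K.indicator v)) _ x := hd.comp x hA
  rw [hcomp.fderiv]
  simp only [ContinuousLinearMap.comp_apply, _root_.smul_apply,
    ContinuousLinearMap.id_apply, map_smul]
  congr 1
  rw [mollify_eq]
  have hint : Integrable (fun t => (ContinuousLinearMap.precompL (E d)
      (ContinuousLinearMap.lsmul ℝ ℝ : ℝ →L[ℝ] ℂ →L[ℝ] ℂ)) (fderiv ℝ η t)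
      (K.indicator v (x₀ - t))) volume := by
    have := (hcs.fderiv (𝕜 := ℝ)).convolutionExists_left
      (ContinuousLinearMap.precompL (E d) (ContinuousLinearMap.lsmul ℝ ℝ : ℝ →L[ℝ] ℂ →L[ℝ] ℂ))
      (hη.continuous_fderiv (by simp)) hvi.locallyIntegrable x₀
    exact this
  have hL : (MeasureTheory.convolution (fderiv ℝ η) (K.indicator v)
      (ContinuousLinearMap.precompL (E d) (ContinuousLinearMap.lsmul ℝ ℝ : ℝ →L[ℝ] ℂ →L[ℝ] ℂ))
      volume x₀) e = ∫ t, (fderiv ℝ η t e) • K.indicator v (x₀ - t) := by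
    rw [MeasureTheory.convolution, ContinuousLinearMap.integral_apply hint]
    rfl
  rw [hL]
  rw [← integral_sub_left_eq_self (fun t => (fderiv ℝ η t e) • K.indicator v (x₀ - t)) volume x₀,
    ← integral_sub_left_eq_self (fun t => η t • K.indicator g (x₀ - t)) volume x₀]
  simp only [sub_sub_cancel]
  have hind : ∀ (a : E d → ℝ) (u : E d → ℂ), ∫ z, a z • K.indicator u z = ∫ z in K, a z • u z := by
    intro a u
    rw [← integral_indicator hKm]
    congr with z
    by_cases hz : z ∈ K <;> simp [hz]
  rw [hind, hind]
  have hψ : ContDiff ℝ (⊤ : ℕ∞) fun z => η (x₀ - z) := hη.comp (by fun_prop)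
  have hψt : tsupport (fun z => η (x₀ - z)) ⊆ Metric.closedBall x₀ δ := by
    refine closure_minimal (fun z hz => ?_) Metric.isClosed_closedBall
    have := hs (subset_tsupport η hz)
    rw [mem_closedBall_zero_iff, norm_sub_rev] at this
    exact mem_closedBall_iff_norm.2 this
  have hψs : HasCompactSupport fun z => η (x₀ - z) :=
    (isCompact_closedBall x₀ δ).of_isClosed_subset (isClosed_tsupport _) hψt
  have hψd : ∀ z, fderiv ℝ (fun z => η (x₀ - z)) z e = - fderiv ℝ η (x₀ - z) e := by
    intro z
    have h1 : HasFDerivAt (fun z => x₀ - z) (-ContinuousLinearMap.id ℝ (E d)) z :=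
      (hasFDerivAt_id z).const_sub x₀
    have h2 := ((hη.differentiable (by simp)) (x₀ - z)).hasFDerivAt.comp z h1
    have : fderiv ℝ (fun z => η (x₀ - z)) z = _ := h2.fderiv
    rw [this]
    simp
  -- The reflected and translated kernel is a test function on `K`, as its support lies in `K`; the
  -- sign from the reflection cancels that of the weak derivative.
  have hweak := hw _ hψ hψs (hψt.trans fun z hz => ?_)
  · simp only [← he, hψd, neg_smul] at hweak
    rw [integral_neg, neg_inj] at hweak
    exact hweak
  · have := h.sub_mem_of_support (t := x₀ - z) hl0 hl1 hx (by
      rw [norm_sub_rev]; exact (mem_closedBall_iff_norm.1 hz).trans_lt hδ)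
    rwa [← hx₀, sub_sub_cancel] at this

/-- Mollification with dilation converges in `L²(K)`. -/
theorem tendsto_mollify (h : IsStarBall K c r ρ) {η : ℕ → E d → ℝ} {l : ℕ → ℝ}
    (hη0 : ∀ n x, 0 ≤ η n x) (hηc : ∀ n, Continuous (η n)) (hηi : ∀ n, Integrable (η n))
    (hη1 : ∀ n, ∫ x, η n x = 1) (hl0 : ∀ n, 1 / 2 ≤ l n) (hl1 : ∀ n, l n < 1)
    (hll : Tendsto l atTop (𝓝 1))
    (hs : ∀ n, Function.support (η n) ⊆ Metric.ball 0 ((1 - l n) * r))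
    {v : E d → ℂ} (hvm : Measurable v) (hv : MemLp v 2 (volume.restrict K)) :
    Tendsto (fun n => volSq K fun x => v x - mollify (η n) c (l n) (K.indicator v) x) atTop (𝓝 0) := by
  have hKm := h.isOpen.measurableSet
  have hr := h.pos
  have hρ := h.rho_nonneg
  have hKfin : volume K ≠ ⊤ := h.volume_lt_top.ne
  have hbd : ∀ n (w : E d → ℂ), Measurable w →
      volSq K (mollify (η n) c (l n) (K.indicator w)) ≤ ENNReal.ofReal (2 ^ d) * volSq K w := by
    intro n w hw
    have hl : 0 < l n := by linarith [hl0 n]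
    calc _ ≤ sqNorm volume (mollify (η n) c (l n) (K.indicator w)) :=
          lintegral_mono' Measure.restrict_le_self le_rfl
      _ ≤ ENNReal.ofReal ((l n ^ d)⁻¹) * sqNorm volume (K.indicator w) :=
          sqNorm_mollify_le (hη0 n) (hηc n) (hηi n) (hη1 n) c hl (hw.indicator hKm)
      _ ≤ _ := by
          refine mul_le_mul' (ENNReal.ofReal_le_ofReal ?_) (le_of_eq ?_)
          · rw [← inv_pow]
            have : (l n)⁻¹ ≤ 2 := by rw [inv_le_comm₀ hl two_pos]; linarith [hl0 n]
            gcongr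
          · rw [volSq_eq, ← lintegral_indicator hKm, sqNorm]
            congr with x
            by_cases hx : x ∈ K <;> simp [hx]
  rw [ENNReal.tendsto_nhds_zero]
  intro ε hε
  by_cases hεt : ε = ⊤
  · simp [hεt]
  set C : ℝ≥0∞ := 4 * (2 + ENNReal.ofReal (2 ^ d)) with hC
  have hC0 : C ≠ 0 := by simp [hC]
  have hCt : C ≠ ⊤ := ENNReal.mul_ne_top (by simp) (by simp [ENNReal.add_eq_top])
  -- Density plus uniform boundedness: for continuous `f` with compact support the mollifications
  -- converge uniformly on `K`, and those of `v - f` are controlled by `hbd` uniformly in `n`. `C`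
  -- collects the losses of the three-term splitting.
  obtain ⟨f, hfs, hfe, hfc, hfL⟩ := hv.exists_hasCompactSupport_eLpNorm_sub_le (by norm_num)
    (ε := (ε / C / 2) ^ (1 / 2 : ℝ)) (by
      rw [Ne, ENNReal.rpow_eq_zero_iff]
      push Not
      refine ⟨fun h0 => ?_, fun _ => by norm_num⟩
      rw [ENNReal.div_eq_zero_iff, ENNReal.div_eq_zero_iff] at h0
      rcases h0 with (h0 | h0) | h0
      · exact absurd h0 hε.ne'
      · exact absurd h0 hCt
      · exact absurd h0 (by simp))
  have hvf : volSq K (fun x => v x - f x) ≤ ε / C / 2 := by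
    rw [volSq, sqNorm_eq_eLpNorm]
    refine (pow_le_pow_left' hfe 2).trans (le_of_eq ?_)
    rw [← ENNReal.rpow_natCast, ← ENNReal.rpow_mul]; norm_num
  have hunif := hfs.uniformContinuous_of_continuous hfc
  obtain ⟨ε', hε'0, hε'⟩ : ∃ ε' : ℝ, 0 < ε' ∧ ENNReal.ofReal (ε' ^ 2) * volume K ≤ ε / C / 2 := by
    have hpos : 0 < ε / C / 2 := by
      refine ENNReal.div_pos (ENNReal.div_pos hε.ne' hCt).ne' (by simp)
    have ht : Tendsto (fun a : ℝ => ENNReal.ofReal (a ^ 2) * volume K) (𝓝[>] 0) (𝓝 0) := by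
      have h1 : Tendsto (fun a : ℝ => ENNReal.ofReal (a ^ 2)) (𝓝[>] 0) (𝓝 0) := by
        have : Continuous fun a : ℝ => ENNReal.ofReal (a ^ 2) :=
          ENNReal.continuous_ofReal.comp (by fun_prop)
        have := (this.tendsto 0).mono_left (nhdsWithin_le_nhds (s := Ioi 0))
        simpa using this
      simpa using ENNReal.Tendsto.mul_const h1 (Or.inr hKfin)
    obtain ⟨a, ha1, ha2⟩ := ((ht.eventually (ge_mem_nhds hpos)).and self_mem_nhdsWithin).exists
    exact ⟨a, ha2, ha1⟩
  obtain ⟨δ, hδ0, hδ⟩ := Metric.uniformContinuous_iff.1 hunif ε' hε'0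
  have hev : ∀ᶠ n in atTop, (1 - l n) * (ρ * r + r) < δ := by
    have : Tendsto (fun n => (1 - l n) * (ρ * r + r)) atTop (𝓝 ((1 - 1) * (ρ * r + r))) :=
      (hll.const_sub 1).mul_const _
    rw [sub_self, zero_mul] at this
    exact this.eventually (gt_mem_nhds hδ0)
  filter_upwards [hev] with n hn
  have hptw : ∀ x ∈ K, ‖f x - mollify (η n) c (l n) (K.indicator f) x‖ₑ ^ 2 ≤
      ENNReal.ofReal (ε' ^ 2) := by
    intro x hx
    rw [enorm_sq_eq]
    apply ENNReal.ofReal_le_ofReal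
    rw [← dist_eq_norm, dist_comm]
    refine pow_le_pow_left₀ dist_nonneg ?_ 2
    refine MeasureTheory.dist_convolution_le hε'0.le (hs n) (hη0 n) (hη1 n)
      ((hfc.measurable.indicator hKm).aestronglyMeasurable) fun y hy => ?_
    have hyK : y ∈ K := h.ball_lineMap_subset (subset_closure hx) (by linarith [hl0 n]) (hl1 n) hy
    rw [indicator_of_mem hyK]
    refine (hδ ?_).le
    rw [mem_ball_iff_norm] at hy
    calc dist y x = ‖(y - (c + l n • (x - c))) + (-(1 - l n)) • (x - c)‖ := by
          rw [dist_eq_norm]; congr 1; module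
      _ ≤ ‖y - (c + l n • (x - c))‖ + ‖(-(1 - l n)) • (x - c)‖ := norm_add_le _ _
      _ ≤ (1 - l n) * r + (1 - l n) * (ρ * r) := by
          rw [norm_smul, norm_neg, Real.norm_of_nonneg (by linarith [hl1 n])]
          have h1 : 0 ≤ 1 - l n := by linarith [hl1 n]
          have h2 := h.norm_sub_center_le (subset_closure hx)
          have := mul_le_mul_of_nonneg_left h2 h1
          linarith
      _ < δ := by linarith
  have hfm := hfc.measurable
  have h2 : volSq K (fun x => f x - mollify (η n) c (l n) (K.indicator f) x) ≤ ε / C / 2 := by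
    refine le_trans ?_ hε'
    calc _ ≤ ∫⁻ x in K, ENNReal.ofReal (ε' ^ 2) := setLIntegral_mono' hKm hptw
      _ = _ := by rw [lintegral_const, Measure.restrict_apply_univ]
  have hmdiff : ∀ x, mollify (η n) c (l n) (K.indicator v) x =
      mollify (η n) c (l n) (K.indicator f) x +
        mollify (η n) c (l n) (K.indicator fun x => v x - f x) x := by
    intro x
    have hηb : ∃ B, ∀ t, ‖η n t‖ ≤ B := by
      have hcs : HasCompactSupport (η n) := HasCompactSupport.of_support_subset_isCompact
        (isCompact_closedBall (0 : E d) ((1 - l n) * r)) ((hs n).trans Metric.ball_subset_closedBall)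
      obtain ⟨B, hB⟩ := (hηc n).bounded_above_of_compact_support hcs
      exact ⟨B, hB⟩
    obtain ⟨B, hB⟩ := hηb
    have hi : ∀ w : E d → ℂ, MemLp w 2 (volume.restrict K) →
        Integrable fun t => η n t • K.indicator w (c + l n • (x - c) - t) := fun w hw =>
      ((h.integrable_indicator hw).comp_sub_left _).bdd_smul B (hηc n).aestronglyMeasurable
        (Eventually.of_forall hB)
    rw [mollify_eq, mollify_eq, mollify_eq,
      ← integral_add (hi f hfL) (hi (fun x => v x - f x) (hv.sub hfL))]
    congr with t
    rw [← smul_add]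
    congr 1
    by_cases hx : c + l n • (x - c) - t ∈ K <;> simp [hx]
  set T := mollify (η n) c (l n) (K.indicator fun x => v x - f x) with hT
  set S := mollify (η n) c (l n) (K.indicator f) with hS
  calc volSq K (fun x => v x - mollify (η n) c (l n) (K.indicator v) x)
      = volSq K (fun x => (v x - f x) + ((f x - S x) - T x)) := by
        congr with x; rw [hmdiff]; ring
    _ ≤ 2 * volSq K (fun x => v x - f x) + 2 * volSq K (fun x => (f x - S x) - T x) :=
        sqNorm_add_le (hvm.sub hfm).aestronglyMeasurable
    _ ≤ 2 * volSq K (fun x => v x - f x) + 2 * (2 * volSq K (fun x => f x - S x) + 2 * volSq K T) := by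
        gcongr
        refine sqNorm_sub_le ?_
        have hcs : HasCompactSupport (η n) := HasCompactSupport.of_support_subset_isCompact
          (isCompact_closedBall (0 : E d) ((1 - l n) * r)) ((hs n).trans Metric.ball_subset_closedBall)
        have hSc : Continuous S := by
          have := hcs.continuous_convolution_left (ContinuousLinearMap.lsmul ℝ ℝ) (μ := volume)
            (hηc n) (h.integrable_indicator hfL).locallyIntegrable
          exact this.comp (by fun_prop : Continuous fun x : E d => c + l n • (x - c))
        exact (hfc.sub hSc).aestronglyMeasurable
    _ ≤ 2 * (ε / C / 2) + 2 * (2 * (ε / C / 2) + 2 * (ENNReal.ofReal (2 ^ d) * (ε / C / 2))) := by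
        gcongr
        exact (hbd n _ (hvm.sub hfm)).trans (mul_le_mul' le_rfl hvf)
    _ ≤ C * (ε / C) := by
        have : ε / C / 2 ≤ ε / C := ENNReal.half_le_self
        calc _ = (6 + 4 * ENNReal.ofReal (2 ^ d)) * (ε / C / 2) := by ring
          _ ≤ (8 + 4 * ENNReal.ofReal (2 ^ d)) * (ε / C) := by gcongr; norm_num
          _ = _ := by rw [hC]; ring
    _ = ε := ENNReal.mul_div_cancel hC0 hCt

/-- Smooth functions are dense in `H¹(K)`. -/
theorem exists_smooth_tendsto (h : IsStarBall K c r ρ) {v : E d → ℂ} {g : Fin d → E d → ℂ}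
    (hv : IsH1 K v g) :
    ∃ φ : ℕ → E d → ℂ, (∀ n, ContDiff ℝ (⊤ : ℕ∞) (φ n)) ∧
      Tendsto (fun n => volSq K (fun x => v x - φ n x)) atTop (𝓝 0) ∧
      ∀ i, Tendsto (fun n => volSq K (fun x =>
        g i x - fderiv ℝ (φ n) x (EuclideanSpace.single i 1))) atTop (𝓝 0) := by
  have hKm := h.isOpen.measurableSet
  have hr := h.pos
  wlog hm : Measurable v ∧ ∀ i, Measurable (g i) generalizing v g
  · obtain ⟨v', hv'm, hv'⟩ := hv.memLp.1.aemeasurable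
    choose g' hg'm hg' using fun i => (hv.memLp_grad i).1.aemeasurable
    obtain ⟨φ, hφ, h1, h2⟩ := this (hv.congr hv' hg') ⟨hv'm, hg'm⟩
    refine ⟨φ, hφ, ?_, fun i => ?_⟩
    · refine h1.congr fun n => sqNorm_congr ?_
      exact hv'.mono fun x hx => by simp only [hx]
    · refine (h2 i).congr fun n => sqNorm_congr ?_
      exact (hg' i).mono fun x hx => by simp only [hx]
  set l : ℕ → ℝ := fun n => 1 - 1 / ((n : ℝ) + 1 + 1) with hl
  have hl0 : ∀ n, 1 / 2 ≤ l n := fun n => by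
    have : 1 / ((n : ℝ) + 1 + 1) ≤ 1 / 2 := by
      apply one_div_le_one_div_of_le two_pos; linarith [show (0 : ℝ) ≤ n by positivity]
    simp only [hl]; linarith
  have hl1 : ∀ n, l n < 1 := fun n => by
    have : 0 < 1 / ((n : ℝ) + 1 + 1) := by positivity
    simp only [hl]; linarith
  have hll : Tendsto l atTop (𝓝 1) := by
    have := (tendsto_one_div_add_atTop_nhds_zero_nat (𝕜 := ℝ)).comp (tendsto_add_atTop_nat 1)
    have := this.const_sub 1
    rw [sub_zero] at this
    refine this.congr fun n => ?_
    simp [hl]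
  have hδ : ∀ n, 0 < (1 - l n) * r / 2 := fun n => by
    have := hl1 n
    have : 0 < 1 - l n := by linarith
    positivity
  set b : ∀ n, ContDiffBump (0 : E d) := fun n =>
    ⟨(1 - l n) * r / 4, (1 - l n) * r / 2, by linarith [hδ n], by linarith [hδ n]⟩ with hb
  set η : ℕ → E d → ℝ := fun n => (b n).normed volume with hη
  have hηsm : ∀ n, ContDiff ℝ (⊤ : ℕ∞) (η n) := fun n => (b n).contDiff_normed
  have hts : ∀ n, tsupport (η n) ⊆ Metric.closedBall 0 ((1 - l n) * r / 2) := fun n =>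
    ((b n).tsupport_normed_eq).subset
  have hsup : ∀ n, Function.support (η n) ⊆ Metric.ball 0 ((1 - l n) * r) := fun n => by
    refine ((b n).support_normed_eq).subset.trans (Metric.ball_subset_ball ?_)
    change (1 - l n) * r / 2 ≤ _
    linarith [hδ n]
  have hconv : ∀ w : E d → ℂ, Measurable w → MemLp w 2 (volume.restrict K) → Tendsto (fun n =>
      volSq K fun x => w x - mollify (η n) c (l n) (K.indicator w) x) atTop (𝓝 0) := fun w hw hwL =>
    h.tendsto_mollify (fun n x => (b n).nonneg_normed x) (fun n => (b n).continuous_normed)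
      (fun n => (b n).integrable_normed) (fun n => (b n).integral_normed) hl0 hl1 hll hsup hw hwL
  refine ⟨fun n => mollify (η n) c (l n) (K.indicator v), fun n => ?_, hconv v hm.1 hv.memLp,
    fun i => ?_⟩
  · exact contDiff_mollify (hηsm n) (b n).hasCompactSupport_normed _ _
      (h.integrable_indicator hv.memLp).locallyIntegrable
  · have hgL := hv.memLp_grad i
    have h1 := hconv (g i) (hm.2 i) hgL
    have hfin : volSq K (g i) < ⊤ := sqNorm_lt_top hgL
    have hbound : ∀ n, volSq K (fun x => g i x -
        fderiv ℝ (mollify (η n) c (l n) (K.indicator v)) x (EuclideanSpace.single i 1)) ≤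
        2 * ENNReal.ofReal ((1 - l n) ^ 2) * volSq K (g i) + 2 * volSq K
          (fun x => g i x - mollify (η n) c (l n) (K.indicator (g i)) x) := by
      intro n
      -- The chain rule leaves a factor `l`, so the error is written as `(1 - l) g + l (g -
      -- mollified g)`; both parts tend to zero.
      have e : volSq K (fun x => g i x -
          fderiv ℝ (mollify (η n) c (l n) (K.indicator v)) x (EuclideanSpace.single i 1)) =
          volSq K (fun x => ((1 - l n : ℝ) : ℂ) * g i x +
            ((l n : ℝ) : ℂ) * (g i x - mollify (η n) c (l n) (K.indicator (g i)) x)) := by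
        refine setLIntegral_congr_fun hKm fun x hx => ?_
        beta_reduce
        rw [h.fderiv_mollify (hηsm n) (by linarith [hl0 n]) (hl1 n) (by linarith [hδ n]) (hts n)
          hv.memLp (hv.weak i) hx, Complex.real_smul]
        congr 2
        push_cast; ring
      rw [e]
      refine (sqNorm_add_le ((hm.2 i).const_mul _).aestronglyMeasurable).trans ?_
      rw [sqNorm_const_mul, sqNorm_const_mul, mul_assoc]
      refine add_le_add (mul_le_mul' le_rfl (mul_le_mul' ?_ le_rfl)) (mul_le_mul' le_rfl ?_)
      · rw [enorm_sq_eq]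
        apply ENNReal.ofReal_le_ofReal
        rw [Complex.norm_real, Real.norm_eq_abs, sq_abs]
      · refine mul_le_of_le_one_left zero_le ?_
        rw [enorm_sq_eq, ← ENNReal.ofReal_one]
        apply ENNReal.ofReal_le_ofReal
        rw [Complex.norm_real, Real.norm_eq_abs, sq_abs]
        have := hl0 n; have := hl1 n
        nlinarith
    refine tendsto_of_tendsto_of_tendsto_of_le_of_le tendsto_const_nhds ?_ (fun n => zero_le) hbound
    have h2 : Tendsto (fun n => ENNReal.ofReal ((1 - l n) ^ 2)) atTop (𝓝 0) := by
      have : Tendsto (fun n => (1 - l n) ^ 2) atTop (𝓝 ((1 - 1) ^ 2)) := (hll.const_sub 1).pow 2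
      have := ENNReal.tendsto_ofReal this
      simpa using this
    have h3 := ENNReal.Tendsto.mul_const (ENNReal.Tendsto.const_mul h2 (Or.inr (by simp : (2 : ℝ≥0∞) ≠ ⊤)))
      (Or.inr hfin.ne)
    have h4 := ENNReal.Tendsto.const_mul h1 (Or.inr (by simp : (2 : ℝ≥0∞) ≠ ⊤))
    simpa using h3.add h4

end IsStarBall

/-! ### Existence of traces and the trace inequality in `H¹(K)`. -/

theorem sqNorm_le_add {μ : Measure (E d)} {v w : E d → ℂ} (hv : AEStronglyMeasurable v μ) :
    sqNorm μ w ≤ 2 * sqNorm μ v + 2 * sqNorm μ (fun x => v x - w x) := by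
  have := sqNorm_sub_le (w := fun x => v x - w x) hv
  simpa using this

theorem lintegral_gradEnergy {K : Set (E d)} {φ : E d → ℂ} (hφ : ContDiff ℝ 1 φ) :
    ∫⁻ x in K, gradEnergy φ x
      = ∑ i, volSq K fun x => fderiv ℝ φ x (EuclideanSpace.single i 1) :=
  lintegral_finsetSum _ fun _ _ => (continuous_fderiv_apply hφ _).measurable.enorm.pow_const 2

/-- The constant of the trace inequality. -/
noncomputable def traceConst (d : ℕ) (ρ : ℝ) : ℝ≥0∞ := surfConst d ρ * (8 * ENNReal.ofReal (1 + ρ ^ 2))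

theorem traceConst_ne_top (ρ : ℝ) : traceConst d ρ ≠ ⊤ :=
  ENNReal.mul_ne_top (surfConst_ne_top ρ) (ENNReal.mul_ne_top (by simp) ENNReal.ofReal_ne_top)

namespace IsStarBall

variable {K : Set (E d)} {c : E d} {r ρ : ℝ}

/-- Trace inequality for `C¹` functions in terms of `volSq`. -/
theorem surfSq_le_of_contDiff' (h : IsStarBall K c r ρ) (hd : 1 ≤ d) {φ : E d → ℂ}
    (hφ : ContDiff ℝ 1 φ) :
    surfSq (frontier K) φ ≤ surfConst d ρ * ENNReal.ofReal r⁻¹ * (2 * ENNReal.ofReal (1 + ρ ^ 2)) *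
      (volSq K φ + ENNReal.ofReal (r ^ 2) *
        ∑ i, volSq K fun x => fderiv ℝ φ x (EuclideanSpace.single i 1)) := by
  refine (h.surfSq_le_of_contDiff hd hφ).trans ?_
  rw [lintegral_gradEnergy hφ, mul_assoc (surfConst d ρ * ENNReal.ofReal r⁻¹)]
  gcongr
  have h1 : (1 : ℝ≥0∞) ≤ ENNReal.ofReal (1 + ρ ^ 2) := by
    rw [← ENNReal.ofReal_one]; apply ENNReal.ofReal_le_ofReal; nlinarith
  have h2 : ENNReal.ofReal (ρ ^ 2) ≤ ENNReal.ofReal (1 + ρ ^ 2) := by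
    apply ENNReal.ofReal_le_ofReal; nlinarith
  rw [mul_pow, ENNReal.ofReal_mul (by positivity), mul_add]
  refine add_le_add ?_ ?_
  · calc 2 * volSq K φ = 2 * 1 * volSq K φ := by ring
      _ ≤ _ := by gcongr
  · rw [← mul_assoc, ← mul_assoc]; gcongr

/-- Trace inequality in `H¹(K)`. -/
theorem surfSq_isTrace_le (h : IsStarBall K c r ρ) (hd : 1 ≤ d) {v t : E d → ℂ}
    (ht : IsTrace K v t) :
    surfSq (frontier K) t ≤ traceConst d ρ * ENNReal.ofReal r⁻¹ *
      (volSq K v + ENNReal.ofReal (r ^ 2) * gradSq K v) := by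
  obtain ⟨hv, htL, φ, hφ, h1, h2, h3⟩ := ht
  have hv' := hv.isH1
  have hφ1 : ∀ n, ContDiff ℝ 1 (φ n) := fun n => (hφ n).of_le (by simp)
  set A := surfConst d ρ * ENNReal.ofReal r⁻¹ * (2 * ENNReal.ofReal (1 + ρ ^ 2)) with hA
  have hAt : A ≠ ⊤ := ENNReal.mul_ne_top (ENNReal.mul_ne_top (surfConst_ne_top ρ) ENNReal.ofReal_ne_top)
    (ENNReal.mul_ne_top (by simp) ENNReal.ofReal_ne_top)
  set e : ℕ → ℝ≥0∞ := fun n => volSq K (fun x => v x - φ n x) + ENNReal.ofReal (r ^ 2) *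
    ∑ i, volSq K fun x => weakDeriv K i v x - fderiv ℝ (φ n) x (EuclideanSpace.single i 1) with he
  have he0 : Tendsto e atTop (𝓝 0) := by
    have hs : Tendsto (fun n => ∑ i, volSq K fun x =>
        weakDeriv K i v x - fderiv ℝ (φ n) x (EuclideanSpace.single i 1)) atTop (𝓝 0) := by
      have := tendsto_finsetSum Finset.univ fun i _ => h2 i
      simpa using this
    have := h1.add (ENNReal.Tendsto.const_mul (a := ENNReal.ofReal (r ^ 2)) hs
      (Or.inr ENNReal.ofReal_ne_top))
    simpa using this
  have hb : ∀ n, surfSq (frontier K) t ≤ 2 * surfSq (frontier K) (fun x => t x - φ n x) +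
      2 * (A * (2 * (volSq K v + ENNReal.ofReal (r ^ 2) * gradSq K v) + 2 * e n)) := by
    intro n
    have hcφ := (hφ1 n).continuous
    have e1 : surfSq (frontier K) t = surfSq (frontier K) (fun x => (t x - φ n x) + φ n x) := by simp
    rw [e1]
    refine (sqNorm_add_le (htL.1.sub hcφ.aestronglyMeasurable)).trans ?_
    refine add_le_add le_rfl (mul_le_mul' le_rfl ?_)
    refine (h.surfSq_le_of_contDiff' hd (hφ1 n)).trans (mul_le_mul' le_rfl ?_)
    calc _ ≤ (2 * volSq K v + 2 * volSq K (fun x => v x - φ n x)) + ENNReal.ofReal (r ^ 2) *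
          ∑ i, (2 * volSq K (weakDeriv K i v) + 2 * volSq K
            fun x => weakDeriv K i v x - fderiv ℝ (φ n) x (EuclideanSpace.single i 1)) := by
          refine add_le_add (sqNorm_le_add hv'.memLp.1) ?_
          gcongr with i
          exact sqNorm_le_add (hv'.memLp_grad i).1
      _ = _ := by
          rw [Finset.sum_add_distrib, ← Finset.mul_sum, ← Finset.mul_sum, he, gradSq]
          ring
  -- Both error terms vanish in the limit. Two uses of `|a + b|² ≤ 2|a|² + 2|b|²` leave `4 A`,
  -- whence the 8 in `traceConst`.
  have hlim : Tendsto (fun n => 2 * surfSq (frontier K) (fun x => t x - φ n x) +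
      2 * (A * (2 * (volSq K v + ENNReal.ofReal (r ^ 2) * gradSq K v) + 2 * e n))) atTop
      (𝓝 (2 * 0 + 2 * (A * (2 * (volSq K v + ENNReal.ofReal (r ^ 2) * gradSq K v) + 2 * 0)))) := by
    refine (ENNReal.Tendsto.const_mul h3 (Or.inr (by simp))).add
      (ENNReal.Tendsto.const_mul (ENNReal.Tendsto.const_mul (tendsto_const_nhds.add
        (ENNReal.Tendsto.const_mul he0 (Or.inr (by simp)))) (Or.inr hAt)) (Or.inr (by simp)))
  refine (ge_of_tendsto' hlim hb).trans (le_of_eq ?_)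
  rw [traceConst, hA]
  ring

/-- The trace inequality for the chosen trace; it holds trivially if there is no trace. -/
theorem surfSq_trace_le (h : IsStarBall K c r ρ) (hd : 1 ≤ d) (v : E d → ℂ) :
    surfSq (frontier K) (trace K v) ≤ traceConst d ρ * ENNReal.ofReal r⁻¹ *
      (volSq K v + ENNReal.ofReal (r ^ 2) * gradSq K v) := by
  by_cases ht : ∃ t, IsTrace K v t
  · rw [trace, dif_pos ht]
    exact h.surfSq_isTrace_le hd ht.choose_spec
  · rw [trace, dif_neg ht]
    simp [surfSq, sqNorm]

theorem memLp_frontier (h : IsStarBall K c r ρ) (hd : 1 ≤ d) {f : E d → ℂ} (hf : Continuous f) :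
    MemLp f 2 ((surf d).restrict (frontier K)) := by
  have := h.isFiniteMeasure_surf hd
  obtain ⟨C, hC⟩ := h.isCompact_frontier.exists_bound_of_continuousOn hf.continuousOn
  refine MemLp.of_bound hf.aestronglyMeasurable C ?_
  filter_upwards [self_mem_ae_restrict isClosed_frontier.measurableSet] with x hx
  exact hC x hx

/-- Every function in `H¹(K)` has a trace. -/
theorem exists_isTrace (h : IsStarBall K c r ρ) (hd : 1 ≤ d) {v : E d → ℂ} (hv : MemH1 K v) :
    ∃ t, IsTrace K v t := by
  have hv' := hv.isH1
  obtain ⟨φ, hφ, h1, h2⟩ := h.exists_smooth_tendsto hv'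
  have hφ1 : ∀ n, ContDiff ℝ 1 (φ n) := fun n => (hφ n).of_le (by simp)
  set μ := (surf d).restrict (frontier K) with hμ
  have hmem : ∀ n, MemLp (φ n) 2 μ := fun n => h.memLp_frontier hd (hφ n).continuous
  set A := surfConst d ρ * ENNReal.ofReal r⁻¹ * (2 * ENNReal.ofReal (1 + ρ ^ 2)) with hA
  have hAt : A ≠ ⊤ := ENNReal.mul_ne_top (ENNReal.mul_ne_top (surfConst_ne_top ρ) ENNReal.ofReal_ne_top)
    (ENNReal.mul_ne_top (by simp) ENNReal.ofReal_ne_top)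
  set e : ℕ → ℝ≥0∞ := fun n => volSq K (fun x => v x - φ n x) + ENNReal.ofReal (r ^ 2) *
    ∑ i, volSq K fun x => weakDeriv K i v x - fderiv ℝ (φ n) x (EuclideanSpace.single i 1) with he
  have he0 : Tendsto e atTop (𝓝 0) := by
    have hs : Tendsto (fun n => ∑ i, volSq K fun x =>
        weakDeriv K i v x - fderiv ℝ (φ n) x (EuclideanSpace.single i 1)) atTop (𝓝 0) := by
      have := tendsto_finsetSum Finset.univ fun i _ => h2 i
      simpa using this
    have := h1.add (ENNReal.Tendsto.const_mul (a := ENNReal.ofReal (r ^ 2)) hs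
      (Or.inr ENNReal.ofReal_ne_top))
    simpa using this
  -- The trace inequality for differences makes the restrictions to `∂K` a Cauchy sequence, and
  -- completeness of `L²(∂K)` supplies the trace.
  have hdiff : ∀ n m, sqNorm μ (fun x => φ n x - φ m x) ≤ A * (2 * e n + 2 * e m) := by
    intro n m
    refine (h.surfSq_le_of_contDiff' hd (φ := fun x => φ n x - φ m x)
      ((hφ1 n).sub (hφ1 m))).trans (mul_le_mul' le_rfl ?_)
    have hfd : ∀ i x, fderiv ℝ (fun x => φ n x - φ m x) x (EuclideanSpace.single i 1)
        = fderiv ℝ (φ n) x (EuclideanSpace.single i 1)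
          - fderiv ℝ (φ m) x (EuclideanSpace.single i 1) := by
      intro i x
      rw [fderiv_fun_sub ((hφ1 n).differentiable one_ne_zero x)
        ((hφ1 m).differentiable one_ne_zero x)]
      rfl
    have htri : ∀ (a b w : E d → ℂ), Continuous b → AEStronglyMeasurable w (volume.restrict K) →
        volSq K (fun x => a x - b x) ≤ 2 * volSq K (fun x => w x - a x) +
          2 * volSq K (fun x => w x - b x) := by
      intro a b w hb hw
      have e1 : volSq K (fun x => a x - b x) = volSq K (fun x => (w x - b x) - (w x - a x)) := by
        congr with x; ring
      rw [e1, add_comm]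
      exact sqNorm_sub_le (hw.sub hb.aestronglyMeasurable)
    simp_rw [hfd]
    calc _ ≤ (2 * volSq K (fun x => v x - φ n x) + 2 * volSq K (fun x => v x - φ m x)) +
          ENNReal.ofReal (r ^ 2) * ∑ i, (2 * volSq K (fun x => weakDeriv K i v x -
            fderiv ℝ (φ n) x (EuclideanSpace.single i 1)) + 2 * volSq K (fun x => weakDeriv K i v x -
            fderiv ℝ (φ m) x (EuclideanSpace.single i 1))) := by
          refine add_le_add (htri _ _ _ (hφ1 m).continuous hv'.memLp.1) ?_
          gcongr with i
          exact htri _ _ _ (continuous_fderiv_apply (hφ1 m) _) (hv'.memLp_grad i).1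
      _ = _ := by
          rw [Finset.sum_add_distrib, ← Finset.mul_sum, ← Finset.mul_sum, he]
          ring
  have hcau : CauchySeq fun n => (hmem n).toLp (φ n) := by
    rw [EMetric.cauchySeq_iff]
    intro ε hε
    have hlim : Tendsto (fun n => A * (4 * e n)) atTop (𝓝 0) := by
      have := ENNReal.Tendsto.const_mul (ENNReal.Tendsto.const_mul he0
        (Or.inr (by simp : (4 : ℝ≥0∞) ≠ ⊤))) (Or.inr hAt)
      simpa using this
    have hε2 : 0 < ε ^ 2 := by positivity
    obtain ⟨N, hN⟩ := eventually_atTop.1 (hlim.eventually (gt_mem_nhds hε2))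
    refine ⟨N, fun m hm n hn => ?_⟩
    rw [Lp.edist_toLp_toLp]
    have h5 : eLpNorm (φ m - φ n) 2 μ ^ 2 < ε ^ 2 := by
      rw [← sqNorm_eq_eLpNorm]
      refine (hdiff m n).trans_lt ?_
      rcases le_total (e m) (e n) with h6 | h6
      · refine lt_of_le_of_lt ?_ (hN n hn)
        gcongr
        calc _ ≤ 2 * e n + 2 * e n := by gcongr
          _ = _ := by ring
      · refine lt_of_le_of_lt ?_ (hN m hm)
        gcongr
        calc _ ≤ 2 * e m + 2 * e m := by gcongr
          _ = _ := by ring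
    exact lt_of_pow_lt_pow_left' 2 h5
  obtain ⟨T, hT⟩ := cauchySeq_tendsto_of_complete hcau
  refine ⟨T, hv, Lp.memLp T, φ, hφ, h1, h2, ?_⟩
  have h7 := (tendsto_iff_edist_tendsto_0.1 hT)
  have h8 : Tendsto (fun n => edist ((hmem n).toLp (φ n)) T ^ 2) atTop (𝓝 (0 ^ 2)) :=
    ENNReal.Tendsto.pow h7
  rw [zero_pow two_ne_zero] at h8
  refine h8.congr fun n => ?_
  rw [edist_comm, Lp.edist_def, ← sqNorm_eq_eLpNorm]
  refine sqNorm_congr ?_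
  filter_upwards [(hmem n).coeFn_toLp] with x hx
  simp [hx]

theorem isTrace_trace (h : IsStarBall K c r ρ) (hd : 1 ≤ d) {v : E d → ℂ} (hv : MemH1 K v) :
    IsTrace K v (trace K v) := by
  have ht := h.exists_isTrace hd hv
  rw [trace, dif_pos ht]
  exact ht.choose_spec

end IsStarBall

/-! ### The Poincaré inequality in `H¹(K)`. -/

/-- The constant of the Poincaré inequality. -/
noncomputable def poinConst (d : ℕ) (ρ : ℝ) : ℝ := 8 * ((2 * ρ) ^ 2 * 2 ^ d * (1 + (ρ + 1) ^ d))

theorem IsTrace.sub_const {K : Set (E d)} (hK : IsOpen K) (hb : Bornology.IsBounded K)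
    {v t : E d → ℂ} (ht : IsTrace K v t) (m : ℂ) (hm : MemLp (fun _ : E d => m) 2 ((surf d).restrict (frontier K))) :
    IsTrace K (fun x => v x - m) (fun x => t x - m) := by
  obtain ⟨hv, htL, φ, hφ, h1, h2, h3⟩ := ht
  have hs := hv.isH1.sub_const hK hb m
  refine ⟨hs.memH1, htL.sub hm, fun n x => φ n x - m, fun n => (hφ n).sub contDiff_const, ?_,
    fun i => ?_, ?_⟩
  · simpa using h1
  · refine (h2 i).congr fun n => sqNorm_congr ?_
    filter_upwards [hs.weakDeriv_ae_eq hK i] with x hx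
    rw [hx, fderiv_sub_const]
  · simpa using h3

namespace IsStarBall

variable {K : Set (E d)} {c : E d} {r ρ : ℝ}

/-- Poincaré inequality: some constant approximates `v` in `L²(K)`. -/
theorem exists_const_volSq_sub_le (h : IsStarBall K c r ρ) {v : E d → ℂ} {g : Fin d → E d → ℂ}
    (hv : IsH1 K v g) :
    ∃ m : ℂ, volSq K (fun x => v x - m) ≤
      ENNReal.ofReal (poinConst d ρ * r ^ 2) * ∑ i, volSq K (g i) := by
  have hKm := h.isOpen.measurableSet
  have hr := h.pos
  have hρ := h.rho_nonneg
  wlog hm : Measurable v generalizing v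
  · obtain ⟨v', hv'm, hv'⟩ := hv.memLp.1.aemeasurable
    obtain ⟨m, hm⟩ := this (hv.congr hv' fun i => by rfl) hv'm
    refine ⟨m, le_trans (le_of_eq (sqNorm_congr ?_)) hm⟩
    exact hv'.mono fun x hx => by simp only [hx]
  obtain ⟨φ, hφ, h1, h2⟩ := h.exists_smooth_tendsto hv
  have hφ1 : ∀ n, ContDiff ℝ 1 (φ n) := fun n => (hφ n).of_le (by simp)
  set B := Metric.ball c r with hB
  have hBfin : volume B ≠ ⊤ := measure_ball_lt_top.ne
  have hB0 : volume B ≠ 0 := (Metric.measure_ball_pos _ _ hr).ne'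
  have hKfin := h.volume_lt_top.ne
  obtain ⟨D, hD⟩ : ∃ D : ℝ, D = (2 * ρ * r) ^ 2 * 2 ^ d * (1 + (ρ + 1) ^ d) := ⟨_, rfl⟩
  set e : ℕ → ℝ≥0∞ := fun n => volSq K fun x => v x - φ n x with he
  set f : ℕ → ℝ≥0∞ := fun n => ∑ i, volSq K fun x =>
    g i x - fderiv ℝ (φ n) x (EuclideanSpace.single i 1) with hf
  have hf0 : Tendsto f atTop (𝓝 0) := by
    have := tendsto_finsetSum Finset.univ fun i _ => h2 i
    simpa using this
  have hb : ∀ n, ∫⁻ y in B, ∫⁻ x in K, ‖v x - v y‖ₑ ^ 2 ≤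
      2 * (volume B * e n) + 4 * (ENNReal.ofReal D * volume B * (2 * (∑ i, volSq K (g i)) + 2 * f n))
        + 4 * (volume K * e n) := by
    intro n
    have hcφ := (hφ1 n).continuous.measurable
    have hmd : Measurable fun x => ‖v x - φ n x‖ₑ ^ 2 := (hm.sub hcφ).enorm.pow_const 2
    have hmp : Measurable fun p : E d × E d => ‖φ n p.2 - φ n p.1‖ₑ ^ 2 :=
      ((hcφ.comp measurable_snd).sub (hcφ.comp measurable_fst)).enorm.pow_const 2
    have hpt : ∀ x y, ‖v x - v y‖ₑ ^ 2 ≤ 2 * ‖v x - φ n x‖ₑ ^ 2 + (4 * ‖φ n x - φ n y‖ₑ ^ 2 +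
        4 * ‖v y - φ n y‖ₑ ^ 2) := by
      intro x y
      have e1 : v x - v y = (v x - φ n x) + ((φ n x - φ n y) - (v y - φ n y)) := by ring
      rw [e1]
      refine (enorm_add_sq_le _ _).trans ?_
      have := enorm_sub_sq_le (φ n x - φ n y) (v y - φ n y)
      calc _ ≤ 2 * ‖v x - φ n x‖ₑ ^ 2 + 2 * (2 * ‖φ n x - φ n y‖ₑ ^ 2 +
            2 * ‖v y - φ n y‖ₑ ^ 2) := by gcongr
        _ = _ := by ring
    calc _ ≤ ∫⁻ y in B, ∫⁻ x in K, (2 * ‖v x - φ n x‖ₑ ^ 2 + (4 * ‖φ n x - φ n y‖ₑ ^ 2 +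
        4 * ‖v y - φ n y‖ₑ ^ 2)) := lintegral_mono fun y => lintegral_mono fun x => hpt x y
      _ = ∫⁻ y in B, (2 * e n + (4 * (∫⁻ x in K, ‖φ n x - φ n y‖ₑ ^ 2) +
          4 * ‖v y - φ n y‖ₑ ^ 2 * volume K)) := by
        congr with y
        have hmy : Measurable fun x => ‖φ n x - φ n y‖ₑ ^ 2 :=
          (hcφ.sub_const _).enorm.pow_const 2
        rw [lintegral_add_left (hmd.const_mul 2), lintegral_const_mul _ hmd,
          lintegral_add_left (hmy.const_mul 4), lintegral_const_mul _ hmy, lintegral_const,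
          Measure.restrict_apply_univ]
        rfl
      _ = 2 * (volume B * e n) + (4 * (∫⁻ y in B, ∫⁻ x in K, ‖φ n x - φ n y‖ₑ ^ 2) +
          4 * (∫⁻ y in B, ‖v y - φ n y‖ₑ ^ 2) * volume K) := by
        have hmi : Measurable fun y => ∫⁻ x in K, ‖φ n x - φ n y‖ₑ ^ 2 := hmp.lintegral_prod_right'
        rw [lintegral_add_left measurable_const, lintegral_const, Measure.restrict_apply_univ,
          lintegral_add_left (hmi.const_mul 4), lintegral_const_mul _ hmi,
          lintegral_mul_const _ (hmd.const_mul 4), lintegral_const_mul _ hmd]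
        ring
      _ ≤ 2 * (volume B * e n) + (4 * (ENNReal.ofReal D * volume B *
            (2 * (∑ i, volSq K (g i)) + 2 * f n)) + 4 * e n * volume K) := by
        gcongr
        · refine (h.lintegral_lintegral_sub_le (hφ1 n)).trans ?_
          rw [← hD]
          rw [lintegral_gradEnergy (hφ1 n)]
          refine mul_le_mul' le_rfl ((Finset.sum_le_sum fun i _ =>
            sqNorm_le_add (hv.memLp_grad i).1).trans (le_of_eq ?_))
          rw [Finset.sum_add_distrib, ← Finset.mul_sum, ← Finset.mul_sum]
          rfl
        · exact volSq_mono h.ball_subset _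
      _ = _ := by ring
  have hlim : Tendsto (fun n => 2 * (volume B * e n) + 4 * (ENNReal.ofReal D * volume B *
        (2 * (∑ i, volSq K (g i)) + 2 * f n)) + 4 * (volume K * e n)) atTop
      (𝓝 (2 * (volume B * 0) + 4 * (ENNReal.ofReal D * volume B *
        (2 * (∑ i, volSq K (g i)) + 2 * 0)) + 4 * (volume K * 0))) := by
    have h4 : (4 : ℝ≥0∞) ≠ ⊤ := by simp
    have h2' : (2 : ℝ≥0∞) ≠ ⊤ := by simp
    refine ((ENNReal.Tendsto.const_mul (ENNReal.Tendsto.const_mul h1 (Or.inr hBfin)) (Or.inr h2')).add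
      (ENNReal.Tendsto.const_mul (ENNReal.Tendsto.const_mul (tendsto_const_nhds.add
        (ENNReal.Tendsto.const_mul hf0 (Or.inr h2')))
        (Or.inr (ENNReal.mul_ne_top ENNReal.ofReal_ne_top hBfin))) (Or.inr h4))).add
      (ENNReal.Tendsto.const_mul (ENNReal.Tendsto.const_mul h1 (Or.inr hKfin)) (Or.inr h4))
  have hmain := ge_of_tendsto' hlim hb
  have hmF : Measurable fun y => ∫⁻ x in K, ‖v x - v y‖ₑ ^ 2 := by
    have : Measurable fun p : E d × E d => ‖v p.2 - v p.1‖ₑ ^ 2 :=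
      ((hm.comp measurable_snd).sub (hm.comp measurable_fst)).enorm.pow_const 2
    exact this.lintegral_prod_right'
  -- The constant is not the mean of `v` but a value `v y` at a point of the inscribed ball where
  -- the inner integral does not exceed its average over the ball.
  obtain ⟨y, -, hy⟩ := exists_le_setLAverage hB0 hBfin hmF.aemeasurable
  refine ⟨v y, hy.trans ?_⟩
  rw [setLAverage_eq]
  refine ENNReal.div_le_of_le_mul (hmain.trans (le_of_eq ?_))
  have : poinConst d ρ * r ^ 2 = 8 * D := by rw [poinConst, hD]; ring
  rw [this, ENNReal.ofReal_mul (p := 8) (by norm_num)]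
  simp only [mul_zero, add_zero, zero_add, ENNReal.ofReal_ofNat]
  ring

end IsStarBall

/-! ### Size of the boundary and Friedrichs' inequality. -/

/-- The projection that forgets the first coordinate. -/
def dropZero (m : ℕ) (x : E (m + 1)) : E m := WithLp.toLp 2 fun j => x j.succ

theorem lipschitzWith_dropZero (m : ℕ) : LipschitzWith 1 (dropZero m) := by
  refine LipschitzWith.of_dist_le_mul fun x y => ?_
  rw [NNReal.coe_one, one_mul, EuclideanSpace.dist_eq, EuclideanSpace.dist_eq, Fin.sum_univ_succ]
  exact Real.sqrt_le_sqrt (le_add_of_nonneg_left (sq_nonneg _))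

/-- Each line in the first coordinate direction that starts in the ball leaves the bounded set `K`
and so meets its frontier. The projection of the frontier thus covers a ball of one dimension less,
and a 1-Lipschitz map does not increase Hausdorff measure. -/
theorem surf_ge_of_ball_subset {m : ℕ} {K : Set (E (m + 1))} {c : E (m + 1)} {r : ℝ}
    (hb : Bornology.IsBounded K) (hcK : Metric.ball c r ⊆ K) :
    volume (Metric.ball (dropZero m c) r) ≤ surf (m + 1) (frontier K) := by
  have hsub : Metric.ball (dropZero m c) r ⊆ dropZero m '' frontier K := by
    intro y hy
    set x₀ : E (m + 1) := WithLp.toLp 2 (Fin.cons (c 0) fun j => y j) with hx₀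
    have hx₀K : x₀ ∈ K := by
      refine hcK ?_
      rw [Metric.mem_ball, EuclideanSpace.dist_eq] at hy ⊢
      rw [Fin.sum_univ_succ]
      simpa [hx₀, dropZero] using hy
    have hcont : Continuous fun t : ℝ => x₀ + t • EuclideanSpace.single (0 : Fin (m + 1)) (1 : ℝ) := by
      fun_prop
    set f : ℝ → E (m + 1) := fun t => x₀ + t • EuclideanSpace.single (0 : Fin (m + 1)) (1 : ℝ)
      with hf
    obtain ⟨R, hR⟩ := hb.subset_closedBall x₀
    have hne : (frontier (f ⁻¹' K)).Nonempty := by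
      rw [nonempty_frontier_iff]
      refine ⟨⟨0, by simpa [hf] using hx₀K⟩, fun h => ?_⟩
      have : f (|R| + 1) ∈ K := by
        change |R| + 1 ∈ f ⁻¹' K
        rw [h]; trivial
      have h2 := hR this
      rw [mem_closedBall_iff_norm] at h2
      have h3 : ‖f (|R| + 1) - x₀‖ = |R| + 1 := by
        simp only [hf, add_sub_cancel_left, norm_smul, Real.norm_eq_abs,
          PiLp.norm_single, norm_one, mul_one]
        exact abs_of_nonneg (by positivity)
      have := le_abs_self R
      linarith
    obtain ⟨t, ht⟩ := hne
    refine ⟨f t, hcont.frontier_preimage_subset K ht, ?_⟩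
    ext j
    simp [dropZero, hf, hx₀]
  calc volume (Metric.ball (dropZero m c) r)
      ≤ volume (dropZero m '' frontier K) := measure_mono hsub
    _ = surfFactor (m + 1) * μH[(m : ℝ)] (dropZero m '' frontier K) := by
      rw [← EuclideanSpace.euclideanHausdorffMeasure_eq_volume m,
        Measure.euclideanHausdorffMeasure_def]
      rfl
    _ ≤ surfFactor (m + 1) * μH[(m : ℝ)] (frontier K) := by
      gcongr
      simpa using (lipschitzWith_dropZero m).hausdorffMeasure_image_le (by positivity) (frontier K)
    _ = _ := by rw [surf_apply]; rfl

namespace IsStarBall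

variable {K : Set (E d)} {c : E d} {r ρ : ℝ}

/-- The boundary of `K` has at least the measure of a ball of dimension `d - 1`. -/
theorem surf_frontier_ge (h : IsStarBall K c r ρ) (hd : 1 ≤ d) :
    ENNReal.ofReal (r ^ (d - 1)) * volume (Metric.ball (0 : E (d - 1)) 1) ≤
      surf d (frontier K) := by
  obtain ⟨m, rfl⟩ : ∃ m, d = m + 1 := ⟨d - 1, by omega⟩
  refine le_trans (le_of_eq ?_) (surf_ge_of_ball_subset h.bounded h.ball_subset)
  rw [Measure.addHaar_ball_of_pos _ _ h.pos]
  simp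

/-- Split `v = (v - m) + m` with the Poincaré constant `m`. The quantity `|m|² surf(∂K)` is bounded
by the traces of `v` and of `v - m`, the latter through the trace inequality. The volume bound `vol
K ≤ Q r surf(∂K)` carries this back to `‖m‖_K²`. -/
theorem exists_friedrichs_const (d : ℕ) (hd : 1 ≤ d) (ρ : ℝ) : ∃ C : ℝ≥0, ∀ (K : Set (E d)) (c : E d) (r : ℝ),
    IsStarBall K c r ρ → ∀ v, MemH1 K v → volSq K v ≤
      C * (ENNReal.ofReal (r ^ 2) * gradSq K v
        + ENNReal.ofReal r * surfSq (frontier K) (trace K v)) := by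
  set β := volume (Metric.ball (0 : E (d - 1)) 1) with hβ
  have hβ0 : β ≠ 0 := volume_unitBall_pos.ne'
  have hβt : β ≠ ⊤ := measure_ball_lt_top.ne
  set V := volume (Metric.ball (0 : E d) 1) with hV
  have hVt : V ≠ ⊤ := measure_ball_lt_top.ne
  set P := ENNReal.ofReal (poinConst d ρ) with hP
  set τ := traceConst d ρ with hτ
  set Q := ENNReal.ofReal ((ρ + 1) ^ d) * V * β⁻¹ with hQ
  have hQt : Q ≠ ⊤ := ENNReal.mul_ne_top (ENNReal.mul_ne_top ENNReal.ofReal_ne_top hVt)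
    (ENNReal.inv_ne_top.2 hβ0)
  have hτt : τ ≠ ⊤ := traceConst_ne_top ρ
  have hPt : P ≠ ⊤ := ENNReal.ofReal_ne_top
  set C : ℝ≥0∞ := 2 * P + 2 * Q * (2 * (τ * (P + 1))) + 4 * Q with hC
  have hCt : C ≠ ⊤ := by
    simp only [hC, ne_eq, ENNReal.add_eq_top, ENNReal.mul_eq_top, not_or]
    simp [hQt, hτt, hPt]
  refine ⟨C.toNNReal, fun K c r h v hv => ?_⟩
  rw [ENNReal.coe_toNNReal hCt]
  have hr := h.pos
  set G := gradSq K v with hG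
  set S := surfSq (frontier K) (trace K v) with hS
  have hT := h.isTrace_trace hd hv
  have hfin := h.isFiniteMeasure_surf hd
  obtain ⟨m, hm⟩ := h.exists_const_volSq_sub_le hv.isH1
  have hm' : volSq K (fun x => v x - m) ≤ P * (ENNReal.ofReal (r ^ 2) * G) := by
    rw [ENNReal.ofReal_mul' (by positivity), mul_assoc] at hm
    exact hm
  have hTm := hT.sub_const h.isOpen h.bounded m (memLp_const m)
  have hgr : gradSq K (fun x => v x - m) = G :=
    (hv.isH1.sub_const h.isOpen h.bounded m).gradSq_eq h.isOpen
  have htr := h.surfSq_isTrace_le hd hTm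
  rw [hgr] at htr
  have hrr : ENNReal.ofReal r⁻¹ * ENNReal.ofReal (r ^ 2) = ENNReal.ofReal r := by
    rw [← ENNReal.ofReal_mul (by positivity)]
    congr 1
    field_simp
  have htr' : surfSq (frontier K) (fun x => trace K v x - m)
      ≤ τ * (P + 1) * (ENNReal.ofReal r * G) := by
    calc _ ≤ τ * ENNReal.ofReal r⁻¹ * (P * (ENNReal.ofReal (r ^ 2) * G)
          + ENNReal.ofReal (r ^ 2) * G) := htr.trans (by gcongr)
      _ = τ * (P + 1) * ((ENNReal.ofReal r⁻¹ * ENNReal.ofReal (r ^ 2)) * G) := by ring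
      _ = _ := by rw [hrr]
  have hconst : ‖m‖ₑ ^ 2 * surf d (frontier K) ≤
      2 * S + 2 * (τ * (P + 1) * (ENNReal.ofReal r * G)) := by
    have e : sqNorm ((surf d).restrict (frontier K)) (fun _ => m)
        = ‖m‖ₑ ^ 2 * surf d (frontier K) := by
      rw [sqNorm, lintegral_const, Measure.restrict_apply_univ]
    rw [← e]
    refine (sqNorm_le_add hT.2.1.1).trans ?_
    exact add_le_add le_rfl (mul_le_mul' le_rfl htr')
  have hvolK : volume K ≤ Q * (ENNReal.ofReal r * surf d (frontier K)) := by
    refine h.volume_le.trans ?_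
    rw [Measure.addHaar_ball_of_pos _ _ hr]
    have e1 : ENNReal.ofReal (r ^ Module.finrank ℝ (E d))
        = ENNReal.ofReal r * ENNReal.ofReal (r ^ (d - 1)) := by
      rw [← ENNReal.ofReal_mul hr.le, finrank_euclideanSpace_fin, ← pow_succ']
      congr 2
      omega
    rw [e1]
    calc _ = ENNReal.ofReal ((ρ + 1) ^ d) * V * (β⁻¹ * β) *
          (ENNReal.ofReal r * ENNReal.ofReal (r ^ (d - 1))) := by
          rw [ENNReal.inv_mul_cancel hβ0 hβt]; ring
      _ = Q * (ENNReal.ofReal r * (ENNReal.ofReal (r ^ (d - 1)) * β)) := by rw [hQ]; ring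
      _ ≤ _ := by
        gcongr
        exact h.surf_frontier_ge hd
  have hvm : volSq K (fun _ => m) ≤ Q * (ENNReal.ofReal r * (2 * S
      + 2 * (τ * (P + 1) * (ENNReal.ofReal r * G)))) := by
    calc volSq K (fun _ => m) = ‖m‖ₑ ^ 2 * volume K := by
          rw [volSq, sqNorm, lintegral_const, Measure.restrict_apply_univ]
      _ ≤ ‖m‖ₑ ^ 2 * (Q * (ENNReal.ofReal r * surf d (frontier K))) := by gcongr
      _ = Q * (ENNReal.ofReal r * (‖m‖ₑ ^ 2 * surf d (frontier K))) := by ring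
      _ ≤ _ := by gcongr
  have hsplit : volSq K v ≤ 2 * volSq K (fun x => v x - m) + 2 * volSq K (fun _ => m) := by
    have := sqNorm_add_le (v := fun x => v x - m) (w := fun _ => m)
      (hv.1.1.sub (aestronglyMeasurable_const (b := m)))
    simp only [sub_add_cancel] at this
    exact this
  calc volSq K v ≤ 2 * (P * (ENNReal.ofReal (r ^ 2) * G)) + 2 * (Q * (ENNReal.ofReal r * (2 * S
      + 2 * (τ * (P + 1) * (ENNReal.ofReal r * G))))) := by
        refine hsplit.trans ?_
        gcongr
    _ = (2 * P + 2 * Q * (2 * (τ * (P + 1)))) * (ENNReal.ofReal (r ^ 2) * G)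
        + 4 * Q * (ENNReal.ofReal r * S) := by
        rw [pow_two, ENNReal.ofReal_mul hr.le]; ring
    _ ≤ C * (ENNReal.ofReal (r ^ 2) * G) + C * (ENNReal.ofReal r * S) := by
        gcongr
        · rw [hC]; exact le_self_add
        · rw [hC]; exact le_add_self
    _ = _ := by ring

theorem two_mul_le_diam (h : IsStarBall K c r ρ) (hd : 1 ≤ d) : 2 * r ≤ Metric.diam K := by
  have : NeZero d := ⟨by omega⟩
  rw [← Metric.diam_ball_eq c h.pos.le]
  exact Metric.diam_mono h.ball_subset h.bounded

theorem diam_le (h : IsStarBall K c r ρ) : Metric.diam K ≤ 2 * ρ * r := by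
  have := h.rho_nonneg
  have hr := h.pos
  refine (Metric.diam_mono h.subset_closedBall Metric.isBounded_closedBall).trans ?_
  refine (Metric.diam_closedBall (by positivity)).trans (by linarith)

end IsStarBall

/-- The outer ball need not be concentric with the inscribed one; recentring doubles the ratio. -/
theorem Mesh.A1.isStarBall {Ω : Set (E d)} {T : Mesh Ω} {σ : ShapeParams} (h : T.A1 σ)
    {K : Set (E d)} (hK : K ∈ T.elems) : IsStarBall K (T.ctr K) (T.rad K) (2 * σ.gam) := by
  obtain ⟨hr, hb, ⟨y, R, hR, hRr⟩, hs⟩ := h K hK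
  refine ⟨(T.lipschitz K hK).1, hr, hb, fun x hx => ?_, hs⟩
  have h1 := hR hx
  have h2 := hR (hb (Metric.mem_ball_self hr))
  rw [Metric.mem_closedBall] at *
  have := dist_triangle_right x (T.ctr K) y
  linarith

/-! ### Polynomials: the Laplacian of a bubble. -/

open MvPolynomial

/-- The Laplacian of a polynomial. -/
noncomputable def polyLap (d : ℕ) : Poly d →ₗ[ℂ] Poly d :=
  ∑ i, (pderiv i).toLinearMap ∘ₗ (pderiv i).toLinearMap

theorem polyLap_apply (q : Poly d) : polyLap d q = ∑ i, pderiv i (pderiv i q) := by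
  simp [polyLap]

/-- The polynomial `|x|²`. -/
noncomputable def normSqPoly (d : ℕ) : Poly d := ∑ i, X i ^ 2

theorem pderiv_normSqPoly (i : Fin d) : pderiv i (normSqPoly d) = 2 * X i := by
  rw [normSqPoly, map_sum, Finset.sum_eq_single i]
  · simp [Derivation.leibniz_pow]
  · intro j _ hj
    simp [Derivation.leibniz_pow, pderiv_X_of_ne hj]
  · simp

theorem isHomogeneous_polyLap {f : Poly d} {m : ℕ} (hf : f.IsHomogeneous m) :
    (polyLap d f).IsHomogeneous (m - 1 - 1) := by
  rw [polyLap_apply]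
  exact IsHomogeneous.sum _ _ _ fun i _ => hf.pderiv.pderiv

theorem isHomogeneous_normSqPoly : (normSqPoly d).IsHomogeneous 2 :=
  IsHomogeneous.sum _ _ _ fun i _ => by simpa using (isHomogeneous_X ℂ i).pow 2

/-- The commutator of the Laplacian and the multiplication by `|x|²`. -/
theorem polyLap_normSqPoly_mul {f : Poly d} {m : ℕ} (hf : f.IsHomogeneous m) :
    polyLap d (normSqPoly d * f) = normSqPoly d * polyLap d f + ((4 * m + 2 * d : ℕ) : ℂ) • f := by
  have h1 : ∀ i, pderiv i (pderiv i (normSqPoly d * f)) =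
      2 * f + 4 * (X i * pderiv i f) + normSqPoly d * pderiv i (pderiv i f) := by
    intro i
    have h2 : pderiv i (2 : Poly d) = 0 := by
      rw [← map_ofNat (C : ℂ →+* Poly d) 2, pderiv_C]
    simp only [pderiv_mul, map_add, pderiv_normSqPoly, pderiv_X_self, h2]
    ring
  rw [polyLap_apply, Finset.sum_congr rfl fun i _ => h1 i, Finset.sum_add_distrib,
    Finset.sum_add_distrib, ← Finset.mul_sum, ← Finset.mul_sum, ← Finset.mul_sum, hf.sum_X_mul_pderiv, polyLap_apply]
  rw [Nat.cast_smul_eq_nsmul, Finset.sum_const, Finset.card_univ, Fintype.card_fin]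
  simp only [nsmul_eq_mul]
  push_cast
  ring

/-- The commutator formula gives `|x|² Δf = -(n + 4m + 2d) f`. Applying `Δ`, the polynomial `Δf`, of
lower degree, satisfies an equation of the same form with a larger `n`, so it vanishes by induction.
Then `f = 0` because the coefficient is nonzero. Allowing every `n ≥ 0` is what closes the
induction. -/
theorem eq_zero_of_polyLap_normSqPoly_mul (hd : 1 ≤ d) (m : ℕ) : ∀ (f : Poly d) (n : ℕ), f.IsHomogeneous m →
    polyLap d (normSqPoly d * f) = -(n : ℂ) • f → f = 0 := by
  induction m using Nat.strong_induction_on with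
  | _ m ih =>
    intro f n hf h
    have h1 := polyLap_normSqPoly_mul hf
    have hk : ((n + (4 * m + 2 * d) : ℕ) : ℂ) ≠ 0 := by
      exact_mod_cast (by omega : n + (4 * m + 2 * d) ≠ 0)
    have h2 : normSqPoly d * polyLap d f = -((n + (4 * m + 2 * d) : ℕ) : ℂ) • f := by
      rw [Nat.cast_add, neg_add, add_smul, ← h, h1]
      module
    have h3 : polyLap d f = 0 := by
      rcases Nat.lt_or_ge m 2 with hm | hm
      · have : ∀ i, pderiv i f = C (coeff 0 (pderiv i f)) := fun i => by
          have := (hf.pderiv (i := i))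
          rw [show m - 1 = 0 by omega, ← totalDegree_zero_iff_isHomogeneous,
            totalDegree_eq_zero_iff_eq_C] at this
          exact this
        rw [polyLap_apply]
        refine Finset.sum_eq_zero fun i _ => ?_
        rw [this, pderiv_C]
      · refine ih (m - 1 - 1) (by omega) _ (n + (4 * m + 2 * d)) (isHomogeneous_polyLap hf) ?_
        rw [h2, map_smul]
    rw [h3, mul_zero] at h2
    exact (smul_eq_zero.1 h2.symm).resolve_left (neg_ne_zero.2 hk)

/-- A polynomial harmonic in the unit ball that vanishes on the sphere is zero. -/
theorem eq_zero_of_polyLap_bubble_eq_zero (hd : 1 ≤ d) {q : Poly d}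
    (h : polyLap d ((normSqPoly d - 1) * q) = 0) : q = 0 := by
  by_contra hq
  set m := q.totalDegree with hm
  have htop : homogeneousComponent m q ≠ 0 := by
    intro h0
    obtain ⟨s, hs, hsm⟩ := q.support.exists_mem_eq_sup (support_nonempty.2 hq)
      (fun s => s.sum fun _ e => e)
    have h1 : coeff s (homogeneousComponent m q) = coeff s q := by
      rw [coeff_homogeneousComponent, if_pos]
      rw [hm, totalDegree, hsm]
      rfl
    rw [h0, coeff_zero] at h1
    exact mem_support_iff.1 hs h1.symm
  refine htop (eq_zero_of_polyLap_normSqPoly_mul hd m _ 0 (homogeneousComponent_isHomogeneous m q) ?_)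
  -- In degree `m` of this identity the right side contributes nothing, as `Δ` lowers the degree,
  -- and the left side contributes only through the top component of `q`. That component then
  -- satisfies the homogeneous equation with `n = 0`.
  have h1 : polyLap d (normSqPoly d * q) = polyLap d q := by
    rw [sub_mul, one_mul, map_sub, sub_eq_zero] at h
    exact h
  have h2 := congrArg (homogeneousComponent m) h1
  have hlow : ∀ i ∈ Finset.range (m + 1), homogeneousComponent m
      (polyLap d (homogeneousComponent i q)) = 0 := by
    intro i hi
    rw [Finset.mem_range] at hi
    rcases Nat.eq_zero_or_pos i with rfl | hi0
    · rw [homogeneousComponent_zero, polyLap_apply]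
      simp
    · rw [homogeneousComponent_of_mem (isHomogeneous_polyLap
        (homogeneousComponent_isHomogeneous i q)), if_neg (by omega)]
  have hup : ∀ i ∈ Finset.range (m + 1), homogeneousComponent m
      (polyLap d (normSqPoly d * homogeneousComponent i q)) =
        if i = m then polyLap d (normSqPoly d * homogeneousComponent m q) else 0 := by
    intro i hi
    rw [homogeneousComponent_of_mem (isHomogeneous_polyLap (isHomogeneous_normSqPoly.mul
        (homogeneousComponent_isHomogeneous i q)))]
    rcases eq_or_ne i m with rfl | hne
    · rw [if_pos (by omega), if_pos rfl]
    · rw [if_neg (by omega), if_neg hne]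
  nth_rewrite 1 [← sum_homogeneousComponent q] at h2
  nth_rewrite 3 [← sum_homogeneousComponent q] at h2
  rw [Finset.mul_sum, map_sum, map_sum, map_sum, map_sum, Finset.sum_congr rfl hup,
    Finset.sum_congr rfl hlow, Finset.sum_ite_eq', if_pos (by simp)] at h2
  simpa using h2

theorem totalDegree_pderiv_le (q : Poly d) (i : Fin d) :
    (pderiv i q).totalDegree ≤ q.totalDegree - 1 := by
  refine Finset.sup_le fun s hs => ?_
  have h1 : s + Finsupp.single i 1 ∈ q.support := by
    rw [mem_support_iff, coeff_pderiv] at hs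
    exact mem_support_iff.2 (left_ne_zero_of_mul hs)
  have h2 := le_totalDegree h1
  rw [Finsupp.sum_add_index' (fun _ => rfl) (fun _ _ _ => rfl), Finsupp.sum_single_index rfl] at h2
  exact Nat.le_sub_of_add_le h2

theorem totalDegree_polyLap_le (q : Poly d) : (polyLap d q).totalDegree ≤ q.totalDegree - 2 := by
  rw [polyLap_apply]
  refine totalDegree_finsetSum_le fun i _ => ?_
  have h1 := totalDegree_pderiv_le q i
  have h2 := totalDegree_pderiv_le (pderiv i q) i
  omega

theorem contDiff_polyFun (q : Poly d) {n : WithTop ℕ∞} : ContDiff ℝ n (polyFun q) := by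
  induction q using MvPolynomial.induction_on with
  | C a =>
    have : polyFun (C a : Poly d) = fun _ => a := by ext x; simp [polyFun]
    rw [this]; exact contDiff_const
  | add p q hp hq =>
    have : polyFun (p + q) = fun x => polyFun p x + polyFun q x := by ext x; simp [polyFun]
    rw [this]; exact hp.add hq
  | mul_X p i hp =>
    have : polyFun (p * X i) = fun x => polyFun p x * ((x i : ℝ) : ℂ) := by ext x; simp [polyFun]
    rw [this]
    exact hp.mul
      ((Complex.ofRealCLM.comp (EuclideanSpace.proj i : E d →L[ℝ] ℝ) : E d →L[ℝ] ℂ).contDiff)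

theorem fderiv_polyFun (q : Poly d) (i : Fin d) (x : E d) :
    fderiv ℝ (polyFun q) x (EuclideanSpace.single i 1) = polyFun (pderiv i q) x := by
  induction q using MvPolynomial.induction_on with
  | C a =>
    have : polyFun (C a : Poly d) = fun _ => a := by ext x; simp [polyFun]
    rw [this]; simp [polyFun]
  | add p q hp hq =>
    have : polyFun (p + q) = fun x => polyFun p x + polyFun q x := by ext x; simp [polyFun]
    rw [this, fderiv_fun_add ((contDiff_polyFun p).differentiable one_ne_zero x)
      ((contDiff_polyFun q).differentiable one_ne_zero x), _root_.add_apply, hp, hq]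
    simp [polyFun]
  | mul_X p j hp =>
    have : polyFun (p * X j) = fun x => polyFun p x * ((x j : ℝ) : ℂ) := by ext x; simp [polyFun]
    have hj : HasFDerivAt (fun x : E d => ((x j : ℝ) : ℂ))
        (Complex.ofRealCLM.comp (EuclideanSpace.proj j)) x :=
      (Complex.ofRealCLM.comp (EuclideanSpace.proj (𝕜 := ℝ) j)).hasFDerivAt
    rw [this]
    change fderiv ℝ (polyFun p * fun x : E d => ((x j : ℝ) : ℂ)) x _ = _
    rw [(((contDiff_polyFun p).differentiable one_ne_zero x).hasFDerivAt.mul hj).fderiv]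
    simp only [_root_.add_apply, _root_.smul_apply, hp,
      Derivation.leibniz, pderiv_X, smul_eq_mul, polyFun, map_add, map_mul, eval_X]
    rcases eq_or_ne j i with rfl | hij
    · simp
    · simp [hij]

theorem memLp_of_continuous {U : Set (E d)} (hU : MeasurableSet U) (hb : Bornology.IsBounded U)
    {f : E d → ℂ} (hf : Continuous f) : MemLp f 2 (volume.restrict U) := by
  have hfin : IsFiniteMeasure (volume.restrict U) :=
    ⟨by rw [Measure.restrict_apply_univ]; exact hb.measure_lt_top⟩
  obtain ⟨C, hC⟩ := hb.isCompact_closure.exists_bound_of_continuousOn hf.continuousOn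
  refine MemLp.of_bound hf.aestronglyMeasurable C ?_
  filter_upwards [self_mem_ae_restrict hU] with x hx
  exact hC x (subset_closure hx)

theorem polyFun_add (p q : Poly d) : polyFun (p + q) = fun x => polyFun p x + polyFun q x := by
  ext x; simp [polyFun]

theorem polyFun_mul (p q : Poly d) : polyFun (p * q) = fun x => polyFun p x * polyFun q x := by
  ext x; simp [polyFun]

theorem polyFun_smul (a : ℂ) (q : Poly d) : polyFun (a • q) = fun x => a * polyFun q x := by
  ext x; simp [polyFun]

/-- A polynomial as an element of `L²(U)`. -/
noncomputable def polyLp {U : Set (E d)} (hU : MeasurableSet U) (hb : Bornology.IsBounded U) :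
    Poly d →ₗ[ℂ] Lp ℂ 2 (volume.restrict U) where
  toFun q := (memLp_of_continuous hU hb (continuous_polyFun q)).toLp _
  map_add' p q := by
    rw [← MemLp.toLp_add]
    exact MemLp.toLp_congr _ _ (ae_of_all _ fun x => by rw [polyFun_add]; rfl)
  map_smul' a q := by
    rw [RingHom.id_apply, ← MemLp.toLp_const_smul]
    exact MemLp.toLp_congr _ _ (ae_of_all _ fun x => by rw [polyFun_smul]; rfl)

theorem enorm_polyLp {U : Set (E d)} (hU : MeasurableSet U) (hb : Bornology.IsBounded U)
    (q : Poly d) : ‖polyLp hU hb q‖ₑ ^ 2 = volSq U (polyFun q) := by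
  rw [volSq, sqNorm_eq_eLpNorm, polyLp]
  simp only [LinearMap.coe_mk, AddHom.coe_mk]
  rw [Lp.enorm_toLp]

/-- A polynomial function that vanishes on a nonempty open set is zero. -/
theorem eq_zero_of_polyFun_eqOn {U : Set (E d)} (hU : IsOpen U) (hne : U.Nonempty) {q : Poly d}
    (h : ∀ x ∈ U, polyFun q x = 0) : q = 0 := by
  obtain ⟨x, hx⟩ := hne
  have hc : Continuous (fun y : Fin d → ℝ => (WithLp.toLp 2 y : E d)) := PiLp.continuous_toLp 2 _
  have ho := hU.preimage hc
  obtain ⟨ε, hε, hb⟩ := Metric.isOpen_iff.1 ho x.ofLp hx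
  refine funext_set (fun i => (fun t : ℝ => (t : ℂ)) '' Metric.ball (x i) ε) (fun i => ?_) ?_
  · refine Set.Infinite.image Complex.ofReal_injective.injOn ?_
    rw [Real.ball_eq_Ioo]
    exact Set.Ioo_infinite (by linarith)
  · intro y hy
    choose t ht hty using fun i => hy i (mem_univ i)
    have h1 : t ∈ Metric.ball x.ofLp ε := by
      rw [Metric.mem_ball, dist_pi_lt_iff hε]
      exact fun i => ht i
    have := h _ (hb h1)
    rw [map_zero, ← this, polyFun]
    congr 1
    exact congrArg eval (_root_.funext fun i => (hty i).symm)

theorem polyLp_injective {U : Set (E d)} (hU : IsOpen U) (hb : Bornology.IsBounded U)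
    (hne : U.Nonempty) : Function.Injective (polyLp hU.measurableSet hb) := by
  refine (injective_iff_map_eq_zero _).2 fun q hq => ?_
  have h1 : polyFun q =ᵐ[volume.restrict U] fun _ => 0 := by
    have h2 := MemLp.coeFn_toLp (memLp_of_continuous hU.measurableSet hb (continuous_polyFun q))
    have h3 : (memLp_of_continuous hU.measurableSet hb (continuous_polyFun q)).toLp _ = 0 := hq
    rw [h3] at h2
    exact h2.symm.trans (Lp.coeFn_zero _ _ _)
  exact eq_zero_of_polyFun_eqOn hU hne
    (Measure.eqOn_open_of_ae_eq h1 hU (continuous_polyFun q).continuousOn continuousOn_const)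

/-! ### Equivalence of norms and scaling to the reference ball. -/

/-- On a finite-dimensional space every linear map is bounded by an injective one. -/
theorem exists_norm_le_of_injective {V A B : Type*} [AddCommGroup V] [Module ℂ V]
    [FiniteDimensional ℂ V] [NormedAddCommGroup A] [NormedSpace ℂ A] [NormedAddCommGroup B]
    [NormedSpace ℂ B] (f : V →ₗ[ℂ] A) (g : V →ₗ[ℂ] B) (hf : Function.Injective f) :
    ∃ C : ℝ≥0, ∀ v, ‖g v‖ₑ ≤ C * ‖f v‖ₑ := by
  let e := LinearEquiv.ofInjective f hf
  let G : LinearMap.range f →L[ℂ] B := LinearMap.toContinuousLinearMap (g ∘ₗ e.symm.toLinearMap)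
  refine ⟨‖G‖₊, fun v => ?_⟩
  have h1 := G.le_opENorm (e v)
  have h2 : G (e v) = g v := by simp [G]
  rw [h2] at h1
  exact h1

/-- `q ↦ ‖f q‖` over the unit ball is a norm on `V`, so it dominates the seminorm `q ↦ ‖g q‖`, even
over a larger ball. -/
theorem exists_volSq_le (V : Submodule ℂ (Poly d)) [FiniteDimensional ℂ V]
    (f g : Poly d →ₗ[ℂ] Poly d) (hf : ∀ q ∈ V, f q = 0 → q = 0) (ρ : ℝ) :
    ∃ M : ℝ≥0, ∀ q ∈ V, volSq (Metric.closedBall 0 ρ) (polyFun (g q)) ≤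
      M * volSq (Metric.ball 0 1) (polyFun (f q)) := by
  let F := (polyLp Metric.isOpen_ball.measurableSet (Metric.isBounded_ball (x := (0 : E d)) (r := 1)))
    ∘ₗ f ∘ₗ V.subtype
  let G := (polyLp Metric.isClosed_closedBall.measurableSet
    (Metric.isBounded_closedBall (x := (0 : E d)) (r := ρ))) ∘ₗ g ∘ₗ V.subtype
  have hF : Function.Injective F := by
    refine (polyLp_injective Metric.isOpen_ball Metric.isBounded_ball
      (Metric.nonempty_ball.2 one_pos)).comp ((injective_iff_map_eq_zero _).2 fun q hq => ?_)
    exact Subtype.ext (hf q q.2 hq)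
  obtain ⟨C, hC⟩ := exists_norm_le_of_injective F G hF
  refine ⟨C ^ 2, fun q hq => ?_⟩
  have h1 := pow_le_pow_left' (hC ⟨q, hq⟩) 2
  rw [mul_pow] at h1
  simp only [F, G, LinearMap.comp_apply, enorm_polyLp, Submodule.subtype_apply] at h1
  exact_mod_cast h1

/-- The substitution `x = c + r y` in a polynomial. -/
noncomputable def polySub (c : E d) (r : ℝ) : Poly d →ₐ[ℂ] Poly d :=
  aeval fun i => C ((c i : ℝ) : ℂ) + C (r : ℂ) * X i

theorem polyFun_polySub (c : E d) (r : ℝ) (q : Poly d) (y : E d) :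
    polyFun (polySub c r q) y = polyFun q (c + r • y) := by
  induction q using MvPolynomial.induction_on with
  | C a => simp [polyFun, polySub]
  | add p q hp hq => simp only [map_add, polyFun_add, hp, hq]
  | mul_X p i hp =>
    simp only [map_mul, polyFun_mul, hp]
    congr 1
    simp [polyFun, polySub]

theorem pderiv_polySub (c : E d) (r : ℝ) (q : Poly d) (i : Fin d) :
    pderiv i (polySub c r q) = (r : ℂ) • polySub c r (pderiv i q) := by
  induction q using MvPolynomial.induction_on with
  | C a => simp [polySub]
  | add p q hp hq => simp only [map_add, hp, hq, smul_add]
  | mul_X p j hp =>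
    have hX : pderiv i (polySub c r (X j)) = (r : ℂ) • polySub c r (pderiv i (X j)) := by
      rcases eq_or_ne j i with rfl | h
      · simp [polySub, smul_eq_C_mul]
      · simp [polySub, pderiv_X_of_ne h]
    rw [map_mul, pderiv_mul, hp, hX, pderiv_mul, map_add, map_mul, map_mul, smul_add,
      smul_mul_assoc, mul_smul_comm]

theorem polyLap_polySub (c : E d) (r : ℝ) (q : Poly d) :
    polyLap d (polySub c r q) = ((r : ℂ) ^ 2) • polySub c r (polyLap d q) := by
  simp only [polyLap_apply, pderiv_polySub, Derivation.map_smul, smul_smul, map_sum, Finset.smul_sum,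
    pow_two]

theorem polySub_mem_polySpace (c : E d) (r : ℝ) {p : ℕ} {q : Poly d} (hq : q ∈ polySpace d p) :
    polySub c r q ∈ polySpace d p := by
  rw [mem_restrictTotalDegree] at hq ⊢
  rw [q.as_sum, map_sum]
  refine totalDegree_finsetSum_le fun s hs => ?_
  rw [polySub, aeval_monomial]
  refine (totalDegree_mul _ _).trans ?_
  rw [algebraMap_eq, totalDegree_C, zero_add, Finsupp.prod]
  refine (totalDegree_finsetProd _ _).trans (le_trans (Finset.sum_le_sum fun i _ => ?_)
    ((le_totalDegree hs).trans hq))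
  refine (totalDegree_pow _ _).trans ?_
  have : totalDegree (C ((c i : ℝ) : ℂ) + C (r : ℂ) * X i : Poly d) ≤ 1 := by
    refine (totalDegree_add _ _).trans (max_le (by simp) ?_)
    refine (totalDegree_mul _ _).trans ?_
    simp
  calc s i * _ ≤ s i * 1 := Nat.mul_le_mul_left _ this
    _ = s i := mul_one _

theorem polySub_mem_testSpace (c : E d) (r : ℝ) {p : ℕ} {q : Poly d} (hq : q ∈ testSpace d p) :
    polySub c r q ∈ testSpace d p := by
  unfold testSpace at *
  split_ifs at * with h
  · exact polySub_mem_polySpace c r hq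
  · rw [Submodule.mem_bot] at *
    rw [hq, map_zero]

instance (p : ℕ) : FiniteDimensional ℂ (testSpace d p) := by
  by_cases h : 2 ≤ p
  · rw [testSpace, if_pos h]; infer_instance
  · rw [testSpace, if_neg h]; infer_instance

theorem volSq_comp_add_smul (c : E d) {r : ℝ} (hr : 0 < r) {U : Set (E d)} (hU : MeasurableSet U)
    (F : E d → ℂ) : volSq ((fun y => c + r • y) ⁻¹' U) (fun y => F (c + r • y)) =
      ENNReal.ofReal ((r ^ d)⁻¹) * volSq U F := by
  have hm : Measurable fun y : E d => c + r • y := by fun_prop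
  rw [volSq_eq, volSq_eq, ← lintegral_indicator hU, ← lintegral_indicator (hm hU),
    ← lintegral_comp_add_smul _ c hr]
  rfl

theorem volSq_polyFun_smul (U : Set (E d)) (a : ℂ) (q : Poly d) :
    volSq U (polyFun (a • q)) = ‖a‖ₑ ^ 2 * volSq U (polyFun q) := by
  rw [polyFun_smul]; exact sqNorm_const_mul _ _ _

/-- The polynomial `|x - c|² - r²`. -/
noncomputable def bubblePoly (c : E d) (r : ℝ) : Poly d :=
  ∑ i, (X i - C ((c i : ℝ) : ℂ)) ^ 2 - C ((r : ℂ) ^ 2)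

theorem polyFun_bubblePoly (c : E d) (r : ℝ) (x : E d) :
    polyFun (bubblePoly c r) x = ((‖x - c‖ ^ 2 - r ^ 2 : ℝ) : ℂ) := by
  simp [polyFun, bubblePoly, EuclideanSpace.norm_sq_eq]

theorem polySub_bubblePoly (c : E d) (r : ℝ) :
    polySub c r (bubblePoly c r) = ((r : ℂ) ^ 2) • (normSqPoly d - 1) := by
  simp [polySub, bubblePoly, normSqPoly, smul_sub, Finset.smul_sum, smul_eq_C_mul, mul_pow]

theorem totalDegree_bubblePoly_le (c : E d) (r : ℝ) : (bubblePoly c r).totalDegree ≤ 2 := by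
  refine (totalDegree_sub _ _).trans (max_le (totalDegree_finsetSum_le fun i _ => ?_) ((totalDegree_C _).trans_le (Nat.zero_le _)))
  refine (totalDegree_pow _ _).trans ?_
  have := totalDegree_sub_C_le (X i : Poly d) ((c i : ℝ) : ℂ)
  rw [totalDegree_X] at this
  omega

theorem bubblePoly_mul_mem {c : E d} {r : ℝ} {p : ℕ} {q : Poly d} (hq : q ∈ testSpace d p) :
    bubblePoly c r * q ∈ polySpace d p := by
  unfold testSpace at hq
  split_ifs at hq with h
  · rw [mem_restrictTotalDegree] at *
    have := totalDegree_mul (bubblePoly c r) q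
    have := totalDegree_bubblePoly_le c r
    omega
  · rw [Submodule.mem_bot] at hq
    rw [hq, mul_zero]
    exact Submodule.zero_mem _

theorem polyLap_bubblePoly_mul_mem {c : E d} {r : ℝ} {p : ℕ} {q : Poly d} (hq : q ∈ testSpace d p) :
    polyLap d (bubblePoly c r * q) ∈ testSpace d p := by
  have h1 := bubblePoly_mul_mem (c := c) (r := r) hq
  unfold testSpace at *
  split_ifs at * with h
  · rw [mem_restrictTotalDegree] at *
    have := totalDegree_polyLap_le (bubblePoly c r * q)
    omega
  · rw [Submodule.mem_bot] at *
    rw [hq, mul_zero, map_zero]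

namespace IsStarBall

variable {K : Set (E d)} {c : E d} {r ρ : ℝ}

/-- `K` lies between the balls of radii `r` and `ρ r`. The substitution `x = c + r y` maps the
reference balls to these with the same Jacobian on both sides, so a reference estimate holds on
every element, whatever its shape. -/
theorem volSq_polyFun_le_of_polySub (h : IsStarBall K c r ρ) {P Q : Poly d} {M : ℝ≥0∞}
    (hPQ : volSq (Metric.closedBall 0 ρ) (polyFun (polySub c r P)) ≤
      M * volSq (Metric.ball 0 1) (polyFun (polySub c r Q))) :
    volSq K (polyFun P) ≤ M * volSq K (polyFun Q) := by
  have hr := h.pos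
  have e1 : (fun y : E d => c + r • y) ⁻¹' Metric.closedBall c (ρ * r) = Metric.closedBall 0 ρ := by
    ext y
    simp only [mem_preimage, mem_closedBall_iff_norm, add_sub_cancel_left, norm_smul,
      Real.norm_of_nonneg hr.le, sub_zero]
    rw [mul_comm ρ, mul_le_mul_iff_right₀ hr]
  have e2 : (fun y : E d => c + r • y) ⁻¹' Metric.ball c r = Metric.ball 0 1 := by
    ext y
    simp only [mem_preimage, mem_ball_iff_norm, add_sub_cancel_left, norm_smul,
      Real.norm_of_nonneg hr.le, sub_zero]
    rw [mul_lt_iff_lt_one_right hr]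
  have f1 := volSq_comp_add_smul c hr (Metric.isClosed_closedBall (x := c) (ε := ρ * r)).measurableSet
    (polyFun P)
  have f2 := volSq_comp_add_smul c hr (Metric.isOpen_ball (x := c) (ε := r)).measurableSet (polyFun Q)
  rw [e1] at f1
  rw [e2] at f2
  simp_rw [← polyFun_polySub] at f1 f2
  change volSq _ (polyFun _) = _ at f1 f2
  rw [f1, f2, mul_left_comm] at hPQ
  have h0 : ENNReal.ofReal ((r ^ d)⁻¹) ≠ 0 := by
    rw [ne_eq, ENNReal.ofReal_eq_zero, not_le]; positivity
  rw [ENNReal.mul_le_mul_iff_right h0 ENNReal.ofReal_ne_top] at hPQ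
  exact (volSq_mono h.subset_closedBall _).trans (hPQ.trans (by gcongr; exact volSq_mono h.ball_subset _))

end IsStarBall

/-- Inverse estimate for polynomials. -/
theorem exists_inverse_const (d p : ℕ) (ρ : ℝ) : ∃ M : ℝ≥0, ∀ (K : Set (E d)) (c : E d) (r : ℝ),
    IsStarBall K c r ρ → ∀ q ∈ polySpace d p, ∑ i, volSq K (polyFun (pderiv i q)) ≤
      M * ENNReal.ofReal (r⁻¹ ^ 2) * volSq K (polyFun q) := by
  choose M hM using fun i : Fin d => exists_volSq_le (polySpace d p) LinearMap.id
    (pderiv i).toLinearMap (fun q _ h => h) ρ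
  refine ⟨∑ i, M i, fun K c r h q hq => ?_⟩
  rw [ENNReal.ofNNReal_finsetSum, Finset.sum_mul, Finset.sum_mul]
  refine Finset.sum_le_sum fun i _ => h.volSq_polyFun_le_of_polySub ?_
  have h1 := hM i _ (polySub_mem_polySpace c r hq)
  have hr := h.pos
  have e : polySub c r (pderiv i q) = ((r : ℂ)⁻¹) • pderiv i (polySub c r q) := by
    rw [pderiv_polySub, smul_smul, inv_mul_cancel₀ (by exact_mod_cast hr.ne'), one_smul]
  rw [e, volSq_polyFun_smul, enorm_sq_eq]
  change volSq _ (polyFun (pderiv i (polySub c r q))) ≤ M i * volSq _ (polyFun (polySub c r q)) at h1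
  have e2 : ‖(r : ℂ)⁻¹‖ = r⁻¹ := by simp [abs_of_pos hr]
  rw [e2, mul_comm (M i : ℝ≥0∞), mul_assoc]
  gcongr

/-- In the reference coordinate the bubble factor is `r² (|y|² - 1)`, so all elements share one
finite-dimensional estimate in which the Laplacian is injective. The operator `g` scales like `k`
derivatives and `Δ` like two, which leaves `(r² / r^k)²`. -/
theorem exists_bubble_const_of_scaling (hd : 1 ≤ d) (p : ℕ) (ρ : ℝ) (g : Poly d →ₗ[ℂ] Poly d) (k : ℕ)
    (hg : ∀ (c : E d) (r : ℝ) (q : Poly d), g (polySub c r q) = ((r : ℂ) ^ k) • polySub c r (g q)) :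
    ∃ M : ℝ≥0, ∀ (K : Set (E d)) (c : E d) (r : ℝ), IsStarBall K c r ρ → ∀ q ∈ testSpace d p,
      volSq K (polyFun (g (bubblePoly c r * q))) ≤
        M * ENNReal.ofReal ((r ^ 2 * (r ^ k)⁻¹) ^ 2) *
          volSq K (polyFun (polyLap d (bubblePoly c r * q))) := by
  obtain ⟨M, hM⟩ := exists_volSq_le (testSpace d p)
    (polyLap d ∘ₗ LinearMap.mulLeft ℂ (normSqPoly d - 1)) (g ∘ₗ LinearMap.mulLeft ℂ (normSqPoly d - 1))
    (fun q _ h => eq_zero_of_polyLap_bubble_eq_zero hd h) ρ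
  refine ⟨M, fun K c r h q hq => h.volSq_polyFun_le_of_polySub ?_⟩
  have hr := h.pos
  have hr0 : (r : ℂ) ≠ 0 := by exact_mod_cast hr.ne'
  have h1 := hM _ (Submodule.smul_mem _ ((r : ℂ) ^ 2) (polySub_mem_testSpace c r hq))
  have e : (normSqPoly d - 1) * ((r : ℂ) ^ 2) • polySub c r q = polySub c r (bubblePoly c r * q) := by
    rw [map_mul, polySub_bubblePoly, mul_smul_comm, smul_mul_assoc]
  simp only [LinearMap.comp_apply, LinearMap.mulLeft_apply] at h1
  rw [e, hg, polyLap_polySub, volSq_polyFun_smul, volSq_polyFun_smul, enorm_sq_eq, enorm_sq_eq,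
    norm_pow, norm_pow, Complex.norm_of_nonneg hr.le] at h1
  rw [mul_pow, ENNReal.ofReal_mul (by positivity)]
  calc _ = ENNReal.ofReal ((r ^ k)⁻¹ ^ 2) * (ENNReal.ofReal ((r ^ k) ^ 2) * volSq (Metric.closedBall 0 ρ)
        (polyFun (polySub c r (g (bubblePoly c r * q))))) := by
        rw [← mul_assoc, ← ENNReal.ofReal_mul (by positivity), ← mul_pow,
          inv_mul_cancel₀ (by positivity)]
        simp
    _ ≤ _ := mul_le_mul' le_rfl h1
    _ = _ := by ring

/-- Bounds of a bubble function by its Laplacian. -/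
theorem exists_bubble_const (hd : 1 ≤ d) (p : ℕ) (ρ : ℝ) :
    ∃ M : ℝ≥0, ∀ (K : Set (E d)) (c : E d) (r : ℝ), IsStarBall K c r ρ → ∀ q ∈ testSpace d p,
      volSq K (polyFun (bubblePoly c r * q)) ≤
        M * ENNReal.ofReal (r ^ 4) * volSq K (polyFun (polyLap d (bubblePoly c r * q))) ∧
      ∑ i, volSq K (polyFun (pderiv i (bubblePoly c r * q))) ≤
        M * ENNReal.ofReal (r ^ 2) * volSq K (polyFun (polyLap d (bubblePoly c r * q))) ∧
      ∑ i, ∑ j, volSq K (polyFun (pderiv j (pderiv i (bubblePoly c r * q)))) ≤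
        M * volSq K (polyFun (polyLap d (bubblePoly c r * q))) := by
  obtain ⟨M₀, h₀⟩ := exists_bubble_const_of_scaling hd p ρ LinearMap.id 0 (by simp)
  choose M₁ h₁ using fun i => exists_bubble_const_of_scaling hd p ρ (pderiv i).toLinearMap 1
    (fun c r q => by simpa using pderiv_polySub c r q i)
  choose M₂ h₂ using fun i j => exists_bubble_const_of_scaling hd p ρ
    ((pderiv j).toLinearMap ∘ₗ (pderiv i).toLinearMap) 2
    (fun c r q => by
      change pderiv j (pderiv i (polySub c r q)) = _ • polySub c r (pderiv j (pderiv i q))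
      rw [pderiv_polySub, Derivation.map_smul, pderiv_polySub, smul_smul, pow_two])
  refine ⟨M₀ + ∑ i, M₁ i + ∑ i, ∑ j, M₂ i j, fun K c r h q hq => ⟨?_, ?_, ?_⟩⟩
  · refine (h₀ K c r h q hq).trans ?_
    have e : (r ^ 2 * (r ^ 0)⁻¹) ^ 2 = r ^ 4 := by ring
    rw [e]
    gcongr
    rw [add_assoc]
    exact_mod_cast le_self_add
  · have e : (r ^ 2 * (r ^ 1)⁻¹) ^ 2 = r ^ 2 := by have := h.pos; field_simp
    calc _ ≤ ∑ i, (M₁ i : ℝ≥0∞) * ENNReal.ofReal (r ^ 2) *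
          volSq K (polyFun (polyLap d (bubblePoly c r * q))) :=
          Finset.sum_le_sum fun i _ => by
            have := h₁ i K c r h q hq
            rwa [e] at this
      _ = ((∑ i, M₁ i : ℝ≥0) : ℝ≥0∞) * ENNReal.ofReal (r ^ 2) *
          volSq K (polyFun (polyLap d (bubblePoly c r * q))) := by
          rw [ENNReal.ofNNReal_finsetSum, Finset.sum_mul, Finset.sum_mul]
      _ ≤ _ := by
          gcongr
          exact le_add_self.trans le_self_add
  · have e : (r ^ 2 * (r ^ 2)⁻¹) ^ 2 = 1 := by have := h.pos; field_simp
    calc _ ≤ ∑ i, ∑ j, (M₂ i j : ℝ≥0∞) * volSq K (polyFun (polyLap d (bubblePoly c r * q))) :=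
          Finset.sum_le_sum fun i _ => Finset.sum_le_sum fun j _ => by
            have := h₂ i j K c r h q hq
            rwa [e, ENNReal.ofReal_one, mul_one] at this
      _ = ((∑ i, ∑ j, M₂ i j : ℝ≥0) : ℝ≥0∞) *
          volSq K (polyFun (polyLap d (bubblePoly c r * q))) := by
          simp_rw [ENNReal.ofNNReal_finsetSum, Finset.sum_mul]
      _ ≤ _ := by
          gcongr
          exact le_add_self

/-! ### The DG norms in terms of element norms. -/

/-- `A ≤ a H + b X` with nonnegative real coefficients. -/
structure LinBound (A : ℝ≥0∞) (a : ℝ) (H : ℝ≥0∞) (b : ℝ) (X : ℝ≥0∞) : Prop where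
  left_nonneg : 0 ≤ a
  right_nonneg : 0 ≤ b
  le : A ≤ ENNReal.ofReal a * H + ENNReal.ofReal b * X

namespace LinBound

variable {A A' H X : ℝ≥0∞} {a b a' b' : ℝ}

theorem add (h : LinBound A a H b X) (h' : LinBound A' a' H b' X) :
    LinBound (A + A') (a + a') H (b + b') X := by
  refine ⟨add_nonneg h.left_nonneg h'.left_nonneg, add_nonneg h.right_nonneg h'.right_nonneg, ?_⟩
  rw [ENNReal.ofReal_add h.left_nonneg h'.left_nonneg,
    ENNReal.ofReal_add h.right_nonneg h'.right_nonneg]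
  exact (add_le_add h.le h'.le).trans_eq (by ring)

theorem smul (h : LinBound A a H b X) {t : ℝ} (ht : 0 ≤ t) :
    LinBound (ENNReal.ofReal t * A) (t * a) H (t * b) X := by
  refine ⟨mul_nonneg ht h.left_nonneg, mul_nonneg ht h.right_nonneg, ?_⟩
  rw [ENNReal.ofReal_mul ht, ENNReal.ofReal_mul ht]
  exact (mul_le_mul' le_rfl h.le).trans_eq (by ring)

theorem mono (h : LinBound A a H b X) (ha : a ≤ a') (hb : b ≤ b') : LinBound A a' H b' X :=
  ⟨h.left_nonneg.trans ha, h.right_nonneg.trans hb, h.le.trans (by gcongr)⟩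

theorem trans (h : LinBound A a H b X) (hA : A' ≤ A) : LinBound A' a H b X :=
  ⟨h.left_nonneg, h.right_nonneg, hA.trans h.le⟩

theorem left (H X : ℝ≥0∞) : LinBound H 1 H 0 X := ⟨zero_le_one, le_rfl, by simp⟩

theorem right (H X : ℝ≥0∞) : LinBound X 0 H 1 X := ⟨le_rfl, zero_le_one, by simp⟩

end LinBound

theorem isH1_of_eqOn_poly {K : Set (E d)} (hK : IsOpen K) (hb : Bornology.IsBounded K) {u : E d → ℂ}
    {W : Poly d} (h : ∀ x ∈ K, u x = polyFun W x) :
    IsH1 K u fun i => polyFun (pderiv i W) := by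
  refine (IsH1.of_contDiff hK hb (contDiff_polyFun W)).congr ?_ fun i => ?_
  · filter_upwards [self_mem_ae_restrict hK.measurableSet] with x hx using (h x hx).symm
  · exact ae_of_all _ fun x => fderiv_polyFun W i x

theorem isH1_weakDeriv_of_eqOn_poly {K : Set (E d)} (hK : IsOpen K) (hb : Bornology.IsBounded K)
    {u : E d → ℂ} {W : Poly d} (h : ∀ x ∈ K, u x = polyFun W x) (i : Fin d) :
    IsH1 K (weakDeriv K i u) fun j => polyFun (pderiv j (pderiv i W)) :=
  (isH1_of_eqOn_poly hK hb (W := pderiv i W) fun _ _ => rfl).congr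
    ((isH1_of_eqOn_poly hK hb h).weakDeriv_ae_eq hK i).symm fun _ => by rfl

theorem weakLaplacian_ae_eq {K : Set (E d)} (hK : IsOpen K) (hb : Bornology.IsBounded K)
    {u : E d → ℂ} {W : Poly d} (h : ∀ x ∈ K, u x = polyFun W x) :
    weakLaplacian K u =ᵐ[volume.restrict K] polyFun (polyLap d W) := by
  have h1 : ∀ i, weakDeriv K i (weakDeriv K i u) =ᵐ[volume.restrict K]
      polyFun (pderiv i (pderiv i W)) := fun i =>
    (isH1_weakDeriv_of_eqOn_poly hK hb h i).weakDeriv_ae_eq hK i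
  filter_upwards [ae_all_iff.2 h1] with x hx
  simp [weakLaplacian, hx, polyLap_apply, polyFun]

theorem aestronglyMeasurable_trace (K : Set (E d)) (v : E d → ℂ) :
    AEStronglyMeasurable (trace K v) ((surf d).restrict (frontier K)) := by
  unfold trace
  split_ifs with h
  · exact h.choose_spec.2.1.1
  · exact aestronglyMeasurable_const

theorem norm_outerNormal_le (K : Set (E d)) (x : E d) : ‖outerNormal K x‖ ≤ 1 := by
  unfold outerNormal
  split_ifs with h
  · exact h.choose_spec.1.le
  · simp

theorem enorm_normalTrace_sq_le (K : Set (E d)) (u : E d → ℂ) (x : E d) :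
    ‖normalTrace K u x‖ₑ ^ 2 ≤ ∑ i, ‖trace K (weakDeriv K i u) x‖ₑ ^ 2 := by
  simp_rw [enorm_sq_eq]
  rw [← ENNReal.ofReal_sum_of_nonneg fun i _ => by positivity]
  refine ENNReal.ofReal_le_ofReal ?_
  have h1 : ‖normalTrace K u x‖ ≤ ∑ i, |outerNormal K x i| * ‖trace K (weakDeriv K i u) x‖ := by
    refine (norm_sum_le _ _).trans (le_of_eq (Finset.sum_congr rfl fun i _ => ?_))
    rw [norm_mul, Complex.norm_real, Real.norm_eq_abs]
  have h2 : ∑ i, |outerNormal K x i| ^ 2 ≤ 1 := by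
    have := norm_outerNormal_le K x
    have h3 : ‖outerNormal K x‖ ^ 2 ≤ 1 := pow_le_one₀ (norm_nonneg _) this
    rw [EuclideanSpace.norm_sq_eq] at h3
    simpa using h3
  calc ‖normalTrace K u x‖ ^ 2
      ≤ (∑ i, |outerNormal K x i| * ‖trace K (weakDeriv K i u) x‖) ^ 2 := by gcongr
    _ ≤ (∑ i, |outerNormal K x i| ^ 2) * ∑ i, ‖trace K (weakDeriv K i u) x‖ ^ 2 :=
      Finset.sum_mul_sq_le_sq_mul_sq _ _ _
    _ ≤ 1 * ∑ i, ‖trace K (weakDeriv K i u) x‖ ^ 2 := by gcongr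
    _ = _ := one_mul _

/-- The bound is pointwise, so measurability of the normal plays no role; only the traces of the
derivatives must be measurable to split the sum. -/
theorem surfSq_normalTrace_le (K : Set (E d)) (u : E d → ℂ) :
    surfSq (frontier K) (normalTrace K u) ≤
      ∑ i, surfSq (frontier K) (trace K (weakDeriv K i u)) := by
  refine (lintegral_mono fun x => enorm_normalTrace_sq_le K u x).trans (le_of_eq ?_)
  exact lintegral_finsetSum' _ fun i _ => (aestronglyMeasurable_trace K _).enorm.pow_const 2

section Mesh

variable {Ω : Set (E d)} {T : Mesh Ω} {σ : ShapeParams}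

theorem Mesh.diam_le_h {K : Set (E d)} (hK : K ∈ T.elems) : Metric.diam K ≤ T.h :=
  le_csSup ((T.elems.finite_toSet.image _).bddAbove) (mem_image_of_mem _ hK)

theorem Mesh.A1.two_mul_rad_le (h : T.A1 σ) (hd : 1 ≤ d) {K : Set (E d)} (hK : K ∈ T.elems) :
    2 * T.rad K ≤ T.h :=
  ((h.isStarBall hK).two_mul_le_diam hd).trans (Mesh.diam_le_h hK)

theorem Mesh.A1.h_pos (h : T.A1 σ) (hd : 1 ≤ d) {K : Set (E d)} (hK : K ∈ T.elems) : 0 < T.h := by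
  have := h.two_mul_rad_le hd hK
  have := (h.isStarBall hK).pos
  linarith

open Classical in
/-- A point belongs to a bounded number of closed elements. -/
theorem Mesh.A1.card_closure_le (h : T.A1 σ) (x : E d) :
    ((T.elems.filter fun K => x ∈ closure K).card : ℝ) ≤ (2 * σ.gam + 1) ^ d := by
  set I := T.elems.filter fun K => x ∈ closure K with hI
  have hg := σ.gam_pos
  rcases I.eq_empty_or_nonempty with h0 | hne
  · rw [h0]; simp; positivity
  have hmem : ∀ K ∈ I, K ∈ T.elems ∧ x ∈ closure K := fun K hK => by simpa [hI] using hK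
  obtain ⟨K₀, hK₀, hmin⟩ := I.exists_min_image T.rad hne
  set ε := T.rad K₀ with hε
  have hε0 : 0 < ε := (h.isStarBall (hmem K₀ hK₀).1).pos
  -- With `ε` the smallest inscribed radius among the elements touching `x`, each of them contains
  -- an `ε`-ball within distance of order `ε` from `x`. These balls are disjoint, so comparing
  -- volumes bounds their number even if the elements differ greatly in size.
  set y : Set (E d) → E d := fun K => T.ctr K + (1 - ε / T.rad K) • (x - T.ctr K) with hy
  have hsub : ∀ K ∈ I, Metric.ball (y K) ε ⊆ K ∩ Metric.ball x ((2 * σ.gam + 1) * ε) := by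
    intro K hK
    have hs := h.isStarBall (hmem K hK).1
    have hr := hs.pos
    have hle : ε / T.rad K ≤ 1 := (div_le_one hr).2 (hmin K hK)
    have hpos : 0 < ε / T.rad K := by positivity
    refine subset_inter ?_ ?_
    · have := hs.ball_lineMap_subset (hmem K hK).2 (t := 1 - ε / T.rad K) (by linarith) (by linarith)
      rwa [sub_sub_cancel, div_mul_cancel₀ _ hr.ne'] at this
    · refine Metric.ball_subset_ball' ?_
      have h1 := hs.closure_subset (hmem K hK).2
      rw [mem_closedBall_iff_norm] at h1
      have h2 : dist (y K) x ≤ 2 * σ.gam * ε := by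
        rw [dist_eq_norm, hy]
        have : T.ctr K + (1 - ε / T.rad K) • (x - T.ctr K) - x = -(ε / T.rad K) • (x - T.ctr K) := by
          module
        simp only [this, norm_smul, norm_neg, Real.norm_of_nonneg hpos.le]
        calc ε / T.rad K * ‖x - T.ctr K‖ ≤ ε / T.rad K * (2 * σ.gam * T.rad K) := by gcongr
          _ = _ := by field_simp
      linarith
  have hvol : (I.card : ℝ≥0∞) * volume (Metric.ball (0 : E d) ε)
      ≤ volume (Metric.ball x ((2 * σ.gam + 1) * ε)) := by
    calc _ = ∑ K ∈ I, volume (Metric.ball (y K) ε) := by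
          simp [Measure.addHaar_ball_center]
      _ = volume (⋃ K ∈ I, Metric.ball (y K) ε) := by
          refine (measure_biUnion_finset (fun K hK K' hK' hne => ?_) fun K _ => measurableSet_ball).symm
          exact (T.disjoint K (hmem K hK).1 K' (hmem K' hK').1 hne).mono
            ((hsub K hK).trans inter_subset_left) ((hsub K' hK').trans inter_subset_left)
      _ ≤ _ := measure_mono (iUnion₂_subset fun K hK => (hsub K hK).trans inter_subset_right)
  rw [Measure.addHaar_ball_of_pos _ _ (by positivity : 0 < (2 * σ.gam + 1) * ε),
    Measure.addHaar_ball_of_pos _ _ hε0, finrank_euclideanSpace_fin, mul_pow,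
    ENNReal.ofReal_mul (by positivity), mul_assoc, ENNReal.mul_le_mul_iff_left] at hvol
  · rw [← ENNReal.ofReal_natCast, ENNReal.ofReal_le_ofReal_iff (by positivity)] at hvol
    exact hvol
  · refine mul_ne_zero ?_ volume_unitBall_pos.ne'
    rw [ne_eq, ENNReal.ofReal_eq_zero, not_le]; positivity
  · exact ENNReal.mul_ne_top ENNReal.ofReal_ne_top measure_ball_lt_top.ne

/-- The jumps are bounded by the traces from the two sides. -/
theorem Mesh.A1.jumpSq_le (h : T.A1 σ) (u : E d → ℂ) :
    T.jumpSq u ≤ ENNReal.ofReal (2 * (2 * σ.gam + 1) ^ d) *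
      ∑ K ∈ T.elems, surfSq (frontier K) (trace K u) := by
  classical
  have hg := σ.gam_pos
  set t : Set (E d) → Set (E d) → ℝ≥0∞ := fun K K' => surfSq (frontier K ∩ frontier K') (trace K u)
    with ht
  -- At each boundary point only boundedly many `∂K'` contribute, so the sum over neighbours costs
  -- one constant factor.
  have hsum : ∀ K ∈ T.elems, ∑ K' ∈ T.elems, t K K' ≤
      ENNReal.ofReal ((2 * σ.gam + 1) ^ d) * surfSq (frontier K) (trace K u) := by
    intro K hK
    have hm : AEMeasurable (fun x => ‖trace K u x‖ₑ ^ 2) ((surf d).restrict (frontier K)) :=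
      (aestronglyMeasurable_trace K u).enorm.pow_const 2
    have e1 : ∀ K', t K K' = ∫⁻ x in frontier K, (frontier K').indicator
        (fun x => ‖trace K u x‖ₑ ^ 2) x ∂(surf d) := by
      intro K'
      rw [lintegral_indicator isClosed_frontier.measurableSet,
        Measure.restrict_restrict isClosed_frontier.measurableSet, inter_comm]
      rfl
    simp_rw [e1]
    rw [← lintegral_finsetSum' _ fun K' _ => hm.indicator isClosed_frontier.measurableSet,
      surfSq_eq, ← lintegral_const_mul' _ _ ENNReal.ofReal_ne_top]
    refine lintegral_mono fun x => ?_
    simp only [indicator_apply]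
    rw [← Finset.sum_filter, Finset.sum_const, nsmul_eq_mul]
    gcongr
    rw [← ENNReal.ofReal_natCast]
    refine ENNReal.ofReal_le_ofReal (le_trans ?_ (h.card_closure_le x))
    exact_mod_cast Finset.card_le_card (Finset.monotone_filter_right _ fun K' _ hx =>
      frontier_subset_closure hx)
  have hpair : ∀ P ∈ T.elems.offDiag, surfSq (frontier P.1 ∩ frontier P.2 ∩ Ω)
      (fun x => trace P.1 u x - trace P.2 u x) ≤ 2 * t P.1 P.2 + 2 * t P.2 P.1 := by
    intro P _
    refine (lintegral_mono' (Measure.restrict_mono inter_subset_left le_rfl) le_rfl).trans ?_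
    have hm : AEStronglyMeasurable (trace P.1 u) ((surf d).restrict (frontier P.1 ∩ frontier P.2)) :=
      (aestronglyMeasurable_trace P.1 u).mono_measure (Measure.restrict_mono inter_subset_left le_rfl)
    refine (sqNorm_sub_le hm).trans_eq ?_
    simp only [ht, surfSq, inter_comm (frontier P.2)]
  have hoff : ∀ f : Set (E d) × Set (E d) → ℝ≥0∞,
      ∑ P ∈ T.elems.offDiag, f P ≤ ∑ K ∈ T.elems, ∑ K' ∈ T.elems, f (K, K') := by
    intro f
    rw [← Finset.sum_product']
    exact Finset.sum_le_sum_of_subset fun P hP => Finset.mem_product.2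
      ⟨(Finset.mem_offDiag.1 hP).1, (Finset.mem_offDiag.1 hP).2.1⟩
  unfold Mesh.jumpSq
  calc _ ≤ 2⁻¹ * ∑ K ∈ T.elems, ∑ K' ∈ T.elems, (2 * t K K' + 2 * t K' K) := by
        refine mul_le_mul' le_rfl (le_trans ?_ (hoff fun P => 2 * t P.1 P.2 + 2 * t P.2 P.1))
        refine le_trans (le_of_eq ?_) (Finset.sum_le_sum hpair)
        congr
    _ = 2 * ∑ K ∈ T.elems, ∑ K' ∈ T.elems, t K K' := by
        simp_rw [Finset.sum_add_distrib, ← Finset.mul_sum]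
        rw [Finset.sum_comm (f := fun K K' => t K' K), ← mul_add, ← two_mul, ← mul_assoc,
          ENNReal.inv_mul_cancel (by simp) (by simp), one_mul]
    _ ≤ 2 * ∑ K ∈ T.elems, ENNReal.ofReal ((2 * σ.gam + 1) ^ d) *
          surfSq (frontier K) (trace K u) := by
        gcongr with K hK
        exact hsum K hK
    _ = _ := by
        rw [ENNReal.ofReal_mul (p := 2) (by norm_num), ← Finset.mul_sum, ENNReal.ofReal_ofNat, mul_assoc]

/-- The trace constant as a real number. -/
noncomputable def trC (d : ℕ) (σ : ShapeParams) : ℝ := (traceConst d (2 * σ.gam)).toReal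

theorem trC_nonneg : 0 ≤ trC d σ := ENNReal.toReal_nonneg

theorem Mesh.A1.linBound_surfSq_trace (h : T.A1 σ) (hd : 1 ≤ d) {K : Set (E d)} (hK : K ∈ T.elems)
    (u : E d → ℂ) : LinBound (surfSq (frontier K) (trace K u))
      (trC d σ * T.rad K) (gradSq K u) (trC d σ * (T.rad K)⁻¹) (volSq K u) := by
  have hs := h.isStarBall hK
  have hr := hs.pos
  have h1 := hs.surfSq_trace_le hd u
  rw [← ENNReal.ofReal_toReal (traceConst_ne_top (d := d) (2 * σ.gam))] at h1
  have h2 := (((LinBound.right (gradSq K u) (volSq K u)).add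
    ((LinBound.left (gradSq K u) (volSq K u)).smul (sq_nonneg (T.rad K)))).smul
      (inv_nonneg.2 hr.le)).smul (trC_nonneg (d := d) (σ := σ))
  rw [mul_assoc] at h1
  refine (h2.trans h1).mono (le_of_eq ?_) (le_of_eq ?_)
  · field_simp; ring
  · ring

/-- The constant in the bound of the DG norm by scaled element norms. -/
noncomputable def dgC (d : ℕ) (σ : ShapeParams) (CΩ : ℝ) (p : ℕ) : ℝ :=
  1 + CΩ ^ 2 + trC d σ * (2 * (2 * σ.gam + 1) ^ d * p ^ 2 + CΩ)

/-- All face terms go through the trace inequality. The jump weight `p² / h` meets a factor `r ≤ h`,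
and (A0) gives `ω r ≤ CΩ` because `ω ≤ 1 + ω²`; this turns `ω²` and `ω / r` into multiples of `r⁻²`.
-/
theorem Mesh.dgSq_le (hA1 : T.A1 σ) (hd : 1 ≤ d) {ω CΩ : ℝ} (hω : 0 < ω) (hA0 : T.A0 ω CΩ) (p : ℕ)
    (u : E d → ℂ) : T.dgSq ω p u ≤ ∑ K ∈ T.elems, (ENNReal.ofReal (dgC d σ CΩ p) * gradSq K u
      + ENNReal.ofReal (dgC d σ CΩ p * (T.rad K)⁻¹ ^ 2) * volSq K u) := by
  have hg := σ.gam_pos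
  set N := (2 * σ.gam + 1) ^ d with hN
  have hN0 : 0 < N := by positivity
  rcases T.elems.eq_empty_or_nonempty with h0 | ⟨K₀, hK₀⟩
  · simp [Mesh.dgSq, Mesh.jumpSq, Mesh.bdrySq, h0]
  have hh := hA1.h_pos hd hK₀
  unfold Mesh.A0 at hA0
  have hτ := trC_nonneg (d := d) (σ := σ)
  have hb : T.bdrySq u ≤ ∑ K ∈ T.elems, surfSq (frontier K) (trace K u) :=
    Finset.sum_le_sum fun K _ => lintegral_mono_set inter_subset_left
  calc T.dgSq ω p u ≤ ∑ K ∈ T.elems, gradSq K u + ENNReal.ofReal (ω ^ 2) * ∑ K ∈ T.elems, volSq K u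
        + ENNReal.ofReal (p ^ 2 / T.h) * (ENNReal.ofReal (2 * N) *
          ∑ K ∈ T.elems, surfSq (frontier K) (trace K u))
        + ENNReal.ofReal ω * ∑ K ∈ T.elems, surfSq (frontier K) (trace K u) := by
        unfold Mesh.dgSq
        gcongr
        exact hA1.jumpSq_le u
    _ = ∑ K ∈ T.elems, (gradSq K u + ENNReal.ofReal (ω ^ 2) * volSq K u
          + ENNReal.ofReal (p ^ 2 / T.h) * (ENNReal.ofReal (2 * N) * surfSq (frontier K) (trace K u))
          + ENNReal.ofReal ω * surfSq (frontier K) (trace K u)) := by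
        simp_rw [Finset.mul_sum, Finset.sum_add_distrib]
    _ ≤ _ := by
        refine Finset.sum_le_sum fun K hK => ?_
        have hr := (hA1.isStarBall hK).pos
        have hrh := hA1.two_mul_rad_le hd hK
        have hS := hA1.linBound_surfSq_trace hd hK u
        have key := ((((LinBound.left (gradSq K u) (volSq K u)).add
          ((LinBound.right (gradSq K u) (volSq K u)).smul (sq_nonneg ω))).add
          ((hS.smul (by positivity : 0 ≤ 2 * N)).smul (by positivity : 0 ≤ (p : ℝ) ^ 2 / T.h))).add
          (hS.smul hω.le))
        have k1 : T.rad K / T.h ≤ 1 := (div_le_one hh).2 (by linarith)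
        have k2 : ω * T.rad K ≤ CΩ := by nlinarith [sq_nonneg (ω - 1), mul_pos hω hh]
        have k3 : (ω * T.rad K) ^ 2 ≤ CΩ ^ 2 := by gcongr
        have k4 : (p : ℝ) ^ 2 / T.h * (2 * N * (trC d σ * T.rad K)) + ω * (trC d σ * T.rad K)
            ≤ trC d σ * (2 * N * p ^ 2 + CΩ) := by
          calc _ = trC d σ * (2 * N * p ^ 2 * (T.rad K / T.h) + ω * T.rad K) := by ring
            _ ≤ trC d σ * (2 * N * p ^ 2 * 1 + CΩ) := by gcongr
            _ = _ := by ring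
        refine (key.mono ?_ ?_).le
        · rw [dgC]
          linarith [sq_nonneg CΩ]
        · have e : (0 + ω ^ 2 * 1 + (p : ℝ) ^ 2 / T.h * (2 * N * (trC d σ * (T.rad K)⁻¹))
              + ω * (trC d σ * (T.rad K)⁻¹)) = ((ω * T.rad K) ^ 2 +
              ((p : ℝ) ^ 2 / T.h * (2 * N * (trC d σ * T.rad K)) + ω * (trC d σ * T.rad K)))
                * (T.rad K)⁻¹ ^ 2 := by
            field_simp
            ring
          rw [e]
          gcongr
          rw [dgC]
          linarith

/-- The extra DG⁺ term: the trace inequality is applied to each first derivative, at the price of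
second derivatives. -/
theorem Mesh.normalTrace_le (hA1 : T.A1 σ) (hd : 1 ≤ d) {p : ℕ} (hp : 1 ≤ p) {K : Set (E d)}
    (hK : K ∈ T.elems) (u : E d → ℂ) :
    ENNReal.ofReal (T.h / (p : ℝ) ^ 2) * surfSq (frontier K) (normalTrace K u) ≤
      ENNReal.ofReal (T.h * (trC d σ * (T.rad K)⁻¹)) * gradSq K u +
      ENNReal.ofReal (T.h * (trC d σ * T.rad K)) * ∑ i, gradSq K (weakDeriv K i u) := by
  have hh := hA1.h_pos hd hK
  have h1 : surfSq (frontier K) (normalTrace K u) ≤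
      ENNReal.ofReal (trC d σ * (T.rad K)⁻¹) * gradSq K u +
      ENNReal.ofReal (trC d σ * T.rad K) * ∑ i, gradSq K (weakDeriv K i u) := by
    refine (surfSq_normalTrace_le K u).trans ((Finset.sum_le_sum fun i _ =>
      (hA1.linBound_surfSq_trace hd hK (weakDeriv K i u)).le).trans (le_of_eq ?_))
    rw [Finset.sum_add_distrib, ← Finset.mul_sum, ← Finset.mul_sum, add_comm]
    rfl
  have h2 : T.h / (p : ℝ) ^ 2 ≤ T.h := by
    refine div_le_self hh.le (one_le_pow₀ ?_)
    exact_mod_cast hp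
  rw [ENNReal.ofReal_mul hh.le, ENNReal.ofReal_mul hh.le, mul_assoc, mul_assoc, ← mul_add]
  exact mul_le_mul' (ENNReal.ofReal_le_ofReal h2) h1

end Mesh

/-! ### The constants of items 1 and 2. -/

section Mesh

variable {Ω : Set (E d)} {T : Mesh Ω} {σ : ShapeParams}

/-- Replacing `r` by `h_K` only enlarges the right side. The normalisation `C ≥ 1` lets `√C` be
bounded below by 1 in the final constants. -/
theorem exists_poincareFriedrichs (hd : 1 ≤ d) (σ : ShapeParams) : ∃ C ≥ (1 : ℝ),
    ∀ (Ω : Set (E d)) (T : Mesh Ω), T.A1 σ → ∀ K ∈ T.elems, PoincareFriedrichs K C := by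
  obtain ⟨C, hC⟩ := IsStarBall.exists_friedrichs_const d hd (2 * σ.gam)
  refine ⟨C + 1, by simp, fun Ω T hT K hK v hv => ?_⟩
  have hs := hT.isStarBall hK
  have h2 := hs.two_mul_le_diam hd
  have hr := hs.pos
  refine (hC K _ _ hs v hv).trans ?_
  have h3 : T.rad K ≤ Metric.diam K := by linarith
  rw [← ENNReal.ofReal_coe_nnreal]
  gcongr
  simp

theorem exists_inverseTrace (hd : 1 ≤ d) (σ : ShapeParams) : ∃ C > (0 : ℝ),
    ∀ (Ω : Set (E d)) (T : Mesh Ω), T.A1 σ → ∀ K ∈ T.elems, InverseTrace K C := by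
  have hg := σ.gam_pos
  set S := (surfConst d (2 * σ.gam)).toReal with hS
  have hS0 : 0 ≤ S := ENNReal.toReal_nonneg
  -- `(p + 1)² ≤ 4 p²` turns 3 into 12, and `r⁻¹ ≤ 4γ / h_K` gives the last factor.
  set A := S * (12 * 2 ^ d) * (4 * σ.gam) with hA
  have hA0 : 0 ≤ A := by positivity
  refine ⟨√A + 1, by positivity, fun Ω T hT K hK p hp q hq => ?_⟩
  have hs := hT.isStarBall hK
  have hr := hs.pos
  have hD : 0 < Metric.diam K := by have := hs.two_mul_le_diam hd; linarith
  have hDle := hs.diam_le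
  have hp1 : (1 : ℝ) ≤ p := by exact_mod_cast hp
  have h1 := hs.surfSq_polyFun_le hd hq
  rw [← ENNReal.ofReal_toReal (surfConst_ne_top (d := d) (2 * σ.gam)), ← mul_assoc,
    ← ENNReal.ofReal_mul hS0, ← ENNReal.ofReal_mul (by positivity)] at h1
  have h2 : S * (T.rad K)⁻¹ * (3 * 2 ^ d * (p + 1) ^ 2) ≤
      ((√A + 1) * p * Metric.diam K ^ (-(1 / 2) : ℝ)) ^ 2 := by
    have e1 : (Metric.diam K ^ (-(1 / 2) : ℝ)) ^ 2 = (Metric.diam K)⁻¹ := by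
      rw [← Real.rpow_natCast, ← Real.rpow_mul hD.le, ← Real.rpow_neg_one]
      norm_num
    have e2 : A ≤ (√A + 1) ^ 2 := by
      nlinarith [Real.sq_sqrt hA0, Real.sqrt_nonneg A]
    have e3 : (T.rad K)⁻¹ ≤ 4 * σ.gam * (Metric.diam K)⁻¹ := by
      rw [← div_eq_mul_inv, le_div_iff₀ hD, inv_mul_le_iff₀ hr]
      linarith
    have e4 : ((p : ℝ) + 1) ^ 2 ≤ 4 * p ^ 2 := by nlinarith
    calc _ ≤ S * (4 * σ.gam * (Metric.diam K)⁻¹) * (3 * 2 ^ d * (4 * p ^ 2)) := by gcongr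
      _ = A * p ^ 2 * (Metric.diam K)⁻¹ := by rw [hA]; ring
      _ ≤ (√A + 1) ^ 2 * p ^ 2 * (Metric.diam K)⁻¹ := by gcongr
      _ = _ := by rw [mul_pow, mul_pow, e1]
  calc _ ≤ (ENNReal.ofReal (((√A + 1) * p * Metric.diam K ^ (-(1 / 2) : ℝ)) ^ 2) *
        volSq K (polyFun q)) ^ (1 / 2 : ℝ) := by
        refine ENNReal.rpow_le_rpow (h1.trans ?_) (by norm_num)
        gcongr
    _ = _ := by
        rw [ENNReal.mul_rpow_of_nonneg _ _ (by norm_num), ENNReal.ofReal_pow (by positivity),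
          ← ENNReal.rpow_natCast, ← ENNReal.rpow_mul]
        norm_num

theorem volSq_polyFun_lt_top {K : Set (E d)} (hK : IsOpen K) (hb : Bornology.IsBounded K)
    (q : Poly d) : volSq K (polyFun q) < ⊤ :=
  sqNorm_lt_top (memLp_of_continuous hK.measurableSet hb (continuous_polyFun q))

theorem integral_mul_conj_self {K : Set (E d)} (f : E d → ℂ) :
    ‖∫ x in K, f x * (starRingEnd ℂ) (f x)‖ₑ = ‖∫ x in K, ‖f x‖ ^ 2‖ₑ := by
  have : (fun x => f x * (starRingEnd ℂ) (f x)) = fun x => ((‖f x‖ ^ 2 : ℝ) : ℂ) := by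
    ext x
    rw [Complex.mul_conj, Complex.normSq_eq_norm_sq]
  rw [this, integral_complex_ofReal, ← ofReal_norm, ← ofReal_norm, Complex.norm_real]

theorem enorm_integral_mul_conj_self {K : Set (E d)} {f : E d → ℂ}
    (hf : MemLp f 2 (volume.restrict K)) :
    ‖∫ x in K, f x * (starRingEnd ℂ) (f x)‖ₑ = volSq K f := by
  rw [integral_mul_conj_self, Real.enorm_eq_ofReal (integral_nonneg fun x => by positivity),
    ofReal_integral_eq_lintegral_ofReal hf.norm.integrable_sq (ae_of_all _ fun x => by positivity)]
  exact lintegral_congr fun x => (enorm_sq_eq _).symm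

/-- The dual norm of the prototype operator of a bubble function controls its Laplacian. -/
theorem exists_protoDual_const (hd : 1 ≤ d) (σ : ShapeParams) (p : ℕ) : ∃ Q > (0 : ℝ),
    ∀ (Ω : Set (E d)) (T : Mesh Ω), T.A1 σ → ∀ K ∈ T.elems, ∀ u : E d → ℂ, ∀ q ∈ testSpace d p,
      (∀ x ∈ K, u x = polyFun (bubblePoly (T.ctr K) (T.rad K) * q) x) →
      ENNReal.ofReal (T.rad K ^ 2) *
        volSq K (polyFun (polyLap d (bubblePoly (T.ctr K) (T.rad K) * q))) ≤
        ENNReal.ofReal Q * (⨆ q' ∈ testSpace d p, ‖localOp 0 K u q'‖ₑ / testNorm p K q') ^ 2 := by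
  have hg := σ.gam_pos
  obtain ⟨M, hM⟩ := exists_inverse_const d (p - 2) (2 * σ.gam)
  set S := (surfConst d (2 * σ.gam)).toReal with hS
  have hS0 : 0 ≤ S := ENNReal.toReal_nonneg
  set Q : ℝ := (4 * σ.gam) ^ 2 * M + p ^ 2 * (4 * σ.gam) * S * (3 * 2 ^ d * (((p - 2 : ℕ) : ℝ) + 1) ^ 2) + 1
    with hQ
  have hQ0 : 0 < Q := by positivity
  refine ⟨Q, hQ0, fun Ω T hT K hK u q hq hu => ?_⟩
  have hs := hT.isStarBall hK
  have hr := hs.pos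
  set r := T.rad K with hrdef
  set D := Metric.diam K with hD
  have hDr : 2 * r ≤ D := hs.two_mul_le_diam hd
  have hDle : D ≤ 4 * σ.gam * r := by have := hs.diam_le; linarith
  have hD0 : 0 < D := by linarith
  set W := bubblePoly (T.ctr K) r * q with hW
  set L := polyLap d W with hL
  have hLmem : L ∈ testSpace d p := polyLap_bubblePoly_mul_mem hq
  have hLp : L ∈ polySpace d (p - 2) := by
    have h1 := hLmem
    unfold testSpace at h1
    split_ifs at h1 with h2
    · exact h1
    · rw [Submodule.mem_bot] at h1
      rw [h1]; exact Submodule.zero_mem _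
  set X := volSq K (polyFun L) with hX
  have hXt : X ≠ ⊤ := (volSq_polyFun_lt_top hs.isOpen hs.bounded L).ne
  rcases eq_or_ne X 0 with hX0 | hX0
  · rw [hX0, mul_zero]; exact zero_le
  -- The test function `-ΔW` turns the pairing into `h_K ‖ΔW‖²`. Since its test norm is at most a
  -- multiple of `‖ΔW‖`, the quotient in the dual norm is at least a multiple of `h_K ‖ΔW‖`.
  have hop : ‖localOp 0 K u (-L)‖ₑ = ENNReal.ofReal D * X := by
    unfold localOp
    have e : ∫ x in K, (-weakLaplacian K u x - ((0 : ℝ) : ℂ) ^ 2 * u x) *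
        (starRingEnd ℂ) (polyFun (-L) x) = ∫ x in K, polyFun L x * (starRingEnd ℂ) (polyFun L x) := by
      refine integral_congr_ae ?_
      filter_upwards [weakLaplacian_ae_eq hs.isOpen hs.bounded hu] with x hx
      rw [hx]
      simp [polyFun, hL]
    rw [e, enorm_mul, enorm_integral_mul_conj_self
      (memLp_of_continuous hs.isOpen.measurableSet hs.bounded (continuous_polyFun L)),
      ← ofReal_norm, Complex.norm_of_nonneg hD0.le]
  -- The weights of the test norm match the inverse estimates: `h_K²` against `r⁻²` for the gradient
  -- and `h_K` against `r⁻¹` for the trace, with `h_K / r ≤ 4γ`.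
  have htn : testNorm p K (-L) ≤ (ENNReal.ofReal Q * X) ^ (1 / 2 : ℝ) := by
    unfold testNorm
    refine ENNReal.rpow_le_rpow ?_ (by norm_num)
    have e0 : polyFun (-L) = fun x => -polyFun L x := by ext x; simp [polyFun]
    have e1 : surfSq (frontier K) (polyFun (-L)) = surfSq (frontier K) (polyFun L) := by
      rw [e0]; exact sqNorm_neg _ _
    have e2 : ∀ i, volSq K (polyFun (pderiv i (-L))) = volSq K (polyFun (pderiv i L)) := by
      intro i
      have : polyFun (pderiv i (-L)) = fun x => -polyFun (pderiv i L) x := by ext x; simp [polyFun]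
      rw [this]; exact sqNorm_neg _ _
    simp_rw [e2]
    rw [e1]
    have h1 : ∑ i, volSq K (polyFun (pderiv i L)) ≤ ENNReal.ofReal (M * r⁻¹ ^ 2) * X := by
      rw [ENNReal.ofReal_mul (by positivity), ENNReal.ofReal_coe_nnreal]
      exact hM K _ _ hs L hLp
    have h2 : surfSq (frontier K) (polyFun L) ≤
        ENNReal.ofReal (S * r⁻¹ * (3 * 2 ^ d * (((p - 2 : ℕ) : ℝ) + 1) ^ 2)) * X := by
      have := hs.surfSq_polyFun_le hd hLp
      rw [← ENNReal.ofReal_toReal (surfConst_ne_top (d := d) (2 * σ.gam)), ← mul_assoc,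
        ← ENNReal.ofReal_mul hS0, ← ENNReal.ofReal_mul (by positivity)] at this
      exact this
    calc _ ≤ ENNReal.ofReal (D ^ 2) * (ENNReal.ofReal (M * r⁻¹ ^ 2) * X) +
          ENNReal.ofReal ((p : ℝ) ^ 2 * D) *
            (ENNReal.ofReal (S * r⁻¹ * (3 * 2 ^ d * (((p - 2 : ℕ) : ℝ) + 1) ^ 2)) * X) := by gcongr
      _ = ENNReal.ofReal (D ^ 2 * (M * r⁻¹ ^ 2) +
          (p : ℝ) ^ 2 * D * (S * r⁻¹ * (3 * 2 ^ d * (((p - 2 : ℕ) : ℝ) + 1) ^ 2))) * X := by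
          rw [ENNReal.ofReal_add (by positivity) (by positivity), ENNReal.ofReal_mul (p := D ^ 2) (by positivity),
            ENNReal.ofReal_mul (p := (p : ℝ) ^ 2 * D) (by positivity)]
          ring
      _ ≤ _ := by
          gcongr
          have h3 : D * r⁻¹ ≤ 4 * σ.gam := by
            rw [← div_eq_mul_inv, div_le_iff₀ hr]; exact hDle
          have h4 : (D * r⁻¹) ^ 2 ≤ (4 * σ.gam) ^ 2 := by gcongr
          calc _ = (D * r⁻¹) ^ 2 * M + p ^ 2 * (D * r⁻¹) * S *
                (3 * 2 ^ d * (((p - 2 : ℕ) : ℝ) + 1) ^ 2) := by ring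
            _ ≤ (4 * σ.gam) ^ 2 * M + p ^ 2 * (4 * σ.gam) * S *
                (3 * 2 ^ d * (((p - 2 : ℕ) : ℝ) + 1) ^ 2) := by gcongr
            _ ≤ Q := by rw [hQ]; linarith
  have hsup : ‖localOp 0 K u (-L)‖ₑ / testNorm p K (-L) ≤
      ⨆ q' ∈ testSpace d p, ‖localOp 0 K u q'‖ₑ / testNorm p K q' :=
    le_iSup₂ (f := fun q' (_ : q' ∈ testSpace d p) => ‖localOp 0 K u q'‖ₑ / testNorm p K q')
      (-L) (Submodule.neg_mem _ hLmem)
  have hlow : (ENNReal.ofReal D * X) ^ 2 / (ENNReal.ofReal Q * X) ≤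
      (⨆ q' ∈ testSpace d p, ‖localOp 0 K u q'‖ₑ / testNorm p K q') ^ 2 := by
    have h1 : ENNReal.ofReal D * X / (ENNReal.ofReal Q * X) ^ (1 / 2 : ℝ) ≤
        ⨆ q' ∈ testSpace d p, ‖localOp 0 K u q'‖ₑ / testNorm p K q' := by
      refine le_trans ?_ hsup
      rw [hop]
      gcongr
    refine le_trans (le_of_eq ?_) (pow_le_pow_left' h1 2)
    rw [div_eq_mul_inv, div_eq_mul_inv, mul_pow (ENNReal.ofReal D * X), ← ENNReal.inv_pow,
      ← ENNReal.rpow_natCast ((ENNReal.ofReal Q * X) ^ (1 / 2 : ℝ)), ← ENNReal.rpow_mul]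
    norm_num
  have hQe0 : ENNReal.ofReal Q ≠ 0 := by rw [ne_eq, ENNReal.ofReal_eq_zero, not_le]; exact hQ0
  calc ENNReal.ofReal (r ^ 2) * X ≤ ENNReal.ofReal (D ^ 2) * X := by gcongr; linarith
    _ = ENNReal.ofReal Q * ((ENNReal.ofReal D * X) ^ 2 / (ENNReal.ofReal Q * X)) := by
        rw [ENNReal.ofReal_pow hD0.le, div_eq_mul_inv,
          ENNReal.mul_inv (Or.inl hQe0) (Or.inl ENNReal.ofReal_ne_top)]
        calc _ = ENNReal.ofReal D ^ 2 * X * (ENNReal.ofReal Q * (ENNReal.ofReal Q)⁻¹) * (X * X⁻¹) := by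
              rw [ENNReal.mul_inv_cancel hX0 hXt, ENNReal.mul_inv_cancel hQe0 ENNReal.ofReal_ne_top,
                mul_one, mul_one]
          _ = _ := by ring
    _ ≤ _ := by gcongr

theorem dgC_pos {CΩ : ℝ} (hC : 0 < CΩ) (p : ℕ) : 0 < dgC d σ CΩ p := by
  have := trC_nonneg (d := d) (σ := σ)
  have := σ.gam_pos
  unfold dgC
  positivity

/-- Coercivity of the prototype operator on the bubble space. -/
theorem exists_protoCoercive (hd : 1 ≤ d) (σ : ShapeParams) {CΩ : ℝ} (hC : 0 < CΩ) (p : ℕ) :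
    ∃ c₀ > (0 : ℝ), ∀ c, c ≤ c₀ → ∀ (Ω : Set (E d)) (T : Mesh Ω) (ω : ℝ), 0 < ω → T.A1 σ → T.A0 ω CΩ →
      T.ProtoCoercive ω p c := by
  obtain ⟨Q, hQ0, hQ⟩ := exists_protoDual_const hd σ p
  obtain ⟨M, hM⟩ := exists_bubble_const hd p (2 * σ.gam)
  have hdg := dgC_pos (d := d) (σ := σ) hC p
  -- The chain is: DG norm, scaled element norms (`dgC`), Laplacian (two contributions of `M`), dual
  -- norm (`Q`). The `+ 1` keeps `R` positive when `M = 0`.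
  set R : ℝ := dgC d σ CΩ p * (2 * M + 1) * Q with hR
  have hR0 : 0 < R := by positivity
  refine ⟨(√R)⁻¹, by positivity, fun c hc Ω T ω hω hA1 hA0 u hu => ?_⟩
  have hmain : T.dgSq ω p u ≤ ENNReal.ofReal R * ∑ K ∈ T.elems,
      (⨆ q ∈ testSpace d p, ‖localOp 0 K u q‖ₑ / testNorm p K q) ^ 2 := by
    refine (Mesh.dgSq_le hA1 hd hω hA0 p u).trans ?_
    rw [Finset.mul_sum]
    refine Finset.sum_le_sum fun K hK => ?_
    obtain ⟨q, hq, hqu⟩ := hu K hK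
    have hs := hA1.isStarBall hK
    have hr := hs.pos
    have hu' : ∀ x ∈ K, u x = polyFun (bubblePoly (T.ctr K) (T.rad K) * q) x := fun x hx => by
      rw [hqu x hx]; simp only [polyFun_mul, polyFun_bubblePoly]
    obtain ⟨hM0, hM1, -⟩ := hM K _ _ hs q hq
    have hkey := hQ Ω T hA1 K hK u q hq hu'
    set X := volSq K (polyFun (polyLap d (bubblePoly (T.ctr K) (T.rad K) * q))) with hX
    have hv : volSq K u = volSq K (polyFun (bubblePoly (T.ctr K) (T.rad K) * q)) := by
      refine sqNorm_congr ?_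
      filter_upwards [self_mem_ae_restrict hs.isOpen.measurableSet] with x hx using hu' x hx
    rw [← hv] at hM0
    rw [← (isH1_of_eqOn_poly hs.isOpen hs.bounded hu').gradSq_eq hs.isOpen] at hM1
    rw [← ENNReal.ofReal_coe_nnreal, ← ENNReal.ofReal_mul (by positivity)] at hM0 hM1
    calc _ ≤ ENNReal.ofReal (dgC d σ CΩ p) * (ENNReal.ofReal (M * T.rad K ^ 2) * X) +
          ENNReal.ofReal (dgC d σ CΩ p * (T.rad K)⁻¹ ^ 2) *
            (ENNReal.ofReal (M * T.rad K ^ 4) * X) := by gcongr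
      _ = ENNReal.ofReal (dgC d σ CΩ p * (2 * M)) * (ENNReal.ofReal (T.rad K ^ 2) * X) := by
          rw [← mul_assoc, ← mul_assoc, ← mul_assoc, ← ENNReal.ofReal_mul hdg.le,
            ← ENNReal.ofReal_mul (by positivity), ← ENNReal.ofReal_mul (by positivity), ← add_mul,
            ← ENNReal.ofReal_add (by positivity) (by positivity)]
          congr 2
          field_simp
          ring
      _ ≤ ENNReal.ofReal (dgC d σ CΩ p * (2 * M)) * (ENNReal.ofReal Q * _) :=
          mul_le_mul' le_rfl hkey
      _ ≤ _ := by
          rw [← mul_assoc, ← ENNReal.ofReal_mul (by positivity)]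
          refine mul_le_mul' (ENNReal.ofReal_le_ofReal ?_) le_rfl
          rw [hR]
          gcongr
          linarith
  unfold Mesh.dgNorm Mesh.protoDualNorm
  calc _ ≤ ENNReal.ofReal (√R)⁻¹ * (ENNReal.ofReal R * ∑ K ∈ T.elems,
      (⨆ q ∈ testSpace d p, ‖localOp 0 K u q‖ₑ / testNorm p K q) ^ 2) ^ (1 / 2 : ℝ) := by
        gcongr
    _ = _ := by
        rw [ENNReal.mul_rpow_of_nonneg _ _ (by norm_num), ENNReal.ofReal_rpow_of_nonneg hR0.le (by norm_num),
          ← Real.sqrt_eq_rpow, ← mul_assoc, ← ENNReal.ofReal_mul (by positivity),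
          inv_mul_cancel₀ (by positivity), ENNReal.ofReal_one, one_mul]

end Mesh

/-! ### The local corrector and the local approximation. -/

theorem norm_le_of_enorm_sq_le {A B : Type*} [NormedAddCommGroup A] [NormedAddCommGroup B] {a : A}
    {b : B} {c : ℝ} (hc : 0 ≤ c) (h : ‖a‖ₑ ^ 2 ≤ ENNReal.ofReal (c ^ 2) * ‖b‖ₑ ^ 2) :
    ‖a‖ ≤ c * ‖b‖ := by
  rw [enorm_sq_eq, enorm_sq_eq, ← ENNReal.ofReal_mul (by positivity),
    ENNReal.ofReal_le_ofReal_iff (by positivity), ← mul_pow] at h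
  exact (pow_le_pow_iff_left₀ (norm_nonneg _) (by positivity) two_ne_zero).1 h

/-- Solvability of a perturbed finite-dimensional variational problem. -/
theorem exists_variational_solution {V H : Type*} [AddCommGroup V] [Module ℂ V]
    [FiniteDimensional ℂ V] [NormedAddCommGroup H] [InnerProductSpace ℂ H] (J L W : V →ₗ[ℂ] H)
    (hJ : Function.Injective J) (hL : ∀ v, L v ∈ LinearMap.range J) (hLi : Function.Injective L)
    (hW : ∀ v, ‖W v‖ ≤ 1 / 2 * ‖L v‖) (a : H) :
    ∃ v, (∀ f ∈ LinearMap.range J, inner ℂ f (L v + W v - a) = 0) ∧ ‖L v‖ ≤ 2 * ‖a‖ := by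
  set F := LinearMap.range J
  -- A priori bound: `L v` lies in the range of `J` and is itself a test vector, and half of its
  -- norm absorbs the perturbation.
  have hle : ∀ v b, (∀ f ∈ F, inner ℂ f (L v + W v - b) = 0) → ‖L v‖ ≤ 2 * ‖b‖ := by
    intro v b h
    have h1 := h (L v) (hL v)
    have e : L v + W v - b = L v - (b - W v) := by abel
    rw [e, inner_sub_right, sub_eq_zero, inner_self_eq_norm_sq_to_K] at h1
    have h2 : ‖L v‖ ^ 2 ≤ ‖L v‖ * ‖b - W v‖ := by
      refine le_trans (le_of_eq ?_) (norm_inner_le_norm (𝕜 := ℂ) (L v) (b - W v))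
      rw [← h1]
      simp
    have h3 : ‖b - W v‖ ≤ ‖b‖ + 1 / 2 * ‖L v‖ := (norm_sub_le _ _).trans (by gcongr; exact hW v)
    rcases (norm_nonneg (L v)).eq_or_lt with h0 | h0
    · rw [← h0]; positivity
    · rw [pow_two] at h2
      have := le_of_mul_le_mul_left h2 h0
      linarith
  -- `V` and `F` have the same finite dimension because `J` is injective. The a priori bound with
  -- zero data makes `T` injective, hence surjective.
  let T : V →ₗ[ℂ] F := F.orthogonalProjectionOnto.toLinearMap ∘ₗ (L + W)
  have hTinj : Function.Injective T := by
    refine (injective_iff_map_eq_zero _).2 fun v hv => hLi ?_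
    have h1 : L v + W v ∈ Fᗮ := Submodule.orthogonalProjectionOnto_eq_zero_iff.1 hv
    have h2 := hle v 0 fun f hf => by rw [sub_zero]; exact (Submodule.mem_orthogonal _ _).1 h1 f hf
    rw [map_zero, ← norm_le_zero_iff]
    simpa using h2
  have hTsurj : Function.Surjective T :=
    (LinearMap.injective_iff_surjective_of_finrank_eq_finrank
      (LinearMap.finrank_range_of_inj hJ).symm).1 hTinj
  obtain ⟨v, hv⟩ := hTsurj (F.orthogonalProjectionOnto a)
  have hv' : L v + W v - a ∈ Fᗮ := by
    rw [← Submodule.orthogonalProjectionOnto_eq_zero_iff, map_sub, sub_eq_zero]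
    exact hv
  have hv2 := (Submodule.mem_orthogonal _ _).1 hv'
  exact ⟨v, hv2, hle v a hv2⟩

theorem bubblePoly_ne_zero (c : E d) {r : ℝ} (hr : 0 < r) : bubblePoly c r ≠ 0 := by
  intro h
  have h1 := polyFun_bubblePoly c r c
  rw [h, sub_self, norm_zero] at h1
  have : ((0 ^ 2 - r ^ 2 : ℝ) : ℂ) = 0 := by rw [← h1]; simp [polyFun]
  have h2 : (0 ^ 2 - r ^ 2 : ℝ) = 0 := by exact_mod_cast this
  nlinarith

namespace IsStarBall

variable {K : Set (E d)} {c : E d} {r ρ : ℝ}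

/-- The local bubble that corrects a polynomial to a discrete Trefftz function. -/
theorem exists_local_bubble (h : IsStarBall K c r ρ) {p : ℕ} {M ω : ℝ}
    (hM : ∀ q ∈ testSpace d p, volSq K (polyFun (bubblePoly c r * q)) ≤
      ENNReal.ofReal (M * r ^ 4) * volSq K (polyFun (polyLap d (bubblePoly c r * q))))
    (hsmall : ω ^ 4 * (M * r ^ 4) ≤ 1 / 4) (A : Poly d) :
    ∃ q ∈ testSpace d p, (∀ q' ∈ testSpace d p,
      ∫ x in K, (polyFun (polyLap d (bubblePoly c r * q)) x
        + (ω : ℂ) ^ 2 * polyFun (bubblePoly c r * q) x - (ω : ℂ) ^ 2 * polyFun A x) *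
          (starRingEnd ℂ) (polyFun q' x) = 0) ∧
      volSq K (polyFun (polyLap d (bubblePoly c r * q))) ≤
        ENNReal.ofReal (4 * ω ^ 4) * volSq K (polyFun A) := by
  have hr := h.pos
  let Λ := polyLp h.isOpen.measurableSet h.bounded
  have hΛ : Function.Injective Λ := polyLp_injective h.isOpen h.bounded ⟨c, h.center_mem⟩
  have hΛn : ∀ q, ‖Λ q‖ₑ ^ 2 = volSq K (polyFun q) := enorm_polyLp h.isOpen.measurableSet h.bounded
  let B : testSpace d p →ₗ[ℂ] Poly d := LinearMap.mulLeft ℂ (bubblePoly c r) ∘ₗ (testSpace d p).subtype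
  -- Bubbles and test functions are parametrised by the same space: `J` is the test function, `L`
  -- the Laplacian of the bubble and `W` its multiple by `ω²`. The hypothesis `hsmall` says that `W`
  -- is at most half of `L`.
  let J : testSpace d p →ₗ[ℂ] Lp ℂ 2 (volume.restrict K) := Λ ∘ₗ (testSpace d p).subtype
  let L : testSpace d p →ₗ[ℂ] Lp ℂ 2 (volume.restrict K) := Λ ∘ₗ polyLap d ∘ₗ B
  let W : testSpace d p →ₗ[ℂ] Lp ℂ 2 (volume.restrict K) := ((ω : ℂ) ^ 2) • (Λ ∘ₗ B)
  have hJ : Function.Injective J := hΛ.comp Subtype.coe_injective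
  have hL : ∀ v, L v ∈ LinearMap.range J := fun v =>
    ⟨⟨polyLap d (bubblePoly c r * v.1), polyLap_bubblePoly_mul_mem v.2⟩, rfl⟩
  have hLi : Function.Injective L := by
    refine (injective_iff_map_eq_zero _).2 fun v hv => ?_
    have h1 : polyLap d (bubblePoly c r * v.1) = 0 := hΛ (hv.trans (map_zero _).symm)
    have h2 := hM v.1 v.2
    rw [h1, ← hΛn, ← hΛn, map_zero] at h2
    have h3 : Λ (bubblePoly c r * v.1) = 0 := by simpa using h2
    have h4 : bubblePoly c r * v.1 = 0 := hΛ (h3.trans (map_zero _).symm)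
    exact Subtype.ext ((mul_eq_zero.1 h4).resolve_left (bubblePoly_ne_zero c hr))
  have hW : ∀ v, ‖W v‖ ≤ 1 / 2 * ‖L v‖ := by
    intro v
    refine norm_le_of_enorm_sq_le (by norm_num) ?_
    have e1 : ‖W v‖ₑ ^ 2 = ENNReal.ofReal (ω ^ 4) * volSq K (polyFun (bubblePoly c r * v.1)) := by
      have : W v = ((ω : ℂ) ^ 2) • Λ (bubblePoly c r * v.1) := rfl
      rw [this, enorm_smul, mul_pow, hΛn, enorm_sq_eq, norm_pow, Complex.norm_real,
        Real.norm_eq_abs, sq_abs, ← pow_mul]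
    have e2 : ‖L v‖ₑ ^ 2 = volSq K (polyFun (polyLap d (bubblePoly c r * v.1))) := hΛn _
    rw [e1, e2]
    calc _ ≤ ENNReal.ofReal (ω ^ 4) * (ENNReal.ofReal (M * r ^ 4) *
          volSq K (polyFun (polyLap d (bubblePoly c r * v.1)))) := by gcongr; exact hM v.1 v.2
      _ = ENNReal.ofReal (ω ^ 4 * (M * r ^ 4)) *
          volSq K (polyFun (polyLap d (bubblePoly c r * v.1))) := by
          rw [← mul_assoc, ← ENNReal.ofReal_mul (by positivity)]
      _ ≤ _ := by
          gcongr
          exact hsmall.trans (by norm_num)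
  obtain ⟨v, hv, hvn⟩ := exists_variational_solution J L W hJ hL hLi hW (((ω : ℂ) ^ 2) • Λ A)
  refine ⟨v.1, v.2, fun q' hq' => ?_, ?_⟩
  · have h1 := hv (Λ q') ⟨⟨q', hq'⟩, rfl⟩
    have e1 : L v + W v - ((ω : ℂ) ^ 2) • Λ A = Λ (polyLap d (bubblePoly c r * v.1)
        + ((ω : ℂ) ^ 2) • (bubblePoly c r * v.1) - ((ω : ℂ) ^ 2) • A) := by
      simp only [map_sub, map_add, map_smul]
      rfl
    rw [e1, L2.inner_def] at h1
    rw [← h1]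
    refine integral_congr_ae ?_
    have hc : ∀ q, Λ q =ᵐ[volume.restrict K] polyFun q := fun q =>
      MemLp.coeFn_toLp (memLp_of_continuous h.isOpen.measurableSet h.bounded (continuous_polyFun q))
    filter_upwards [hc q', hc (polyLap d (bubblePoly c r * v.1)
        + ((ω : ℂ) ^ 2) • (bubblePoly c r * v.1) - ((ω : ℂ) ^ 2) • A)] with x hx1 hx2
    rw [hx1, hx2, RCLike.inner_apply]
    simp [polyFun]
  · have e2 : ‖L v‖ₑ ^ 2 = volSq K (polyFun (polyLap d (bubblePoly c r * v.1))) := hΛn _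
    rw [← e2, ← hΛn A, enorm_sq_eq, enorm_sq_eq, ← ENNReal.ofReal_mul (by positivity)]
    refine ENNReal.ofReal_le_ofReal ?_
    calc ‖L v‖ ^ 2 ≤ (2 * ‖((ω : ℂ) ^ 2) • Λ A‖) ^ 2 := by gcongr
      _ = _ := by
        rw [norm_smul, norm_pow, Complex.norm_real, Real.norm_eq_abs, sq_abs]; ring

/-- Piecewise affine approximation in `H²`. -/
theorem exists_affine_approx (h : IsStarBall K c r ρ) {z : E d → ℂ} {z₁ : Fin d → E d → ℂ}
    {z₂ : Fin d → Fin d → E d → ℂ} (hz : IsH1 K z z₁) (hz₁ : ∀ i, IsH1 K (z₁ i) (z₂ i)) :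
    ∃ A ∈ polySpace d 1, (∀ i j, pderiv j (pderiv i A) = 0) ∧
      volSq K (fun x => z x - polyFun A x) ≤
        ENNReal.ofReal ((poinConst d ρ * r ^ 2) ^ 2) * ∑ i, ∑ j, volSq K (z₂ i j) ∧
      ∑ i, volSq K (fun x => z₁ i x - polyFun (pderiv i A) x) ≤
        ENNReal.ofReal (poinConst d ρ * r ^ 2) * ∑ i, ∑ j, volSq K (z₂ i j) := by
  have hP : 0 ≤ poinConst d ρ * r ^ 2 := by
    have := h.rho_nonneg
    unfold poinConst
    positivity
  -- The Poincaré constants of the first derivatives are the slopes. A second application, to `z`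
  -- minus this linear function, gives the constant term and another factor `r²`.
  choose g hg using fun i => h.exists_const_volSq_sub_le (hz₁ i)
  set A₀ : Poly d := ∑ i, C (g i) * X i with hA₀
  have hp₀ : ∀ i, pderiv i A₀ = C (g i) := by
    intro i
    rw [hA₀, map_sum, Finset.sum_eq_single i]
    · simp
    · intro j _ hj
      simp [pderiv_X_of_ne hj]
    · simp
  have hsub := hz.sub (isH1_of_eqOn_poly h.isOpen h.bounded (W := A₀) (u := polyFun A₀) fun _ _ => rfl)
  obtain ⟨m, hm⟩ := h.exists_const_volSq_sub_le hsub
  have hp : ∀ i, pderiv i (A₀ + C m) = C (g i) := fun i => by rw [map_add, hp₀, pderiv_C, add_zero]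
  have hgrad : ∑ i, volSq K (fun x => z₁ i x - g i) ≤
      ENNReal.ofReal (poinConst d ρ * r ^ 2) * ∑ i, ∑ j, volSq K (z₂ i j) := by
    rw [Finset.mul_sum]
    exact Finset.sum_le_sum fun i _ => hg i
  have eC : ∀ (a : ℂ) (x : E d), polyFun (C a) x = a := fun a x => by simp [polyFun]
  refine ⟨A₀ + C m, ?_, fun i j => by rw [hp, pderiv_C], ?_, ?_⟩
  · rw [mem_restrictTotalDegree]
    refine (totalDegree_add _ _).trans (max_le (totalDegree_finsetSum_le fun i _ => ?_) (by simp))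
    refine (totalDegree_mul _ _).trans (by simp)
  · have e : (fun x => z x - polyFun (A₀ + C m) x) = fun x => z x - polyFun A₀ x - m := by
      ext x
      simp only [polyFun_add, eC]; ring
    rw [e, pow_two, ENNReal.ofReal_mul hP, mul_assoc]
    refine hm.trans (mul_le_mul' le_rfl ?_)
    simp only [hp₀, eC]
    exact hgrad
  · simp only [hp, eC]
    exact hgrad

end IsStarBall

theorem poinConst_nonneg {ρ : ℝ} (hρ : 0 ≤ ρ) : 0 ≤ poinConst d ρ := by
  unfold poinConst; positivity

namespace IsStarBall

variable {K : Set (E d)} {c : E d} {r ρ : ℝ}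

/-- Bounds of the local error in terms of the second derivatives and of the Laplacian of the bubble. -/
theorem local_error (h : IsStarBall K c r ρ) {z zh : E d → ℂ} {z₁ : Fin d → E d → ℂ}
    {z₂ : Fin d → Fin d → E d → ℂ} (hz : IsH1 K z z₁) (hz₁ : ∀ i, IsH1 K (z₁ i) (z₂ i))
    {A W : Poly d} (hzh : ∀ x ∈ K, zh x = polyFun (A - W) x) {P M : ℝ} (hP : 0 ≤ P) (hM : 0 ≤ M)
    {X : ℝ≥0∞} (hA₂ : ∀ i j, pderiv j (pderiv i A) = 0)
    (hA₀ : volSq K (fun x => z x - polyFun A x) ≤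
      ENNReal.ofReal ((P * r ^ 2) ^ 2) * ∑ i, ∑ j, volSq K (z₂ i j))
    (hA₁ : ∑ i, volSq K (fun x => z₁ i x - polyFun (pderiv i A) x) ≤
      ENNReal.ofReal (P * r ^ 2) * ∑ i, ∑ j, volSq K (z₂ i j))
    (hW₀ : volSq K (polyFun W) ≤ ENNReal.ofReal (M * r ^ 4) * X)
    (hW₁ : ∑ i, volSq K (polyFun (pderiv i W)) ≤ ENNReal.ofReal (M * r ^ 2) * X)
    (hW₂ : ∑ i, ∑ j, volSq K (polyFun (pderiv j (pderiv i W))) ≤ ENNReal.ofReal M * X) :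
    LinBound (volSq K fun x => z x - zh x) (2 * (P * r ^ 2) ^ 2) (∑ i, ∑ j, volSq K (z₂ i j))
      (2 * (M * r ^ 4)) X ∧
    LinBound (gradSq K fun x => z x - zh x) (2 * (P * r ^ 2)) (∑ i, ∑ j, volSq K (z₂ i j))
      (2 * (M * r ^ 2)) X ∧
    LinBound (∑ i, gradSq K (weakDeriv K i fun x => z x - zh x)) 2 (∑ i, ∑ j, volSq K (z₂ i j))
      (2 * M) X := by
  set H := ∑ i, ∑ j, volSq K (z₂ i j) with hH
  have hKm := h.isOpen.measurableSet
  have hc : ∀ q : Poly d, AEStronglyMeasurable (polyFun q) (volume.restrict K) := fun q =>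
    (continuous_polyFun q).aestronglyMeasurable
  have hsplit : ∀ (f : E d → ℂ) (a w : Poly d), AEStronglyMeasurable f (volume.restrict K) →
      volSq K (fun x => f x - polyFun (a - w) x) ≤
        2 * volSq K (fun x => f x - polyFun a x) + 2 * volSq K (polyFun w) := by
    intro f a w hf
    have e : (fun x => f x - polyFun (a - w) x) = fun x => (f x - polyFun a x) + polyFun w x := by
      ext x; simp [polyFun]; ring
    rw [e]
    exact sqNorm_add_le (hf.sub (hc a))
  have hcomb : ∀ {S : ℝ≥0∞} {s t : ℝ≥0∞} {a b : ℝ}, 0 ≤ a → 0 ≤ b → S ≤ 2 * s + 2 * t →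
      s ≤ ENNReal.ofReal a * H → t ≤ ENNReal.ofReal b * X → LinBound S (2 * a) H (2 * b) X := by
    intro S s t a b ha hb hS hs ht
    refine ⟨by positivity, by positivity, hS.trans ?_⟩
    rw [ENNReal.ofReal_mul (p := 2) (by norm_num), ENNReal.ofReal_mul (p := 2) (by norm_num),
      ENNReal.ofReal_ofNat, mul_assoc, mul_assoc]
    gcongr
  have he := hz.sub (isH1_of_eqOn_poly h.isOpen h.bounded hzh)
  have he₁ : ∀ i, IsH1 K (weakDeriv K i fun x => z x - zh x)
      fun j x => z₂ i j x - polyFun (pderiv j (pderiv i (A - W))) x := fun i =>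
    ((hz₁ i).sub (isH1_of_eqOn_poly h.isOpen h.bounded
      (u := polyFun (pderiv i (A - W))) fun _ _ => rfl)).congr
        (he.weakDeriv_ae_eq h.isOpen i).symm fun _ => by rfl
  refine ⟨?_, ?_, ?_⟩
  · refine hcomb (by positivity) (by positivity) ?_ hA₀ hW₀
    refine le_trans (le_of_eq (sqNorm_congr ?_)) (hsplit z A W hz.memLp.1)
    filter_upwards [self_mem_ae_restrict hKm] with x hx
    rw [hzh x hx]
  · refine hcomb (by positivity) (by positivity) ?_ hA₁ hW₁
    rw [he.gradSq_eq h.isOpen, Finset.mul_sum, Finset.mul_sum, ← Finset.sum_add_distrib]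
    refine Finset.sum_le_sum fun i _ => ?_
    rw [map_sub]
    exact hsplit _ _ _ (hz.memLp_grad i).1
  · have := hcomb (S := ∑ i, gradSq K (weakDeriv K i fun x => z x - zh x)) (s := H)
      (t := ∑ i, ∑ j, volSq K (polyFun (pderiv j (pderiv i W)))) zero_le_one hM ?_ (by simp) hW₂
    · rwa [mul_one] at this
    · rw [hH, Finset.mul_sum, Finset.mul_sum, ← Finset.sum_add_distrib]
      refine Finset.sum_le_sum fun i _ => ?_
      rw [(he₁ i).gradSq_eq h.isOpen, Finset.mul_sum, Finset.mul_sum, ← Finset.sum_add_distrib]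
      refine Finset.sum_le_sum fun j _ => ?_
      refine (le_of_eq ?_).trans ((hsplit (z₂ i j) 0 (pderiv j (pderiv i W))
        ((hz₁ i).memLp_grad j).1).trans (le_of_eq ?_))
      · rw [map_sub, map_sub, hA₂]
      · simp [polyFun]

end IsStarBall

theorem rpow_half_le {S H V : ℝ≥0∞} {a b : ℝ} (ha : 0 ≤ a) (hb : 0 ≤ b)
    (h : S ≤ ENNReal.ofReal (a ^ 2) * H + ENNReal.ofReal (b ^ 2) * V) :
    S ^ (1 / 2 : ℝ) ≤ ENNReal.ofReal a * H ^ (1 / 2 : ℝ) + ENNReal.ofReal b * V ^ (1 / 2 : ℝ) := by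
  have e : ∀ {t : ℝ} (_ : 0 ≤ t) (Y : ℝ≥0∞),
      (ENNReal.ofReal (t ^ 2) * Y) ^ (1 / 2 : ℝ) = ENNReal.ofReal t * Y ^ (1 / 2 : ℝ) := by
    intro t ht Y
    rw [ENNReal.mul_rpow_of_nonneg _ _ (by norm_num), ENNReal.ofReal_pow ht, ← ENNReal.rpow_natCast,
      ← ENNReal.rpow_mul]
    norm_num
  calc _ ≤ (ENNReal.ofReal (a ^ 2) * H + ENNReal.ofReal (b ^ 2) * V) ^ (1 / 2 : ℝ) := by gcongr
    _ ≤ _ := ENNReal.rpow_add_le_add_rpow _ _ (by norm_num) (by norm_num)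
    _ = _ := by rw [e ha, e hb]

/-! ### Approximation by Trefftz functions on the mesh. -/

section Mesh

variable {Ω : Set (E d)} {T : Mesh Ω} {σ : ShapeParams}

theorem Mesh.sum_volSq_le (f : E d → ℂ) : ∑ K ∈ T.elems, volSq K f ≤ volSq Ω f := by
  simp_rw [volSq_eq]
  rw [← lintegral_biUnion_finset (fun K hK K' hK' hne => T.disjoint K hK K' hK' hne)
    fun K hK => (T.lipschitz K hK).1.measurableSet]
  exact lintegral_mono_set (iUnion₂_subset T.subset)

theorem Mesh.sum_indicator_eq (f : Set (E d) → E d → ℂ) {K : Set (E d)} (hK : K ∈ T.elems) {x : E d}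
    (hx : x ∈ K) : ∑ K' ∈ T.elems, K'.indicator (f K') x = f K x := by
  rw [Finset.sum_eq_single_of_mem K hK fun K' hK' hne => ?_, indicator_of_mem hx]
  exact indicator_of_notMem (fun hx' => (T.disjoint K' hK' K hK hne).le_bot ⟨hx', hx⟩) _

/-- The constant in `dgC ≤ dgC₁ p²`. -/
noncomputable def dgC₁ (d : ℕ) (σ : ShapeParams) (CΩ : ℝ) : ℝ :=
  1 + CΩ ^ 2 + trC d σ * (2 * (2 * σ.gam + 1) ^ d + CΩ)

theorem dgC_le {CΩ : ℝ} (hC : 0 < CΩ) {p : ℕ} (hp : 1 ≤ p) :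
    dgC d σ CΩ p ≤ dgC₁ d σ CΩ * p ^ 2 := by
  have hτ := trC_nonneg (d := d) (σ := σ)
  have hg := σ.gam_pos
  have hp1 : (1 : ℝ) ≤ (p : ℝ) ^ 2 := one_le_pow₀ (by exact_mod_cast hp)
  have h1 : 0 ≤ (1 + CΩ ^ 2 + trC d σ * CΩ) * ((p : ℝ) ^ 2 - 1) :=
    mul_nonneg (by positivity) (by linarith)
  unfold dgC dgC₁
  linarith

/-- The constants of the approximation estimate. -/
noncomputable def apxC (d : ℕ) (σ : ShapeParams) (CΩ : ℝ) : ℝ :=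
  dgC₁ d σ CΩ * (2 * poinConst d (2 * σ.gam) + 2 * poinConst d (2 * σ.gam) ^ 2)
    + 2 * trC d σ * (poinConst d (2 * σ.gam) + 1)

noncomputable def bubC (d : ℕ) (σ : ShapeParams) (CΩ : ℝ) : ℝ := 4 * (dgC₁ d σ CΩ + trC d σ)

theorem dgC₁_nonneg {CΩ : ℝ} (hC : 0 < CΩ) : 0 ≤ dgC₁ d σ CΩ := by
  have hτ := trC_nonneg (d := d) (σ := σ)
  have hg := σ.gam_pos
  unfold dgC₁
  positivity

theorem bubC_nonneg {CΩ : ℝ} (hC : 0 < CΩ) : 0 ≤ bubC d σ CΩ := by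
  have hτ := trC_nonneg (d := d) (σ := σ)
  have := dgC₁_nonneg (d := d) (σ := σ) hC
  unfold bubC
  positivity

theorem apxC_nonneg {CΩ : ℝ} (hC : 0 < CΩ) : 0 ≤ apxC d σ CΩ := by
  have hτ := trC_nonneg (d := d) (σ := σ)
  have := dgC₁_nonneg (d := d) (σ := σ) hC
  have hP : 0 ≤ poinConst d (2 * σ.gam) := poinConst_nonneg (by linarith [σ.gam_pos])
  unfold apxC
  positivity

/-- The affine part has no Laplacian, so the corrector only has to remove `ω² v`, and `‖Δw‖² ≤ 4 ω⁴
‖v‖²` on each element. Bounding `v` by `z` and `z - v` yields the `ω⁴ ‖z‖²` term and a further `H²`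
contribution. The dependence on `p` is explicit except through `M`, which prepares for its
absorption in `cA0⁻¹`. -/
theorem Mesh.A1.exists_trefftz (hA1 : T.A1 σ) (hd : 1 ≤ d) {ω CΩ : ℝ} (hω : 0 < ω) (hC : 0 < CΩ)
    (hA0 : T.A0 ω CΩ) {p : ℕ} (hp : 1 ≤ p) {M : ℝ≥0}
    (hM : ∀ (K : Set (E d)) (c : E d) (r : ℝ), IsStarBall K c r (2 * σ.gam) → ∀ q ∈ testSpace d p,
      volSq K (polyFun (bubblePoly c r * q)) ≤
        M * ENNReal.ofReal (r ^ 4) * volSq K (polyFun (polyLap d (bubblePoly c r * q))) ∧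
      ∑ i, volSq K (polyFun (pderiv i (bubblePoly c r * q))) ≤
        M * ENNReal.ofReal (r ^ 2) * volSq K (polyFun (polyLap d (bubblePoly c r * q))) ∧
      ∑ i, ∑ j, volSq K (polyFun (pderiv j (pderiv i (bubblePoly c r * q)))) ≤
        M * volSq K (polyFun (polyLap d (bubblePoly c r * q))))
    (hsmall : ∀ K ∈ T.elems, ω ^ 4 * (M * T.rad K ^ 4) ≤ 1 / 4) {z : E d → ℂ} (hz : MemH2 Ω z) :
    ∃ v w : E d → ℂ, T.IsPiecewisePoly 1 v ∧ T.IsBubble p w ∧ T.IsTrefftz ω p (fun x => v x - w x) ∧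
      T.dgSq ω p (fun x => z x - (v x - w x)) + ∑ K ∈ T.elems, ENNReal.ofReal (T.h / (p : ℝ) ^ 2) *
          surfSq (frontier K) (normalTrace K fun x => z x - (v x - w x)) ≤
        ENNReal.ofReal (T.h ^ 2 * (p ^ 2 * (apxC d σ CΩ +
          8 * M * bubC d σ CΩ * poinConst d (2 * σ.gam) ^ 2 * CΩ ^ 4))) *
            ∑ i, ∑ j, volSq Ω (weakDeriv Ω j (weakDeriv Ω i z)) +
        ENNReal.ofReal (T.h ^ 2 * (8 * p ^ 2 * M * bubC d σ CΩ * ω ^ 4)) * volSq Ω z := by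
  set P := poinConst d (2 * σ.gam) with hP
  have hP0 : 0 ≤ P := poinConst_nonneg (by linarith [σ.gam_pos])
  have hτ := trC_nonneg (d := d) (σ := σ)
  have hzK : ∀ K ∈ T.elems, IsH1 K z fun i => weakDeriv Ω i z := fun K hK =>
    hz.1.isH1.mono (T.subset K hK)
  have hzK₁ : ∀ K ∈ T.elems, ∀ i, IsH1 K (weakDeriv Ω i z) fun j => weakDeriv Ω j (weakDeriv Ω i z) :=
    fun K hK i => (hz.2 i).isH1.mono (T.subset K hK)
  have hexA : ∀ K, ∃ A : Poly d, K ∈ T.elems → A ∈ polySpace d 1 ∧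
      (∀ i j, pderiv j (pderiv i A) = 0) ∧ volSq K (fun x => z x - polyFun A x) ≤
        ENNReal.ofReal ((P * T.rad K ^ 2) ^ 2) *
          ∑ i, ∑ j, volSq K (weakDeriv Ω j (weakDeriv Ω i z)) ∧
      ∑ i, volSq K (fun x => weakDeriv Ω i z x - polyFun (pderiv i A) x) ≤
        ENNReal.ofReal (P * T.rad K ^ 2) *
          ∑ i, ∑ j, volSq K (weakDeriv Ω j (weakDeriv Ω i z)) := by
    intro K
    by_cases hK : K ∈ T.elems
    · obtain ⟨A, hA⟩ := (hA1.isStarBall hK).exists_affine_approx (hzK K hK) (hzK₁ K hK)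
      exact ⟨A, fun _ => hA⟩
    · exact ⟨0, fun h => absurd h hK⟩
  choose A hA using hexA
  have hexq : ∀ K, ∃ q : Poly d, K ∈ T.elems → q ∈ testSpace d p ∧ (∀ q' ∈ testSpace d p,
      ∫ x in K, (polyFun (polyLap d (bubblePoly (T.ctr K) (T.rad K) * q)) x
        + (ω : ℂ) ^ 2 * polyFun (bubblePoly (T.ctr K) (T.rad K) * q) x
        - (ω : ℂ) ^ 2 * polyFun (A K) x) * (starRingEnd ℂ) (polyFun q' x) = 0) ∧
      volSq K (polyFun (polyLap d (bubblePoly (T.ctr K) (T.rad K) * q))) ≤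
        ENNReal.ofReal (4 * ω ^ 4) * volSq K (polyFun (A K)) := by
    intro K
    by_cases hK : K ∈ T.elems
    · have hs := hA1.isStarBall hK
      have hr := hs.pos
      obtain ⟨q, hq, hq1, hq2⟩ := hs.exists_local_bubble (p := p) (M := M) (ω := ω)
        (fun q hq => by
          rw [ENNReal.ofReal_mul (by positivity), ENNReal.ofReal_coe_nnreal]
          exact (hM K _ _ hs q hq).1) (hsmall K hK) (A K)
      exact ⟨q, fun _ => ⟨hq, hq1, hq2⟩⟩
    · exact ⟨0, fun h => absurd h hK⟩
  choose q hq using hexq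
  set W : Set (E d) → Poly d := fun K => bubblePoly (T.ctr K) (T.rad K) * q K with hW
  set v : E d → ℂ := fun x => ∑ K ∈ T.elems, K.indicator (polyFun (A K)) x with hv
  set w : E d → ℂ := fun x => ∑ K ∈ T.elems, K.indicator (polyFun (W K)) x with hw
  have hvK : ∀ K ∈ T.elems, ∀ x ∈ K, v x = polyFun (A K) x := fun K hK x hx =>
    Mesh.sum_indicator_eq (fun K => polyFun (A K)) hK hx
  have hwK : ∀ K ∈ T.elems, ∀ x ∈ K, w x = polyFun (W K) x := fun K hK x hx =>
    Mesh.sum_indicator_eq (fun K => polyFun (W K)) hK hx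
  have hzh : ∀ K ∈ T.elems, ∀ x ∈ K, v x - w x = polyFun (A K - W K) x := fun K hK x hx => by
    rw [hvK K hK x hx, hwK K hK x hx]; simp [polyFun]
  refine ⟨v, w, fun K hK => ⟨A K, (hA K hK).1, hvK K hK⟩, fun K hK => ⟨q K, (hq K hK).1, fun x hx => ?_⟩,
    ⟨fun K hK => ⟨A K - W K, Submodule.sub_mem _ ?_ (bubblePoly_mul_mem (hq K hK).1), hzh K hK⟩,
      fun K hK q' hq' => ?_⟩, ?_⟩
  · rw [hwK K hK x hx]; simp only [hW, polyFun_mul, polyFun_bubblePoly]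
  · have := (hA K hK).1
    rw [mem_restrictTotalDegree] at this ⊢
    exact this.trans hp
  · have hs := hA1.isStarBall hK
    unfold localOp
    refine mul_eq_zero_of_right _ ?_
    rw [← (hq K hK).2.1 q' hq']
    refine integral_congr_ae ?_
    have hlap : polyLap d (A K - W K) = -polyLap d (W K) := by
      have : polyLap d (A K) = 0 := by
        rw [polyLap_apply]
        exact Finset.sum_eq_zero fun i _ => (hA K hK).2.1 i i
      rw [map_sub, this, zero_sub]
    filter_upwards [weakLaplacian_ae_eq hs.isOpen hs.bounded (hzh K hK),
      self_mem_ae_restrict hs.isOpen.measurableSet] with x hx hxK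
    rw [hx, hzh K hK x hxK, hlap]
    congr 1
    simp [polyFun, hW]
    ring
  set e : E d → ℂ := fun x => z x - (v x - w x) with he
  refine (add_le_add (Mesh.dgSq_le hA1 hd hω hA0 p e)
    (Finset.sum_le_sum fun K hK => Mesh.normalTrace_le hA1 hd hp hK e)).trans ?_
  rw [← Finset.sum_add_distrib]
  set HK : Set (E d) → ℝ≥0∞ := fun K => ∑ i, ∑ j, volSq K (weakDeriv Ω j (weakDeriv Ω i z)) with hHK
  have hlocal : ∀ K ∈ T.elems, (ENNReal.ofReal (dgC d σ CΩ p) * gradSq K e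
      + ENNReal.ofReal (dgC d σ CΩ p * (T.rad K)⁻¹ ^ 2) * volSq K e) +
      (ENNReal.ofReal (T.h * (trC d σ * (T.rad K)⁻¹)) * gradSq K e +
      ENNReal.ofReal (T.h * (trC d σ * T.rad K)) * ∑ i, gradSq K (weakDeriv K i e)) ≤
      ENNReal.ofReal (T.h ^ 2 * (p ^ 2 * (apxC d σ CΩ + 8 * M * bubC d σ CΩ * P ^ 2 * CΩ ^ 4))) * HK K
        + ENNReal.ofReal (T.h ^ 2 * (8 * p ^ 2 * M * bubC d σ CΩ * ω ^ 4)) * volSq K z := by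
    intro K hK
    have hs := hA1.isStarBall hK
    have hr := hs.pos
    have hh := hA1.h_pos hd hK
    have hrh := hA1.two_mul_rad_le hd hK
    obtain ⟨-, hA₂, hA₀, hA₁⟩ := hA K hK
    obtain ⟨hqt, -, hX⟩ := hq K hK
    obtain ⟨hM0, hM1, hM2⟩ := hM K _ _ hs (q K) hqt
    change volSq K (polyFun (polyLap d (W K))) ≤ _ at hX
    set X := volSq K (polyFun (polyLap d (W K))) with hXdef
    rw [← ENNReal.ofReal_coe_nnreal, ← ENNReal.ofReal_mul (by positivity)] at hM0 hM1
    rw [← ENNReal.ofReal_coe_nnreal] at hM2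
    obtain ⟨l0, l1, l2⟩ := hs.local_error (hzK K hK) (hzK₁ K hK) (hzh K hK) hP0 M.coe_nonneg hA₂
      hA₀ hA₁ hM0 hM1 hM2
    set r := T.rad K with hrdef
    have hdg := dgC_pos (d := d) (σ := σ) hC p
    have hdgle := dgC_le (d := d) (σ := σ) hC hp
    have hD1 := dgC₁_nonneg (d := d) (σ := σ) hC
    have hb0 := bubC_nonneg (d := d) (σ := σ) hC
    have ha0 := apxC_nonneg (d := d) (σ := σ) hC
    have hp1 : (1 : ℝ) ≤ (p : ℝ) ^ 2 := one_le_pow₀ (by exact_mod_cast hp)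
    have hrh' : r ≤ T.h := by linarith
    have hr2 : r ^ 2 ≤ T.h ^ 2 := by gcongr
    have hrT : r * T.h ≤ T.h ^ 2 := by rw [pow_two]; gcongr
    have key := (((l1.smul hdg.le).add (l0.smul (by positivity :
      0 ≤ dgC d σ CΩ p * r⁻¹ ^ 2))).add ((l1.smul (by positivity : 0 ≤ T.h * (trC d σ * r⁻¹))).add
        (l2.smul (by positivity : 0 ≤ T.h * (trC d σ * r)))))
    have key2 := key.mono (a' := T.h ^ 2 * (p ^ 2 * apxC d σ CΩ))
      (b' := T.h ^ 2 * (p ^ 2 * M * bubC d σ CΩ))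
      (by
        calc _ = dgC d σ CΩ p * (2 * P + 2 * P ^ 2) * r ^ 2
              + trC d σ * (2 * P + 2) * (r * T.h) := by field_simp
          _ ≤ (dgC₁ d σ CΩ * p ^ 2) * (2 * P + 2 * P ^ 2) * T.h ^ 2
              + (trC d σ * p ^ 2) * (2 * P + 2) * T.h ^ 2 := by
              gcongr
              exact le_mul_of_one_le_right hτ hp1
          _ = _ := by rw [apxC]; ring)
      (by
        calc _ = dgC d σ CΩ p * (4 * M) * r ^ 2 + trC d σ * (4 * M) * (r * T.h) := by
              field_simp; ring
          _ ≤ (dgC₁ d σ CΩ * p ^ 2) * (4 * M) * T.h ^ 2 + (trC d σ * p ^ 2) * (4 * M) * T.h ^ 2 := by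
              gcongr
              exact le_mul_of_one_le_right hτ hp1
          _ = _ := by rw [bubC]; ring)
    have hAz : volSq K (polyFun (A K)) ≤ 2 * volSq K z +
        2 * (ENNReal.ofReal ((P * r ^ 2) ^ 2) * HK K) := by
      refine (sqNorm_le_add (hzK K hK).memLp.1).trans ?_
      exact add_le_add le_rfl (mul_le_mul' le_rfl hA₀)
    have hX2 : LinBound X (8 * ω ^ 4 * (P * r ^ 2) ^ 2) (HK K) (8 * ω ^ 4) (volSq K z) := by
      refine ⟨by positivity, by positivity, hX.trans ((mul_le_mul' le_rfl hAz).trans (le_of_eq ?_))⟩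
      have e8 : (8 : ℝ) * ω ^ 4 = 4 * ω ^ 4 * 2 := by ring
      rw [e8, ENNReal.ofReal_mul (p := 4 * ω ^ 4 * 2) (by positivity),
        ENNReal.ofReal_mul (p := 4 * ω ^ 4) (by positivity), ENNReal.ofReal_ofNat]
      ring
    -- The `H²` contribution of the corrector carries `ω⁴ r⁴`, which (A0) replaces by a constant
    -- independent of `ω`.
    have hωr : (ω * r) ^ 4 ≤ CΩ ^ 4 := by
      have hA0' := hA0
      unfold Mesh.A0 at hA0'
      have : ω * r ≤ CΩ := by nlinarith [sq_nonneg (ω - 1), mul_pos hω hh]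
      gcongr
    refine key2.le.trans ?_
    have hX3 := (hX2.smul (by positivity : 0 ≤ T.h ^ 2 * (p ^ 2 * M * bubC d σ CΩ)))
    have hX4 := ((LinBound.left (HK K) (volSq K z)).smul
      (by positivity : 0 ≤ T.h ^ 2 * (p ^ 2 * apxC d σ CΩ))).add hX3
    refine (hX4.mono ?_ ?_).le
    · calc _ = T.h ^ 2 * (p ^ 2 * (apxC d σ CΩ + 8 * M * bubC d σ CΩ * P ^ 2 * (ω * r) ^ 4)) := by ring
        _ ≤ _ := by gcongr
    · exact le_of_eq (by ring)
  refine (Finset.sum_le_sum hlocal).trans ?_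
  rw [Finset.sum_add_distrib, ← Finset.mul_sum, ← Finset.mul_sum]
  gcongr
  · rw [hHK, Finset.sum_comm]
    refine Finset.sum_le_sum fun i _ => ?_
    rw [Finset.sum_comm]
    exact Finset.sum_le_sum fun j _ => Mesh.sum_volSq_le _
  · exact Mesh.sum_volSq_le z

end Mesh

/-! ### Bookkeeping of the constants. -/

/-- Here `lam` stands for `cA0⁻¹`: one number that dominates the degree, the bubble constant and the
mesh constant at once. -/
theorem param_bounds {p M b lam : ℝ} (hp : 1 ≤ p) (hM : 0 ≤ M) (hb : 0 ≤ b)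
    (h : 2 * p * (1 + M) * (1 + b) ≤ lam) :
    4 * (p ^ 2 * M * b) ≤ lam ^ 2 ∧ p ^ 2 ≤ lam ^ 2 ∧ M ≤ lam ^ 2 := by
  have hp0 : 0 ≤ p := by linarith
  have hpb : 1 * 1 ≤ p * (1 + b) := mul_le_mul hp (by linarith) zero_le_one hp0
  have hMb : 1 * 1 ≤ (1 + M) * (1 + b) := mul_le_mul (by linarith) (by linarith) zero_le_one (by linarith)
  have h1 : p ≤ lam := by
    refine le_trans ?_ h
    calc p ≤ 2 * p * (1 * 1) := by linarith
      _ ≤ 2 * p * ((1 + M) * (1 + b)) := by gcongr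
      _ = _ := by ring
  have h2 : 1 + M ≤ lam := by
    refine le_trans ?_ h
    calc 1 + M ≤ 2 * (1 + M) * (1 * 1) := by linarith
      _ ≤ 2 * (1 + M) * (p * (1 + b)) := by gcongr
      _ = _ := by ring
  refine ⟨?_, by gcongr, ?_⟩
  · calc 4 * (p ^ 2 * M * b) ≤ 4 * (p ^ 2 * (1 + M) ^ 2 * (1 + b) ^ 2) := by
          gcongr <;> nlinarith
      _ = (2 * p * (1 + M) * (1 + b)) ^ 2 := by ring
      _ ≤ lam ^ 2 := by gcongr
  · nlinarith

/-- (A0) gives `ω² r² ≤ C h`, and the smallness of `C h lam²` then bounds `ω² r² lam²`; its square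
dominates the left side, since `M ≤ lam² ≤ lam⁴`. -/
theorem small_of_le {C ω h r M lam : ℝ} (hC : (1 + ω ^ 2) * h ≤ C) (hh : 0 ≤ h) (hr : 0 ≤ r)
    (hrh : 2 * r ≤ h) (hX : C * h * (4 * lam ^ 2) ≤ 1) (hM : M ≤ lam ^ 2)
    (hl : 1 ≤ lam ^ 2) : ω ^ 4 * (M * r ^ 4) ≤ 1 / 4 := by
  have h1 : ω ^ 2 * r ^ 2 ≤ C * h := by
    calc ω ^ 2 * r ^ 2 ≤ ω ^ 2 * h ^ 2 := by gcongr; linarith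
      _ = (ω ^ 2 * h) * h := by ring
      _ ≤ C * h := by gcongr; linarith
  have h2 : ω ^ 2 * r ^ 2 * (4 * lam ^ 2) ≤ 1 :=
    (mul_le_mul_of_nonneg_right h1 (by positivity)).trans hX
  have h3 : (ω ^ 2 * r ^ 2 * (4 * lam ^ 2)) ^ 2 ≤ 1 := pow_le_one₀ (by positivity) h2
  have h4 : M ≤ lam ^ 4 := hM.trans (by nlinarith)
  calc ω ^ 4 * (M * r ^ 4) ≤ ω ^ 4 * (lam ^ 4 * r ^ 4) := by gcongr
    _ = (ω ^ 2 * r ^ 2 * (4 * lam ^ 2)) ^ 2 / 16 := by ring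
    _ ≤ 1 / 4 := by linarith

/-- The subtracted term is nonnegative and less than 1, so `C₂ ≤ 1`; dropping `√Cpf ≥ 1` from it and
squaring gives the first bound. -/
theorem smallness_bounds {Cpf c C h C₂ : ℝ} (hCpf : 1 ≤ Cpf) (hc : 0 < c) (hCh : 0 ≤ C * h)
    (hC₂ : 0 < C₂) (hsm : 1 - 2 * √Cpf / c * √(C * h) ≥ C₂) :
    C * h * (4 * c⁻¹ ^ 2) ≤ 1 ∧ 1 ≤ C₂⁻¹ := by
  have hsq1 : 1 ≤ √Cpf := Real.one_le_sqrt.2 hCpf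
  have h0 : 0 ≤ 2 * √Cpf / c * √(C * h) := by positivity
  refine ⟨?_, (one_le_inv₀ hC₂).2 (by linarith)⟩
  have h2 : 2 * c⁻¹ * √(C * h) ≤ 1 := by
    refine le_trans ?_ (by linarith : 2 * √Cpf / c * √(C * h) ≤ 1)
    rw [div_eq_mul_inv]
    gcongr
    linarith
  have h3 : (2 * c⁻¹ * √(C * h)) ^ 2 ≤ 1 := pow_le_one₀ (by positivity) h2
  rw [mul_pow, Real.sq_sqrt hCh] at h3
  linarith

/-- Everything that depends on `p` is at most `lam²`, and `lam` is absorbed by the summand `s C²` of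
the prescribed constant. Dividing the square root by `C²` compensates, so the remaining factor is
independent of `p` and `M`. -/
theorem h2_coeff_le {p a b M P C lam s h : ℝ} (hC : 0 < C) (ha : 0 ≤ a) (hb : 0 ≤ b)
    (hM : 0 ≤ M) (hlam : 0 ≤ lam) (hp : p ^ 2 ≤ lam ^ 2) (hpMb : 4 * (p ^ 2 * M * b) ≤ lam ^ 2)
    (hs : 2 * lam ≤ s) :
    h ^ 2 * (p ^ 2 * (a + 8 * M * b * P ^ 2 * C ^ 4)) ≤
      ((√(a + 8 * P ^ 2 * C ^ 4) / C ^ 2 + 1) * (1 + s * C ^ 2) * h) ^ 2 := by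
  set S := a + 8 * P ^ 2 * C ^ 4 with hS
  have hS0 : 0 ≤ S := by positivity
  have hpos : 0 ≤ p ^ 2 * M * b := by positivity
  have h1 : p ^ 2 * (a + 8 * M * b * P ^ 2 * C ^ 4) ≤ lam ^ 2 * S := by
    calc _ = p ^ 2 * a + (p ^ 2 * M * b) * (8 * P ^ 2 * C ^ 4) := by ring
      _ ≤ lam ^ 2 * a + lam ^ 2 * (8 * P ^ 2 * C ^ 4) := by
        gcongr
        linarith
      _ = _ := by rw [hS]; ring
  have h2 : lam * √S ≤ (√S / C ^ 2 + 1) * (1 + s * C ^ 2) := by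
    have h3 : lam * C ^ 2 ≤ s * C ^ 2 := by gcongr; linarith
    calc lam * √S = √S / C ^ 2 * (lam * C ^ 2) := by field_simp
      _ ≤ (√S / C ^ 2 + 1) * (1 + s * C ^ 2) :=
        mul_le_mul (by linarith) (by linarith) (by positivity) (by positivity)
  calc _ ≤ h ^ 2 * (lam ^ 2 * S) := by gcongr
    _ = (lam * √S) ^ 2 * h ^ 2 := by rw [mul_pow, Real.sq_sqrt hS0]; ring
    _ ≤ ((√S / C ^ 2 + 1) * (1 + s * C ^ 2)) ^ 2 * h ^ 2 := by gcongr
    _ = _ := by ring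

/-- Of `ω⁴`, one `ω²` stays in the squared coefficient `(s ω h)²`, and the other is the weight of
`‖z‖²` in the squared norm `‖z‖_{V,ω}²`. -/
theorem v_coeff_le {p b M ω lam s h : ℝ} (hlam : 0 ≤ lam) (hpMb : 4 * (p ^ 2 * M * b) ≤ lam ^ 2)
    (hs : 2 * lam ≤ s) :
    h ^ 2 * (8 * p ^ 2 * M * b * ω ^ 4) ≤ (s * ω * h) ^ 2 * ω ^ 2 := by
  calc _ = h ^ 2 * (2 * (4 * (p ^ 2 * M * b)) * ω ^ 4) := by ring
    _ ≤ h ^ 2 * (2 * lam ^ 2 * ω ^ 4) := by gcongr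
    _ ≤ h ^ 2 * (4 * lam ^ 2 * ω ^ 4) := by gcongr; norm_num
    _ = (2 * lam) ^ 2 * (h ^ 2 * ω ^ 4) := by ring
    _ ≤ s ^ 2 * (h ^ 2 * ω ^ 4) := by gcongr
    _ = _ := by ring

end TrefftzDG

open TrefftzDG
theorem mainTheorem6 (d : ℕ) (hd : 2 ≤ d) (σ : ShapeParams) :
    ∃ Cpf > 0, ∃ Citr > 0,
      (∀ (Ω : Set (E d)), IsLipschitzDomain Ω → ∀ T : Mesh Ω, T.ShapeRegular σ →
        ∀ K ∈ T.elems, PoincareFriedrichs K Cpf ∧ InverseTrace K Citr) ∧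
      ∀ CΩ > 0, ∃ cA0 : ℕ → ℝ,
        (∀ p, 1 ≤ p → 0 < cA0 p ∧
          ∀ (Ω : Set (E d)), IsLipschitzDomain Ω → ∀ ω > 0, ∀ T : Mesh Ω,
            T.ShapeRegular σ → T.A0 ω CΩ → T.ProtoCoercive ω p (cA0 p)) ∧
        ∀ (Ω : Set (E d)), IsLipschitzDomain Ω → ∃ Cconf > 0,
          ∀ p, 1 ≤ p → ∀ ω > 0, ∀ T : Mesh Ω, T.ShapeRegular σ → T.A0 ω CΩ →
            ∀ C₂ > 0, 1 - 2 * √Cpf / cA0 p * √(CΩ * T.h) ≥ C₂ →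
              ∀ z : E d → ℂ, MemH2 Ω z →
                ∃ zh : E d → ℂ, T.IsTrefftz ω p zh ∧
                  (∃ v w : E d → ℂ, T.IsPiecewisePoly 1 v ∧ T.IsBubble p w ∧
                    ∀ x, zh x = v x - w x) ∧
                  T.dgPlusNorm ω p (fun x => z x - zh x) ≤
                    ENNReal.ofReal
                      (Cconf * (1 + 2 * √(1 + Citr ^ 2) * √Cpf * (cA0 p)⁻¹ * C₂⁻¹ * CΩ ^ 2) * T.h)
                        * h2Seminorm Ω z
                    + ENNReal.ofReal
                      (2 * √(1 + Citr ^ 2) * √Cpf * (cA0 p)⁻¹ * C₂⁻¹ * ω * T.h) * vNorm Ω ω z := by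
  have hd1 : 1 ≤ d := by omega
  obtain ⟨Cpf, hCpf1, hCpf⟩ := exists_poincareFriedrichs hd1 σ
  obtain ⟨Citr, hCitr0, hCitr⟩ := exists_inverseTrace hd1 σ
  refine ⟨Cpf, by linarith, Citr, hCitr0, fun Ω _ T hT K hK =>
    ⟨hCpf Ω T hT.1 K hK, hCitr Ω T hT.1 K hK⟩, fun CΩ hC => ?_⟩
  choose c₀ hc₀pos hc₀ using fun p => exists_protoCoercive hd1 σ hC p
  choose M hM using fun p => exists_bubble_const hd1 p (2 * σ.gam)
  set a₁ := apxC d σ CΩ with ha₁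
  set b₁ := bubC d σ CΩ with hb₁
  set P := poinConst d (2 * σ.gam) with hP
  have ha0 : 0 ≤ a₁ := apxC_nonneg hC
  have hb0 : 0 ≤ b₁ := bubC_nonneg hC
  set Λ : ℕ → ℝ := fun p => 2 * p * (1 + M p) * (1 + b₁) with hΛ
  have hΛpos : ∀ p, 1 ≤ p → 0 < Λ p := fun p hp => by
    have : (0 : ℝ) < p := by exact_mod_cast hp
    positivity
  -- Lowering the constant preserves coercivity and makes its inverse at least `Λ p`, which
  -- dominates all factors depending on `p`.
  set cA0 : ℕ → ℝ := fun p => min (c₀ p) (Λ p)⁻¹ with hcA0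
  have hcpos : ∀ p, 1 ≤ p → 0 < cA0 p := fun p hp =>
    lt_min (hc₀pos p) (inv_pos.2 (hΛpos p hp))
  refine ⟨cA0, fun p hp => ⟨hcpos p hp, fun Ω _ ω hω T hT hA0 =>
    hc₀ p _ (min_le_left _ _) Ω T ω hω hT.1 hA0⟩, fun Ω _ => ?_⟩
  -- Only `d`, the shape parameters and `CΩ` enter here; the degree is hidden in `cA0⁻¹`.
  refine ⟨√(a₁ + 8 * P ^ 2 * CΩ ^ 4) / CΩ ^ 2 + 1, by positivity,
    fun p hp ω hω T hT hA0 C₂ hC₂ hsm z hz => ?_⟩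
  have hA1 := hT.1
  have hh0 : 0 ≤ T.h := Real.sSup_nonneg (by rintro _ ⟨K, -, rfl⟩; exact Metric.diam_nonneg)
  have hc := hcpos p hp
  obtain ⟨hX, hC2⟩ := smallness_bounds hCpf1 hc (by positivity) hC₂ hsm
  set lam := (cA0 p)⁻¹ with hlam
  have hlam0 : 0 ≤ lam := (inv_pos.2 hc).le
  have hΛlam : Λ p ≤ lam := by
    rw [hlam, le_inv_comm₀ (hΛpos p hp) hc]
    exact min_le_right _ _
  have hp1 : (1 : ℝ) ≤ p := by exact_mod_cast hp
  have hM0 : (0 : ℝ) ≤ M p := (M p).coe_nonneg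
  obtain ⟨hpMb, hp2, hMlam⟩ := param_bounds hp1 hM0 hb0 hΛlam
  obtain ⟨v, w, hv, hw, hT', hest⟩ := hA1.exists_trefftz hd1 hω hC hA0 hp (hM p)
    (fun K hK => small_of_le hA0 hh0 (hA1.isStarBall hK).pos.le (hA1.two_mul_rad_le hd1 hK) hX hMlam
      ((one_le_pow₀ hp1).trans hp2)) hz
  refine ⟨fun x => v x - w x, hT', ⟨v, w, hv, hw, fun _ => rfl⟩, ?_⟩
  set s := 2 * √(1 + Citr ^ 2) * √Cpf * lam * C₂⁻¹ with hs
  have hsq1 : 1 ≤ √Cpf := Real.one_le_sqrt.2 hCpf1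
  have hst1 : 1 ≤ √(1 + Citr ^ 2) := Real.one_le_sqrt.2 (by linarith [sq_nonneg Citr])
  -- The remaining factors of the prescribed constant, `√(1 + Citr²)`, `√Cpf` and `C₂⁻¹`, are all at
  -- least 1.
  have hs2 : 2 * lam ≤ s := by
    calc 2 * lam = 2 * 1 * 1 * lam * 1 := by ring
      _ ≤ s := by rw [hs]; gcongr
  refine rpow_half_le (by positivity) (by positivity) (hest.trans (add_le_add ?_ ?_))
  · exact mul_le_mul' (ENNReal.ofReal_le_ofReal (h2_coeff_le hC ha0 hb0 hM0 hlam0 hp2 hpMb hs2)) le_rfl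
  -- Only the mass part of `‖z‖_{V,ω}²` is used.
  · refine (mul_le_mul' (ENNReal.ofReal_le_ofReal (v_coeff_le hlam0 hpMb hs2)) le_rfl).trans ?_
    rw [ENNReal.ofReal_mul (by positivity), mul_assoc]
    exact mul_le_mul' le_rfl le_add_self
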